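/- **Itô formula for $q$-Brownian motion.** Let $q\in(-1,1)$, $n\in\mathbb N$, $\mathfrak H=L^2(\mathbb R)^n$ (real). On the algebraic Fock space $\bigoplus_k\mathfrak H^{\otimes k}$ with vacuum $\mathbf 1$ let $\xi_q(f)=\alpha^\dagger(f)+\alpha_q(f)$, where $\alpha^\dagger(f)x=f\otimes x$, $\alpha_q(f)\mathbf 1=0$ and $\alpha_q(f)(f_1\otimes\cdots\otimes f_k)=\sum_i q^{i-1}\langle f,f_i\rangle f_1\otimes\cdots\widehat{f_i}\cdots\otimes f_k$. Let $\mathfrak A_q$ be the algebra generated by the $\xi_q(f)$; each $A\in\mathfrak A_q$ is determined by $A\mathbf 1=\sum_kF_k$, $F_k\in\mathfrak H^{\otimes k}$. Let $\mathscr A_q$ be the Banach algebra obtained by completing $\mathfrak A_q$ in the norm $\sum_k(k+1)C_q^{3/2}D_q^k\|F_k\|$, with $C_q=\prod_{m\ge1}(1-|q|^m)^{-1}$, $D_q=(1-|q|)^{-1}$ and $\|\cdot\|$ the Hilbert tensor norm. Let $\omega_q$ be the vacuum state ($A\mapsto F_0$), let $\Delta_q\in\mathcal B(\mathscr A_q)$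 be given by $F_k\mapsto q^kF_k$, and let $\Delta_q^{R;(1,1),(1,2)}(a_0\otimes a_1\otimes a_2)=a_0\,\Delta_q(a_1)\,a_2$ on $\mathscr A_q^{\hat\otimes_\pi3}$. Put $\xi^i_q(f)=\xi_q(fe_i)$, $B_q^i(s,t)=\mathrm{sgn}(t-s)\,\xi_q^i(\mathbf 1_{[s,t]})$ (with $[s,t]$ the interval between $s$ and $t$), $B_q(t)=(B_q^i(0,t))_{i}$. For a mollifier $\rho$ (smooth, compactly supported, even, nonnegative, of integral one) let $\xi_q^{i,(\varepsilon)}(t)=\xi_q^i(\varepsilon^{-1}\rho((\cdot-t)/\varepsilon))$, $B_q^{i,(\varepsilon)}(s,t)=\int_s^t\xi_q^{i,(\varepsilon)}$, $B_q^{(\varepsilon)}(t)=B_q^{(\varepsilon)}(0,t)$. Let $F(X)=\sum_m\sum_{k\in[n]^m}[\![A_{m,k};X^k]\!]$, $A_{m,k}\in\mathscr A_q^{\hat\otimes_\pi(m+1)}$, be $\mathscr A_q$-analytic, where $[\![A_1\otimes\cdots\otimes A_{m+1};X^k]\!]=A_1X_{k_1}A_2\cdots X_{k_m}A_{m+1}$,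 with radius of convergence at least $R\in[0,\infty]$ (that is, $\sum_mr^m\sum_k\|A_{m,k}\|<\infty$ for all finite $0\le r<R$), or let $F$ be the lift $A_{m,k}=c_{m,k}\mathbf 1^{\otimes(m+1)}$ of a scalar power series with $\sum_mr^m\sum_k|c_{m,k}|<\infty$ for all finite $0\le r<R$. Define by linear extension, for one word, $$D_iF(X)=\sum_{r=1}^m\delta_{i,k_r}\,A_1X_{k_1}\cdots A_r\otimes A_{r+1}X_{k_{r+1}}\cdots A_{m+1},$$ $$D_iD_jF(X)=\sum_{1\le r<s\le m}\delta_{i,k_r}\delta_{j,k_s}\,A_1X_{k_1}\cdots A_r\otimes A_{r+1}X_{k_{r+1}}\cdots A_s\otimes A_{s+1}\cdots A_{m+1},$$ and $(a\otimes b)[h]=ahb$, $(a\otimes b\otimes c)[T]=a\,T(b)\,c$ for $h\in\mathscr A_q$, $T\in\mathcal B(\mathscr A_q)$. *Lifts.* Let $(C_{ij})$ be any real $n\times n$ matrix. Then there are unique operators $\Pi^L_{ij,s}(\varphi),\Pi^R_{ij,s}(\varphi)\in\mathcal B(\mathscr A_q)$, $s\in\mathbb R$, $\varphi\in\mathscr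 D(\mathbb R)$ (the lift with constants $C$: the model on the two products of a noise with an integrated noise) such that for every mollifier and all $\ell^{L}_{ij}(\varepsilon)\to C_{ij}$, $\ell^{R}_{ij}(\varepsilon)\to C_{ji}$, in operator norm as $\varepsilon\downarrow0$, $$\int\varphi(t)\bigl(B_q^{i,(\varepsilon)}(s,t)\,(\cdot)\,\xi_q^{j,(\varepsilon)}(t)-\ell^L_{ij}(\varepsilon)\Delta_q\bigr)dt\to\Pi^L_{ij,s}(\varphi),\qquad \int\varphi(t)\bigl(\xi_q^{i,(\varepsilon)}(t)\,(\cdot)\,B_q^{j,(\varepsilon)}(s,t)-\ell^R_{ij}(\varepsilon)\Delta_q\bigr)dt\to\Pi^R_{ij,s}(\varphi).$$ The choice $C_{ij}=\delta_{ij}/2$ is the Itô lift, its constants being, for every mollifier and $\varepsilon>0$, $\lim_{T\to\infty}\omega_q(B_q^{i,(\varepsilon)}(0,T)\xi_q^{j,(\varepsilon)}(0))=\lim_{T\to\infty}\omega_q(\xi_q^{i,(\varepsilon)}(0)B_q^{j,(\varepsilon)}(0,T))=\delta_{ij}/2$; the choice $C_{ij}=0$ is the Stratonovich lift. *Formula.*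 Let $\Omega\subseteq\mathbb R$ be open with $\|B_q^i(t)\|<R$ for all $t\in\Omega$ and all $i$ ($\Omega=\mathbb R$ if $R=\infty$). There is a unique $\mathscr A_q$-valued distribution on $\Omega$, denoted $\sum_iD_iF(B_q)[\xi_q^i]$, that is the reconstruction of $$G_s(\varphi)=\sum_iD_iF(B_q(s))[\xi_q^i(\varphi)]+\sum_{i,j}D_iD_jF(B_q(s))\bigl[\Pi^L_{ij,s}(\varphi)+\Pi^R_{ij,s}(\varphi)\bigr],$$ i.e. for some $\gamma>0$ its difference with $G_s$ tested against $\lambda^{-1}\eta((\cdot-s)/\lambda)$ is $O(\lambda^\gamma)$, $\lambda\in(0,1]$, uniformly over smooth $\eta$ supported in $[-1,1]$ with $|\eta|,|\eta'|\le1$ and over $[s-\lambda,s+\lambda]\subseteq K$, for each compact $K\subset\Omega$. In the sense of distributions on $\Omega$, $$\partial_tF(B_q(t))=\sum_{i}D_iF(B_q(t))[\xi_q^i]+\sum_{i,j}(C_{ij}+C_{ji})\,\Delta_q^{R;(1,1),(1,2)}\bigl(D_iD_jF(B_q(t))\bigr).$$ Moreover, for every mollifier, $\partial_tF(B_q^{(\varepsilon)}(t))=\sum_iD_iF(B_q^{(\varepsilon)}(t))[\xi_q^{i,(\varepsilon)}(t)]$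 for all $\varepsilon>0$ and all $t$ with $\max_i\|B_q^{i,(\varepsilon)}(t)\|<R$, and, for all $\ell^L_{ij}(\varepsilon)\to C_{ij}$, $\ell^R_{ij}(\varepsilon)\to C_{ji}$, the functions $\sum_iD_iF(B_q^{(\varepsilon)})[\xi_q^{i,(\varepsilon)}]-\sum_{i,j}(\ell^L_{ij}(\varepsilon)+\ell^R_{ij}(\varepsilon))\Delta_q^{R;(1,1),(1,2)}(D_iD_jF(B_q^{(\varepsilon)}))$ converge to $\sum_iD_iF(B_q)[\xi_q^i]$ against every test function on $\Omega$ as $\varepsilon\downarrow0$. No filtration enters. -/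

import Mathlib

open scoped TensorProduct

noncomputable section

namespace Mezdon

/-- A bundled real inner product space. -/
structure IPS where
  carrier : Type
  [grp : NormedAddCommGroup carrier]
  [ips : InnerProductSpace ℝ carrier]

attribute [instance] IPS.grp IPS.ips

section Fields

variable (H : Type) [NormedAddCommGroup H] [InnerProductSpace ℝ H]

/-- The algebraic tensor powers of `H`, with their Hilbert tensor inner product. -/
def tpowBundle : ℕ → IPS
  | 0 => ⟨ℝ⟩
  | k + 1 => ⟨H ⊗[ℝ] (tpowBundle k).carrier⟩

/-- The `k`-th algebraic tensor power `H^{⊗k}`, with the Hilbert tensor norm. -/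
def TPow (k : ℕ) : Type := (tpowBundle H k).carrier

instance (k : ℕ) : NormedAddCommGroup (TPow H k) := (tpowBundle H k).grp
instance (k : ℕ) : InnerProductSpace ℝ (TPow H k) := (tpowBundle H k).ips

/-- The identification `H^{⊗0} = ℝ`. -/
def nil : ℝ ≃ₗᵢ[ℝ] TPow H 0 := LinearIsometryEquiv.refl ℝ ℝ
/-- The identification `H^{⊗(k+1)} = H ⊗ H^{⊗k}`. -/
def cons (k : ℕ) : (H ⊗[ℝ] TPow H k) ≃ₗᵢ[ℝ] TPow H (k + 1) :=
  LinearIsometryEquiv.refl ℝ (H ⊗[ℝ] TPow H k)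

variable {H}

/-- The contraction `g ⊗ x ↦ ⟨f, g⟩ x`. -/
def contr {E : Type} [AddCommGroup E] [Module ℝ E] : H →ₗ[ℝ] H ⊗[ℝ] E →ₗ[ℝ] E :=
  { toFun := fun f => (TensorProduct.lid ℝ E).toLinearMap ∘ₗ LinearMap.rTensor E (innerₗ H f)
    map_add' := by intros; ext; simp
    map_smul' := by intros; ext; simp }

@[simp] lemma contr_tmul {E : Type} [AddCommGroup E] [Module ℝ E] (f g : H) (x : E) :
    contr f (g ⊗ₜ[ℝ] x) = inner ℝ f g • x := by simp [contr]

@[simp] lemma cons_symm_cons {k : ℕ} (x : H ⊗[ℝ] TPow H k) : (cons H k).symm (cons H k x) = x := by simp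

/-- The pure tensor `f ⊗ x`. -/
def tens {k : ℕ} (f : H) (x : TPow H k) : TPow H (k + 1) := cons H k (f ⊗ₜ[ℝ] x)

lemma ext_tens {k : ℕ} {M : Type*} [AddCommGroup M] [Module ℝ M] {A B : TPow H (k+1) →ₗ[ℝ] M}
    (h : ∀ f x, A (tens f x) = B (tens f x)) : A = B := by
  have : A ∘ₗ (cons H k).toLinearEquiv.toLinearMap = B ∘ₗ (cons H k).toLinearEquiv.toLinearMap := by
    ext f x; exact h f x
  ext z
  obtain ⟨w, rfl⟩ := (cons H k).surjective z
  exact LinearMap.congr_fun this w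

/-- The `q`-annihilation `f₁ ⊗ ⋯ ⊗ f_k ↦ ∑ᵢ q^{i-1} ⟨f, fᵢ⟩ f₁ ⊗ ⋯ f̂ᵢ ⋯ ⊗ f_k`, given recursively by
`g ⊗ x ↦ ⟨f, g⟩ x + q g ⊗ annL f x`. -/
def annL (q : ℝ) : (k : ℕ) → H →ₗ[ℝ] TPow H (k + 1) →ₗ[ℝ] TPow H k
  | 0 => (contr (H := H)).compr₂ LinearMap.id |>.compl₂ (cons H 0).symm.toLinearEquiv.toLinearMap
  | k + 1 => 
    ((contr (H := H)) + 
     { toFun := fun f => q • ((cons H k).toLinearEquiv.toLinearMap ∘ₗ LinearMap.lTensor H (annL q k f))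
       map_add' := by intros; simp [LinearMap.comp_add, LinearMap.lTensor_add]
       map_smul' := by intros; simp [LinearMap.lTensor_smul, LinearMap.comp_smul, smul_comm q] }).compl₂ (cons H (k+1)).symm.toLinearEquiv.toLinearMap

@[simp] lemma annL_zero_tens (q : ℝ) (f g : H) (x : TPow H 0) : annL q 0 f (tens g x) = inner ℝ f g • x := by
  simp [annL, tens]
@[simp] lemma annL_succ_tens (q : ℝ) (k : ℕ) (f g : H) (x : TPow H (k+1)) :
   annL q (k+1) f (tens g x) = inner ℝ f g • x + q • tens g (annL q k f x) := by
  simp [annL, tens]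

/-- The `q`-annihilation counted from the right, `f₁ ⊗ ⋯ ⊗ f_k ↦ ∑ᵢ q^{k-i} ⟨f, fᵢ⟩ f₁ ⊗ ⋯ f̂ᵢ ⋯ ⊗ f_k`.
It serves only to compute products of Wick powers. -/
def annR (q : ℝ) : (k : ℕ) → H →ₗ[ℝ] TPow H (k + 1) →ₗ[ℝ] TPow H k
  | 0 => (contr (H := H)).compl₂ (cons H 0).symm.toLinearEquiv.toLinearMap
  | k + 1 =>
    (q ^ (k + 1) • (contr (H := H) (E := TPow H (k + 1))) +
      ({ toFun := fun f => (cons H k).toLinearEquiv.toLinearMap ∘ₗ LinearMap.lTensor H (annR q k f)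
         map_add' := by intros; simp [LinearMap.comp_add, LinearMap.lTensor_add]
         map_smul' := by intros; simp [LinearMap.lTensor_smul, LinearMap.comp_smul] } :
        H →ₗ[ℝ] H ⊗[ℝ] TPow H (k + 1) →ₗ[ℝ] TPow H (k + 1))).compl₂
          (cons H (k + 1)).symm.toLinearEquiv.toLinearMap

@[simp] lemma annR_zero_tens (q : ℝ) (f g : H) (x : TPow H 0) :
    annR q 0 f (tens g x) = (inner ℝ f g : ℝ) • x := by
  simp [annR, tens]

@[simp] lemma annR_succ_tens (q : ℝ) (k : ℕ) (f g : H) (x : TPow H (k + 1)) :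
    annR q (k + 1) f (tens g x) = (q ^ (k + 1) * inner ℝ f g) • x + tens g (annR q k f x) := by
  simp [annR, tens, mul_smul]

/-- Adding a letter on the left, `x ↦ f ⊗ x`. -/
def tensL (k : ℕ) : H →ₗ[ℝ] TPow H k →ₗ[ℝ] TPow H (k + 1) :=
  (TensorProduct.mk ℝ H (TPow H k)).compr₂ (cons H k).toLinearEquiv.toLinearMap

@[simp] lemma tensL_apply (k : ℕ) (f : H) (x : TPow H k) : tensL k f x = tens f x := rfl

lemma annL_annR (q : ℝ) (k : ℕ) (f g : H) :
    annL q k f ∘ₗ annR q (k + 1) g = annR q k g ∘ₗ annL q (k + 1) f := by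
  induction k with
  | zero =>
    refine ext_tens fun h x => ?_
    simp [smul_smul]
    abel_nf
  | succ k ih =>
    refine ext_tens fun h x => ?_
    have := LinearMap.congr_fun ih x
    simp only [LinearMap.comp_apply] at this
    simp [this, smul_add, smul_smul]
    module

variable (H) in
/-- The algebraic Fock space `⨁ₖ H^{⊗k}`. -/
abbrev Fock : Type := DirectSum ℕ (fun k => TPow H k)

variable (H) in
/-- The inclusion of `H^{⊗k}`. -/
abbrev lof (k : ℕ) : TPow H k →ₗ[ℝ] Fock H := DirectSum.lof ℝ ℕ (fun k => TPow H k) k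

variable (H) in
/-- The vacuum vector `1`. -/
def vac : Fock H := lof H 0 (nil H 1)

/-- The creation operator `α†(f)`. -/
def cre (f : H) : Fock H →ₗ[ℝ] Fock H :=
  DirectSum.toModule ℝ ℕ _ fun k => lof H (k + 1) ∘ₗ tensL k f

/-- The `q`-annihilation operator `α_q(f)`; it kills the vacuum. -/
def annF (q : ℝ) (f : H) : Fock H →ₗ[ℝ] Fock H :=
  DirectSum.toModule ℝ ℕ _ fun
    | 0 => 0
    | k + 1 => lof H k ∘ₗ annL q k f

/-- The annihilation from the right on Fock space. -/
def annRF (q : ℝ) : H →ₗ[ℝ] Fock H →ₗ[ℝ] Fock H where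
  toFun g := DirectSum.toModule ℝ ℕ _ fun
    | 0 => 0
    | k + 1 => lof H k ∘ₗ annR q k g
  map_add' f g := by
    refine DirectSum.linearMap_ext _ fun k => ?_
    ext x; cases k <;> simp
  map_smul' c g := by
    refine DirectSum.linearMap_ext _ fun k => ?_
    ext x; cases k <;> simp

variable (H) in
/-- The second quantisation `Γ_q` of `q`: multiplication by `q ^ k` on `H^{⊗k}`. -/
def secQ (q : ℝ) : Fock H →ₗ[ℝ] Fock H :=
  DirectSum.toModule ℝ ℕ _ fun k => q ^ k • lof H k

@[simp] lemma cre_lof (f : H) (k : ℕ) (x : TPow H k) : cre f (lof H k x) = lof H (k + 1) (tens f x) := by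
  simp [cre]
@[simp] lemma annF_lof_zero (q : ℝ) (f : H) (x : TPow H 0) : annF q f (lof H 0 x) = 0 := by
  simp [annF]
@[simp] lemma annF_lof_succ (q : ℝ) (f : H) (k : ℕ) (x : TPow H (k + 1)) :
    annF q f (lof H (k + 1) x) = lof H k (annL q k f x) := by
  simp [annF]
@[simp] lemma annRF_lof_zero (q : ℝ) (f : H) (x : TPow H 0) : annRF q f (lof H 0 x) = 0 := by
  simp [annRF]
@[simp] lemma annRF_lof_succ (q : ℝ) (f : H) (k : ℕ) (x : TPow H (k + 1)) :
    annRF q f (lof H (k + 1) x) = lof H k (annR q k f x) := by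
  simp [annRF]
@[simp] lemma secQ_lof (q : ℝ) (k : ℕ) (x : TPow H k) : secQ H q (lof H k x) = q ^ k • lof H k x := by
  simp [secQ]

lemma fock_ext {M : Type*} [AddCommGroup M] [Module ℝ M] {A B : Fock H →ₗ[ℝ] M}
    (h : ∀ k x, A (lof H k x) = B (lof H k x)) : A = B := by
  refine DirectSum.linearMap_ext _ fun k => ?_
  ext x; exact h k x

/-- The field operator `ξ_q(f) = α†(f) + α_q(f)`. -/
def field (q : ℝ) (f : H) : Module.End ℝ (Fock H) := cre f + annF q f

lemma annRF_field (q : ℝ) (f g : H) (x : Fock H) :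
    annRF q g (field q f x) = field q f (annRF q g x) + (inner ℝ g f : ℝ) • secQ H q x := by
  suffices h : annRF q g ∘ₗ field q f = field q f ∘ₗ annRF q g + (inner ℝ g f : ℝ) • secQ H q by
    exact LinearMap.congr_fun h x
  refine fock_ext fun k x => ?_
  rcases k with _ | _ | k
  · simp [field]
  · simp [field]
    module
  · have := LinearMap.congr_fun (annL_annR q k f g) x
    simp only [LinearMap.comp_apply] at this
    simp [field, this, mul_smul]
    module

lemma annRF_secQ (q : ℝ) (g : H) (x : Fock H) :
    annRF q g (secQ H q x) = q • secQ H q (annRF q g x) := by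
  suffices h : annRF q g ∘ₗ secQ H q = q • secQ H q ∘ₗ annRF q g by
    exact LinearMap.congr_fun h x
  refine fock_ext fun k x => ?_
  rcases k with _ | k
  · simp
  · simp [smul_smul, pow_succ']

lemma field_vac (q : ℝ) (f : H) : field q f (vac H) = lof H 1 (tens f (nil H 1)) := by
  simp [field, vac]

lemma annF_cre (q : ℝ) (f g : H) (x : Fock H) :
    annF q f (cre g x) = (inner ℝ f g : ℝ) • x + q • cre g (annF q f x) := by
  suffices h : annF q f ∘ₗ cre g = (inner ℝ f g : ℝ) • LinearMap.id + q • cre g ∘ₗ annF q f by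
    exact LinearMap.congr_fun h x
  refine fock_ext fun k x => ?_
  rcases k with _ | k <;> simp

/-- Insertion of a letter in front of the second tensor factor. -/
def ins (r : ℕ) (g : H) : Fock H ⊗[ℝ] TPow H r →ₗ[ℝ] Fock H ⊗[ℝ] TPow H (r + 1) :=
  LinearMap.lTensor (Fock H) (tensL r g)

/-- `V n r y x` collects the ways of contracting all but `r` letters of `y` with the right end of `x`. -/
def V (q : ℝ) : (n r : ℕ) → TPow H n →ₗ[ℝ] Fock H →ₗ[ℝ] Fock H ⊗[ℝ] TPow H r
  | 0, 0 => (TensorProduct.mk ℝ (Fock H) (TPow H 0)).flip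
  | 0, _ + 1 => 0
  | n + 1, 0 =>
    TensorProduct.lift (LinearMap.mk₂ ℝ (fun g y => V q n 0 y ∘ₗ annRF q g)
      (by intros; simp [LinearMap.comp_add]) (by intros; simp [LinearMap.comp_smul])
      (by intros; simp [LinearMap.add_comp]) (by intros; simp [LinearMap.smul_comp])) ∘ₗ
        (cons H n).symm.toLinearEquiv.toLinearMap
  | n + 1, r + 1 =>
    TensorProduct.lift (LinearMap.mk₂ ℝ
      (fun g y => q ^ (n - r) • (ins r g ∘ₗ V q n r y) + V q n (r + 1) y ∘ₗ annRF q g)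
      (by intros; simp [ins, LinearMap.comp_add, LinearMap.lTensor_add, LinearMap.add_comp]; abel)
      (by intros; simp [ins, LinearMap.comp_smul, LinearMap.lTensor_smul, LinearMap.smul_comp,
            smul_comm (q ^ (n - r))])
      (by intros; simp [LinearMap.comp_add, LinearMap.add_comp]; abel)
      (by intros; simp [LinearMap.comp_smul, LinearMap.smul_comp, smul_comm (q ^ (n - r))])) ∘ₗ
        (cons H n).symm.toLinearEquiv.toLinearMap

@[simp] lemma V_zero_zero (q : ℝ) (y : TPow H 0) (x : Fock H) : V q 0 0 y x = x ⊗ₜ y := by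
  simp [V]
@[simp] lemma V_zero_succ (q : ℝ) (r : ℕ) (y : TPow H 0) (x : Fock H) : V q 0 (r + 1) y x = 0 := by
  simp [V]
@[simp] lemma V_succ_zero (q : ℝ) (n : ℕ) (g : H) (y : TPow H n) (x : Fock H) :
    V q (n + 1) 0 (tens g y) x = V q n 0 y (annRF q g x) := by
  simp [V, tens]
@[simp] lemma V_succ_succ (q : ℝ) (n r : ℕ) (g : H) (y : TPow H n) (x : Fock H) :
    V q (n + 1) (r + 1) (tens g y) x =
      q ^ (n - r) • ins r g (V q n r y x) + V q n (r + 1) y (annRF q g x) := by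
  simp [V, tens]

lemma ext_tens_apply {k : ℕ} {M : Type*} [AddCommGroup M] [Module ℝ M] (A B : TPow H (k+1) →ₗ[ℝ] M)
    (h : ∀ f x, A (tens f x) = B (tens f x)) (y : TPow H (k + 1)) : A y = B y :=
  LinearMap.congr_fun (ext_tens h) y

lemma V_eq_zero (q : ℝ) (n : ℕ) : ∀ r, n < r → V (H := H) q n r = 0 := by
  induction n with
  | zero =>
    rintro (_ | r) h
    · omega
    · rfl
  | succ n ih =>
    rintro (_ | r) h
    · omega
    · refine ext_tens (M := Fock H →ₗ[ℝ] Fock H ⊗[ℝ] TPow H (r + 1)) fun g y => LinearMap.ext fun x => ?_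
      simp [ih r (by omega), ih (r + 1) (by omega)]

lemma V_secQ (q : ℝ) (n r : ℕ) (y : TPow H n) (x : Fock H) :
    V q n r y (secQ H q x) = q ^ (n - r) • LinearMap.rTensor _ (secQ H q) (V q n r y x) := by
  induction n generalizing r x with
  | zero =>
    rcases r with _ | r <;> simp
  | succ n ih =>
    rcases r with _ | r
    · refine ext_tens_apply ((V q (n + 1) 0).flip (secQ H q x))
        (q ^ (n + 1 - 0) • LinearMap.rTensor _ (secQ H q) ∘ₗ (V q (n + 1) 0).flip x) (fun g y => ?_) y
      simp [annRF_secQ, ih, smul_smul, pow_succ']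
    · refine ext_tens_apply ((V q (n + 1) (r + 1)).flip (secQ H q x))
        (q ^ (n + 1 - (r + 1)) • LinearMap.rTensor _ (secQ H q) ∘ₗ (V q (n + 1) (r + 1)).flip x) (fun g y => ?_) y
      have e : ∀ t : Fock H ⊗[ℝ] TPow H r, ins r g (LinearMap.rTensor _ (secQ H q) t) =
          LinearMap.rTensor (TPow H (r + 1)) (secQ H q) (ins r g t) := by
        intro t
        simp only [ins, ← LinearMap.comp_apply, LinearMap.lTensor_comp_rTensor, LinearMap.rTensor_comp_lTensor]
      rcases lt_or_ge r n with h | h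
      · obtain ⟨d, rfl⟩ := Nat.exists_eq_add_of_lt h
        simp [annRF_secQ, ih, smul_smul, e, show r + d + 1 - r = d + 1 by omega,
          show r + d + 1 - (r + 1) = d by omega, pow_succ']
      · simp [annRF_secQ, ih, e, V_eq_zero q n (r + 1) (by omega)]

lemma V_field (q : ℝ) (f : H) (n r : ℕ) (y : TPow H n) (x : Fock H) :
    V q n r y (field q f x) = LinearMap.rTensor _ (field q f) (V q n r y x) +
      TensorProduct.map (secQ H q) (annL q r f) (V q n (r + 1) y x) := by
  induction n generalizing r x with
  | zero =>
    rcases r with _ | r <;> simp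
  | succ n ih =>
    have e : ∀ r (g : H) t, TensorProduct.map (secQ H q) (annL q (r + 1) f) (ins (r + 1) g t) =
        (inner ℝ f g : ℝ) • LinearMap.rTensor _ (secQ H q) t + 
        q • ins r g (TensorProduct.map (secQ H q) (annL q r f) t) := by
      intro r g t
      induction t using TensorProduct.induction_on with
      | zero => simp
      | add a b ha hb => simp only [map_add, ha, hb, smul_add]; abel
      | tmul a b => simp [ins, TensorProduct.tmul_add]
    have e0 : ∀ (g : H) t, TensorProduct.map (secQ H q) (annL q 0 f) (ins 0 g t) =
        (inner ℝ f g : ℝ) • LinearMap.rTensor _ (secQ H q) t := by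
      intro g t
      induction t using TensorProduct.induction_on with
      | zero => simp
      | add a b ha hb => simp only [map_add, ha, hb, smul_add]
      | tmul a b => simp [ins]
    have e1 : ∀ r (g : H) t, ins r g (LinearMap.rTensor _ (field q f) t) = LinearMap.rTensor _ (field q f) (ins r g t) := by
        intro r g t
        simp only [ins, ← LinearMap.comp_apply, LinearMap.lTensor_comp_rTensor, LinearMap.rTensor_comp_lTensor]
    rcases r with _ | r
    · refine ext_tens_apply ((V q (n + 1) 0).flip (field q f x))
        (LinearMap.rTensor _ (field q f) ∘ₗ (V q (n + 1) 0).flip x +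
          TensorProduct.map (secQ H q) (annL q 0 f) ∘ₗ (V q (n + 1) 1).flip x) (fun g y => ?_) y
      simp only [LinearMap.flip_apply, LinearMap.add_apply, LinearMap.comp_apply, V_succ_zero,
        V_succ_succ, map_add, map_smul, annRF_field, ih, V_secQ, e0, Nat.sub_zero,
        real_inner_comm f g]
      module
    · refine ext_tens_apply ((V q (n + 1) (r + 1)).flip (field q f x))
        (LinearMap.rTensor _ (field q f) ∘ₗ (V q (n + 1) (r + 1)).flip x +
          TensorProduct.map (secQ H q) (annL q (r + 1) f) ∘ₗ (V q (n + 1) (r + 2)).flip x) (fun g y => ?_) y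
      simp only [LinearMap.flip_apply, LinearMap.add_apply, LinearMap.comp_apply, 
        V_succ_succ, map_add, map_smul, annRF_field, ih, V_secQ, e, e1, 
        real_inner_comm f g]
      rcases lt_or_ge r n with h | h
      · obtain ⟨d, rfl⟩ := Nat.exists_eq_add_of_lt h
        simp only [show r + d + 1 - r = d + 1 by omega, show r + d + 1 - (r + 1) = d by omega, pow_succ']
        module
      · simp [V_eq_zero q n (r + 1) (by omega)]

lemma cre_add (f g : H) : cre (f + g) = cre f + cre g :=
  fock_ext fun k x => by simp [tens, TensorProduct.add_tmul]

lemma cre_smul (c : ℝ) (f : H) : cre (c • f) = c • cre f :=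
  fock_ext fun k x => by simp [tens, ← TensorProduct.smul_tmul']

/-- Concatenation of tensors. -/
def cat : (k r : ℕ) → TPow H k →ₗ[ℝ] TPow H r →ₗ[ℝ] Fock H
  | 0, r => (LinearMap.lsmul ℝ (Fock H)).compl₂ (lof H r) ∘ₗ (nil H).symm.toLinearEquiv.toLinearMap
  | k + 1, r =>
    TensorProduct.lift (LinearMap.mk₂ ℝ (fun f x => cre f ∘ₗ cat k r x)
      (by intros; simp [cre_add, LinearMap.add_comp]) (by intros; simp [cre_smul, LinearMap.smul_comp])
      (by intros; simp [LinearMap.comp_add]) (by intros; simp [LinearMap.comp_smul])) ∘ₗ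
        (cons H k).symm.toLinearEquiv.toLinearMap

@[simp] lemma cat_zero (r : ℕ) (x : TPow H 0) (z : TPow H r) :
    cat 0 r x z = (nil H).symm x • lof H r z := by
  simp [cat]

@[simp] lemma cat_succ (k r : ℕ) (f : H) (x : TPow H k) (z : TPow H r) :
    cat (k + 1) r (tens f x) z = cre f (cat k r x z) := by
  simp [cat, tens]

/-- Concatenation as a map on the tensor product. -/
def join (r : ℕ) : Fock H ⊗[ℝ] TPow H r →ₗ[ℝ] Fock H :=
  TensorProduct.lift (DirectSum.toModule ℝ ℕ _ fun k => cat k r)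

@[simp] lemma join_lof (k r : ℕ) (x : TPow H k) (z : TPow H r) :
    join r (lof H k x ⊗ₜ z) = cat k r x z := by
  simp [join]

lemma cat_annF_zero (q : ℝ) (f : H) (k : ℕ) (x : TPow H k) (z : TPow H 0) :
    annF q f (cat k 0 x z) = join 0 (annF q f (lof H k x) ⊗ₜ z) := by
  induction k with
  | zero => simp
  | succ k ih =>
    refine ext_tens_apply (annF q f ∘ₗ (cat (k + 1) 0).flip z)
      (join 0 ∘ₗ (TensorProduct.mk ℝ _ _).flip z ∘ₗ annF q f ∘ₗ lof H (k + 1)) (fun g y => ?_) x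
    simp only [LinearMap.comp_apply, LinearMap.flip_apply, cat_succ, annF_cre, ih,
      annF_lof_succ, TensorProduct.mk_apply, join_lof]
    rcases k with _ | k
    · simp
    · simp

lemma cat_annF_succ (q : ℝ) (f : H) (k r : ℕ) (x : TPow H k) (z : TPow H (r + 1)) :
    annF q f (cat k (r + 1) x z) = join (r + 1) (annF q f (lof H k x) ⊗ₜ z) +
      q ^ k • cat k r x (annL q r f z) := by
  induction k with
  | zero => simp
  | succ k ih =>
    refine ext_tens_apply (annF q f ∘ₗ (cat (k + 1) (r + 1)).flip z)
      (join (r + 1) ∘ₗ (TensorProduct.mk ℝ _ _).flip z ∘ₗ annF q f ∘ₗ lof H (k + 1) +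
        q ^ (k + 1) • (cat (k + 1) r).flip (annL q r f z)) (fun g y => ?_) x
    simp only [LinearMap.comp_apply, LinearMap.flip_apply, cat_succ, annF_cre, ih,
      annF_lof_succ, TensorProduct.mk_apply, join_lof, LinearMap.add_apply, LinearMap.smul_apply]
    rcases k with _ | k
    · simp
    · simp [smul_smul, pow_succ']
      module

lemma field_join_zero (q : ℝ) (f : H) (t : Fock H ⊗[ℝ] TPow H 0) :
    field q f (join 0 t) = join 0 (LinearMap.rTensor _ (field q f) t) := by
  suffices h : field q f ∘ₗ join 0 = join 0 ∘ₗ LinearMap.rTensor _ (field q f) by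
    exact LinearMap.congr_fun h t
  refine TensorProduct.ext (fock_ext fun k x => ?_)
  refine LinearMap.ext fun z => ?_
  have := cat_annF_zero q f k x z
  simp [field, this]

lemma field_join_succ (q : ℝ) (f : H) (r : ℕ) (t : Fock H ⊗[ℝ] TPow H (r + 1)) :
    field q f (join (r + 1) t) = join (r + 1) (LinearMap.rTensor _ (field q f) t) +
      join r (TensorProduct.map (secQ H q) (annL q r f) t) := by
  suffices h : field q f ∘ₗ join (r + 1) = join (r + 1) ∘ₗ LinearMap.rTensor _ (field q f) +
      join r ∘ₗ TensorProduct.map (secQ H q) (annL q r f) by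
    exact LinearMap.congr_fun h t
  refine TensorProduct.ext (fock_ext fun k x => ?_)
  refine LinearMap.ext fun z => ?_
  have := cat_annF_succ q f k r x z
  simp [field, this, ← TensorProduct.smul_tmul', add_assoc]

/-- Right multiplication by the Wick power of `y` in the vacuum representation. -/
def star (q : ℝ) (n : ℕ) : TPow H n →ₗ[ℝ] Fock H →ₗ[ℝ] Fock H :=
  ∑ r ∈ Finset.range (n + 1), (V q n r).compr₂ (join r)

lemma star_apply (q : ℝ) (n : ℕ) (y : TPow H n) (x : Fock H) :
    star q n y x = ∑ r ∈ Finset.range (n + 1), join r (V q n r y x) := by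
  simp [star]

lemma star_field (q : ℝ) (f : H) (n : ℕ) (y : TPow H n) (x : Fock H) :
    star q n y (field q f x) = field q f (star q n y x) := by
  simp only [star_apply, V_field, map_add, map_sum, Finset.sum_add_distrib]
  rw [Finset.sum_range_succ' (fun r => field q f (join r (V q n r y x))), field_join_zero]
  simp only [field_join_succ, Finset.sum_add_distrib]
  rw [Finset.sum_range_succ' (fun r => join r (LinearMap.rTensor _ (field q f) (V q n r y x))),
    Finset.sum_range_succ (fun r => join r (TensorProduct.map (secQ H q) (annL q r f) (V q n (r + 1) y x)))]
  simp only [V_eq_zero q n (n + 1) (by omega), LinearMap.zero_apply, map_zero, add_zero]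
  abel

lemma annRF_vac (q : ℝ) (g : H) : annRF q g (vac H) = 0 := by simp [vac]

lemma V_vac_lt (q : ℝ) (n : ℕ) : ∀ (r : ℕ) (y : TPow H n), r < n → V q n r y (vac H) = 0 := by
  induction n with
  | zero => intro r y h; omega
  | succ n ih =>
    rintro (_ | r) y h
    · exact ext_tens_apply ((V q (n + 1) 0).flip (vac H)) 0 (fun g y => by simp [annRF_vac]) y
    · exact ext_tens_apply ((V q (n + 1) (r + 1)).flip (vac H)) 0 (fun g y => by
        simp [annRF_vac, ih r y (by omega)]) y

lemma V_vac_self (q : ℝ) (n : ℕ) : ∀ (y : TPow H n), V q n n y (vac H) = vac H ⊗ₜ y := by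
  induction n with
  | zero => simp
  | succ n ih =>
    intro y
    exact ext_tens_apply ((V q (n + 1) (n + 1)).flip (vac H)) (TensorProduct.mk ℝ _ _ (vac H)) (fun g y => by
        simp [annRF_vac, ih y, ins]) y

lemma star_vac (q : ℝ) (n : ℕ) (y : TPow H n) : star q n y (vac H) = lof H n y := by
  rw [star_apply, Finset.sum_range_succ, Finset.sum_eq_zero, V_vac_self]
  · simp [vac]
  · intro r hr
    rw [V_vac_lt q n r y (Finset.mem_range.1 hr), map_zero]

/-- The algebra generated by the field operators. -/
def fieldAlg (H : Type) [NormedAddCommGroup H] [InnerProductSpace ℝ H] (q : ℝ) :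
    Subalgebra ℝ (Module.End ℝ (Fock H)) :=
  Algebra.adjoin ℝ (Set.range (field q))

lemma star_mem (q : ℝ) (n : ℕ) (y : TPow H n) (A : Module.End ℝ (Fock H)) (hA : A ∈ fieldAlg H q) :
    ∀ x, star q n y (A x) = A (star q n y x) := by
  induction hA using Algebra.adjoin_induction with
  | mem a ha => obtain ⟨f, rfl⟩ := ha; exact star_field q f n y
  | algebraMap r => intro x; simp [Module.algebraMap_end_apply]
  | add a b _ _ ha hb => intro x; simp [ha, hb]
  | mul a b _ _ ha hb => intro x; simp [ha, hb]

lemma apply_lof (q : ℝ) (n : ℕ) (y : TPow H n) (A : Module.End ℝ (Fock H)) (hA : A ∈ fieldAlg H q) :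
    A (lof H n y) = star q n y (A (vac H)) := by
  rw [star_mem q n y A hA, star_vac]

lemma vac_inj (q : ℝ) (A : Module.End ℝ (Fock H)) (hA : A ∈ fieldAlg H q) (h : A (vac H) = 0) :
    A = 0 :=
  fock_ext fun k x => by rw [apply_lof q k x A hA, h]; simp

lemma exists_vac_lof (q : ℝ) (k : ℕ) : ∀ x : TPow H k, ∃ A ∈ fieldAlg H q, A (vac H) = lof H k x := by
  induction k using Nat.strong_induction_on with
  | _ k ih =>
  rcases k with _ | k
  · intro x
    obtain ⟨c, rfl⟩ := (nil H).surjective x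
    refine ⟨algebraMap ℝ _ c, Subalgebra.algebraMap_mem _ _, ?_⟩
    rw [Module.algebraMap_end_apply, vac, ← map_smul, ← map_smul]; simp
  · intro x
    obtain ⟨w, rfl⟩ := (cons H k).surjective x
    induction w using TensorProduct.induction_on with
    | zero => exact ⟨0, Subalgebra.zero_mem _, by simp⟩
    | add a b ha hb =>
      obtain ⟨A, hA, hA'⟩ := ha
      obtain ⟨B, hB, hB'⟩ := hb
      exact ⟨A + B, Subalgebra.add_mem _ hA hB, by simp [hA', hB']⟩
    | tmul f y =>
      obtain ⟨A, hA, hA'⟩ := ih k (by omega) y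
      have hf : field q f ∈ fieldAlg H q := Algebra.subset_adjoin ⟨f, rfl⟩
      rcases k with _ | k
      · exact ⟨field q f * A, Subalgebra.mul_mem _ hf hA, by simp [hA', field, tens]⟩
      · obtain ⟨B, hB, hB'⟩ := ih k (by omega) (annL q k f y)
        exact ⟨field q f * A - B, Subalgebra.sub_mem _ (Subalgebra.mul_mem _ hf hA) hB, by
          simp [hA', hB', field, tens]⟩

lemma exists_vac (q : ℝ) (z : Fock H) : ∃ A ∈ fieldAlg H q, A (vac H) = z := by
  induction z using DirectSum.induction_on with
  | zero => exact ⟨0, Subalgebra.zero_mem _, by simp⟩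
  | of k x => exact exists_vac_lof q k x
  | add a b ha hb =>
    obtain ⟨A, hA, hA'⟩ := ha
    obtain ⟨B, hB, hB'⟩ := hb
    exact ⟨A + B, Subalgebra.add_mem _ hA hB, by simp [hA', hB']⟩

/-- The vacuum map `A ↦ A 1`. -/
def vacEquiv (H : Type) [NormedAddCommGroup H] [InnerProductSpace ℝ H] (q : ℝ) :
    fieldAlg H q ≃ₗ[ℝ] Fock H :=
  LinearEquiv.ofBijective
    ((LinearMap.applyₗ (vac H) : Module.End ℝ (Fock H) →ₗ[ℝ] Fock H) ∘ₗ
      (fieldAlg H q).val.toLinearMap)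
    ⟨(injective_iff_map_eq_zero _).2 fun A h => Subtype.ext (vac_inj q A.1 A.2 h),
      fun z => let ⟨A, hA, h⟩ := exists_vac q z; ⟨⟨A, hA⟩, h⟩⟩

lemma norm_sq_sum_tmul {ι : Type*} [Fintype ι] {E : Type} [NormedAddCommGroup E]
    [InnerProductSpace ℝ E] {e : ι → H} (he : Orthonormal ℝ e) (y : ι → E) :
    ‖∑ i, e i ⊗ₜ[ℝ] y i‖ ^ 2 = ∑ i, ‖y i‖ ^ 2 := by
  classical
  rw [← real_inner_self_eq_norm_sq, sum_inner]
  refine Finset.sum_congr rfl fun i _ => ?_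
  rw [inner_sum, Finset.sum_eq_single i]
  · simp [he.1 i]
  · intro j _ hj
    simp [TensorProduct.inner_tmul, he.2 hj.symm]
  · simp

lemma exists_orthonormal {E : Type} [NormedAddCommGroup E] [InnerProductSpace ℝ E]
    (z : H ⊗[ℝ] E) : ∃ (m : ℕ) (e : Fin m → H) (y : Fin m → E), Orthonormal ℝ e ∧
      z = ∑ i, e i ⊗ₜ[ℝ] y i := by
  obtain ⟨S, rfl⟩ := TensorProduct.exists_finset z
  classical
  let U : Submodule ℝ H := Submodule.span ℝ (S.image Prod.fst : Finset H)
  let b := stdOrthonormalBasis ℝ U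
  refine ⟨_, fun i => (b i : H), fun i => ∑ s ∈ S, (inner ℝ (b i : H) s.1 : ℝ) • s.2,
    b.orthonormal.comp_linearIsometry U.subtypeₗᵢ, ?_⟩
  simp only [TensorProduct.tmul_sum]
  rw [Finset.sum_comm]
  refine Finset.sum_congr rfl fun s hs => ?_
  have hs' : s.1 ∈ U := Submodule.subset_span (by simpa using ⟨s.2, hs⟩)
  have := congrArg (Subtype.val) (b.sum_repr' ⟨s.1, hs'⟩)
  simp only [Submodule.coe_inner] at this
  push_cast at this
  conv_lhs => rw [← this]
  rw [TensorProduct.sum_tmul]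
  refine Finset.sum_congr rfl fun i _ => ?_
  rw [TensorProduct.smul_tmul]

lemma exists_orthonormal_tens {k : ℕ} (z : TPow H (k + 1)) :
    ∃ (m : ℕ) (e : Fin m → H) (y : Fin m → TPow H k), Orthonormal ℝ e ∧
      z = ∑ i, tens (e i) (y i) := by
  obtain ⟨w, rfl⟩ := (cons H k).surjective z
  obtain ⟨m, e, y, he, rfl⟩ := exists_orthonormal w
  exact ⟨m, e, y, he, by simp [tens]⟩

lemma norm_sq_sum_tens {ι : Type*} [Fintype ι] {k : ℕ} {e : ι → H} (he : Orthonormal ℝ e)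
    (y : ι → TPow H k) : ‖∑ i, tens (e i) (y i)‖ ^ 2 = ∑ i, ‖y i‖ ^ 2 := by
  rw [← norm_sq_sum_tmul he, ← (cons H k).norm_map]; simp [tens]

lemma sum_mul_le {ι : Type*} (s : Finset ι) (a b : ι → ℝ) {A B : ℝ} (hA : 0 ≤ A) (hB : 0 ≤ B)
    (h1 : ∑ i ∈ s, a i ^ 2 ≤ A ^ 2) (h2 : ∑ i ∈ s, b i ^ 2 ≤ B ^ 2) :
    ∑ i ∈ s, a i * b i ≤ A * B := by
  refine abs_le_of_sq_le_sq' (?_ : _ ≤ (A * B) ^ 2) (by positivity) |>.2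
  calc _ ≤ _ := Finset.sum_mul_sq_le_sq_mul_sq s a b
    _ ≤ A ^ 2 * B ^ 2 := by gcongr
    _ = _ := by ring

lemma sum_norm_add_sq_le {ι : Type*} (s : Finset ι) {E : Type*} [SeminormedAddCommGroup E]
    (a b : ι → E) {A B : ℝ} (hA : 0 ≤ A) (hB : 0 ≤ B)
    (h1 : ∑ i ∈ s, ‖a i‖ ^ 2 ≤ A ^ 2) (h2 : ∑ i ∈ s, ‖b i‖ ^ 2 ≤ B ^ 2) :
    ∑ i ∈ s, ‖a i + b i‖ ^ 2 ≤ (A + B) ^ 2 := by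
  have := sum_mul_le s (fun i => ‖a i‖) (fun i => ‖b i‖) hA hB h1 h2
  calc _ ≤ ∑ i ∈ s, (‖a i‖ ^ 2 + 2 * (‖a i‖ * ‖b i‖) + ‖b i‖ ^ 2) := by
        gcongr with i
        nlinarith [norm_add_le (a i) (b i), norm_nonneg (a i + b i)]
    _ ≤ _ := by
        rw [Finset.sum_add_distrib, Finset.sum_add_distrib, ← Finset.mul_sum]
        nlinarith

lemma sum_contr_sq_le {ι : Type*} [Fintype ι] {k : ℕ} {e : ι → H} (he : Orthonormal ℝ e)
    (x : TPow H (k + 1)) : ∑ i, ‖contr (e i) ((cons H k).symm x)‖ ^ 2 ≤ ‖x‖ ^ 2 := by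
  set z := (cons H k).symm x
  set w := ∑ i, e i ⊗ₜ[ℝ] contr (e i) z with hw
  have h : ∀ t : H ⊗[ℝ] TPow H k, inner ℝ t w = ∑ i, (inner ℝ (contr (e i) t) (contr (e i) z) : ℝ) := by
    intro t
    induction t using TensorProduct.induction_on with
    | zero => simp
    | add a b ha hb => simp [inner_add_left, ha, hb, Finset.sum_add_distrib]
    | tmul f y =>
      rw [hw, inner_sum]
      simp [TensorProduct.inner_tmul, inner_smul_left, real_inner_comm]
  have h1 : inner ℝ z w = ‖w‖ ^ 2 := by
    rw [h, hw, norm_sq_sum_tmul he]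
    simp
  have h2 : ‖x‖ = ‖z‖ := ((cons H k).symm.norm_map x).symm
  rw [← norm_sq_sum_tmul he, ← hw, h2]
  have h3 := real_inner_le_norm z w
  rw [h1] at h3
  have : ‖w‖ ≤ ‖z‖ := by
    rcases (norm_nonneg w).eq_or_lt with h0 | h0
    · rw [← h0]; positivity
    · nlinarith
  gcongr

lemma geom_le (q : ℝ) (hq : |q| < 1) (k : ℕ) : ∑ j ∈ Finset.range k, |q| ^ j ≤ (1 - |q|)⁻¹ := by
  rw [← tsum_geometric_of_lt_one (abs_nonneg q) hq]
  exact (summable_geometric_of_lt_one (abs_nonneg q) hq).sum_le_tsum _ fun _ _ => by positivity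

lemma sum_annR_sq_le (q : ℝ) (k : ℕ) {ι : Type*} [Fintype ι] {e : ι → H}
    (he : Orthonormal ℝ e) (x : TPow H (k + 1)) :
    ∑ i, ‖annR q k (e i) x‖ ^ 2 ≤ ((∑ j ∈ Finset.range (k + 1), |q| ^ j) * ‖x‖) ^ 2 := by
  induction k with
  | zero => simpa [annR] using sum_contr_sq_le he x
  | succ k ih =>
    obtain ⟨m, f, y, hf, rfl⟩ := exists_orthonormal_tens x
    set x := ∑ a, tens (f a) (y a) with hx
    have e1 : ∀ i, annR q (k + 1) (e i) x = ∑ a, tens (f a) (annR q k (e i) (y a)) +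
        q ^ (k + 1) • contr (e i) ((cons H (k + 1)).symm x) := by
      intro i
      simp only [hx, map_sum, annR_succ_tens, Finset.sum_add_distrib, Finset.smul_sum]
      refine (add_comm _ _).trans ?_
      simp [tens, mul_smul]
    simp only [e1]
    rw [Finset.sum_range_succ, add_mul]
    refine sum_norm_add_sq_le _ _ _ (by positivity) (by positivity) ?_ ?_
    · simp only [norm_sq_sum_tens hf]
      rw [Finset.sum_comm, mul_pow, norm_sq_sum_tens hf, Finset.mul_sum]
      refine Finset.sum_le_sum fun a _ => ?_
      rw [← mul_pow]
      exact ih (y a)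
    · simp only [norm_smul, mul_pow, ← Finset.mul_sum, norm_pow, Real.norm_eq_abs]
      gcongr
      exact sum_contr_sq_le he x

lemma V_eq_zero_of_lt (q : ℝ) (n : ℕ) : ∀ (m r : ℕ) (y : TPow H n) (x : TPow H m), m + r < n →
    V q n r y (lof H m x) = 0 := by
  induction n with
  | zero => intro m r y x h; omega
  | succ n ih =>
    rintro m (_ | r) y x h
    · refine ext_tens_apply ((V q (n + 1) 0).flip (lof H m x)) 0 (fun g y => ?_) y
      rcases m with _ | m
      · simp
      · simp [ih m 0 y _ (by omega)]
    · refine ext_tens_apply ((V q (n + 1) (r + 1)).flip (lof H m x)) 0 (fun g y => ?_) y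
      rcases m with _ | m
      · simp [ih 0 r y _ (by omega)]
      · simp [ih m (r + 1) y _ (by omega), ih (m + 1) r y _ (by omega)]

lemma norm_sq_sum_ins {p r : ℕ} {ι : Type*} [Fintype ι] {e : ι → H} (he : Orthonormal ℝ e)
    (w : ι → TPow H p ⊗[ℝ] TPow H r) :
    ‖∑ i, LinearMap.lTensor (TPow H p) (tensL r (e i)) (w i)‖ ^ 2 = ∑ i, ‖w i‖ ^ 2 := by
  classical
  rw [← real_inner_self_eq_norm_sq, sum_inner]
  have h : ∀ i j (s t : TPow H p ⊗[ℝ] TPow H r),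
      inner ℝ (LinearMap.lTensor (TPow H p) (tensL r (e i)) s)
        (LinearMap.lTensor (TPow H p) (tensL r (e j)) t) = (inner ℝ (e i) (e j) * inner ℝ s t : ℝ) := by
    intro i j s t
    induction s using TensorProduct.induction_on with
    | zero => simp
    | add a b ha hb => simp [inner_add_left, ha, hb, mul_add]
    | tmul a b =>
      induction t using TensorProduct.induction_on with
      | zero => simp
      | add a b ha hb => simp only [map_add, inner_add_right, ha, hb, mul_add]
      | tmul c d => 
        simp [TensorProduct.inner_tmul, tens]; ring
  refine Finset.sum_congr rfl fun i _ => ?_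
  rw [inner_sum, Finset.sum_eq_single i]
  · rw [h, real_inner_self_eq_norm_sq, he.1 i, one_pow, one_mul]
    exact real_inner_self_eq_norm_sq (w i)
  · intro j _ hj
    simp [h, he.2 hj.symm]
  · simp

lemma rTensor_ins {p r : ℕ} (g : H) (w : TPow H p ⊗[ℝ] TPow H r) :
    ins r g (LinearMap.rTensor _ (lof H p) w) =
      LinearMap.rTensor _ (lof H p) (LinearMap.lTensor (TPow H p) (tensL r g) w) := by
  simp only [ins, ← LinearMap.comp_apply, LinearMap.lTensor_comp_rTensor,
    LinearMap.rTensor_comp_lTensor]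

lemma sum_annR_bound {q : ℝ} (hq : |q| < 1) {k n : ℕ} {ι : Type*} [Fintype ι] {e : ι → H}
    (he : Orthonormal ℝ e) (x : TPow H (k + 1)) (y : ι → TPow H n) :
    ∑ i, ‖annR q k (e i) x‖ * ‖y i‖ ≤ ((1 - |q|)⁻¹ * ‖x‖) * ‖∑ i, tens (e i) (y i)‖ := by
  have hD : 0 ≤ (1 - |q|)⁻¹ := inv_nonneg.2 (by linarith)
  refine sum_mul_le _ _ _ (by positivity) (by positivity) ?_ (norm_sq_sum_tens he y).ge
  refine (sum_annR_sq_le q k he x).trans ?_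
  gcongr
  exact geom_le q hq _

lemma V_est {q : ℝ} (hq : |q| < 1) (n : ℕ) : ∀ (m r p : ℕ) (y : TPow H n) (x : TPow H m),
    m + r = p + n → ∃ w : TPow H p ⊗[ℝ] TPow H r,
      V q n r y (lof H m x) = LinearMap.rTensor _ (lof H p) w ∧
        ‖w‖ ≤ (1 - |q|)⁻¹ ^ (2 * (n - r)) * (‖x‖ * ‖y‖) := by
  have hD1 : 1 ≤ (1 - |q|)⁻¹ := (one_le_inv₀ (by linarith)).2 (by linarith [abs_nonneg q])
  have hqD : |q| * (1 - |q|)⁻¹ + 1 = (1 - |q|)⁻¹ := by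
    have : 1 - |q| ≠ 0 := by linarith
    field_simp
    ring
  set D := (1 - |q|)⁻¹ with hD
  induction n with
  | zero =>
    rintro m (_ | r) p y x h
    · obtain rfl : m = p := by omega
      exact ⟨x ⊗ₜ y, by simp, by simp⟩
    · exact ⟨0, by simp, by simp; positivity⟩
  | succ n ih =>
    rintro m (_ | r) p y x h
    · obtain ⟨a, e, z, he, rfl⟩ := exists_orthonormal_tens y
      obtain ⟨m, rfl⟩ : ∃ m', m = m' + 1 := ⟨p + n, by omega⟩
      choose w hw hw' using fun i => ih m 0 p (z i) (annR q m (e i) x) (by omega)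
      refine ⟨∑ i, w i, by simp [hw], ?_⟩
      have := sum_annR_bound hq he x z
      calc _ ≤ ∑ i, ‖w i‖ := norm_sum_le _ _
        _ ≤ ∑ i, D ^ (2 * n) * (‖annR q m (e i) x‖ * ‖z i‖) := Finset.sum_le_sum fun i _ => hw' i
        _ ≤ D ^ (2 * n) * ((D * ‖x‖) * ‖∑ i, tens (e i) (z i)‖) := by
          rw [← Finset.mul_sum]; gcongr
        _ = D ^ (2 * n + 1) * (‖x‖ * ‖∑ i, tens (e i) (z i)‖) := by ring
        _ ≤ _ := by gcongr; first | exact hD1 | omega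
    · obtain ⟨a, e, z, he, rfl⟩ := exists_orthonormal_tens y
      choose w hw hw' using fun i => ih m r p (z i) x (by omega)
      have h1 : ‖∑ i, LinearMap.lTensor (TPow H p) (tensL r (e i)) (w i)‖ ≤
          D ^ (2 * (n - r)) * (‖x‖ * ‖∑ i, tens (e i) (z i)‖) := by
        refine abs_le_of_sq_le_sq' (?_ : _ ≤ _ ^ 2) (by positivity) |>.2
        rw [norm_sq_sum_ins he, mul_pow, mul_pow, norm_sq_sum_tens he, Finset.mul_sum,
          Finset.mul_sum]
        refine Finset.sum_le_sum fun i _ => ?_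
        rw [← mul_pow, ← mul_pow]
        exact pow_le_pow_left₀ (norm_nonneg _) (hw' i) 2
      obtain ⟨v, hv, hv'⟩ : ∃ v : TPow H p ⊗[ℝ] TPow H (r + 1),
          ∑ i, V q n (r + 1) (z i) (annRF q (e i) (lof H m x)) = LinearMap.rTensor _ (lof H p) v ∧
            |q| ^ (n - r) * (D ^ (2 * (n - r)) * (‖x‖ * ‖∑ i, tens (e i) (z i)‖)) + ‖v‖ ≤
              D ^ (2 * (n - r)) * (‖x‖ * ‖∑ i, tens (e i) (z i)‖) := by
        have hq1 : |q| ^ (n - r) ≤ 1 := pow_le_one₀ (abs_nonneg q) hq.le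
        have hX : 0 ≤ D ^ (2 * (n - r)) * (‖x‖ * ‖∑ i, tens (e i) (z i)‖) := by positivity
        rcases lt_or_ge r n with hr | hr
        · rcases m with _ | m
          · exact ⟨0, by simp, by simpa using mul_le_of_le_one_left hX hq1⟩
          · choose u hu hu' using fun i => ih m (r + 1) p (z i) (annR q m (e i) x) (by omega)
            refine ⟨∑ i, u i, by simp [hu], ?_⟩
            have := sum_annR_bound hq he x z
            obtain ⟨d, rfl⟩ := Nat.exists_eq_add_of_lt hr
            simp only [show r + d + 1 - (r + 1) = d by omega] at hu'
            rw [show r + d + 1 - r = d + 1 by omega]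
            set Y := ‖∑ i, tens (e i) (z i)‖
            have h2 : ‖∑ i, u i‖ ≤ D ^ (2 * d + 1) * (‖x‖ * Y) := by
              calc _ ≤ ∑ i, ‖u i‖ := norm_sum_le _ _
                _ ≤ ∑ i, D ^ (2 * d) * (‖annR q m (e i) x‖ * ‖z i‖) :=
                  Finset.sum_le_sum fun i _ => hu' i
                _ ≤ D ^ (2 * d) * ((D * ‖x‖) * Y) := by rw [← Finset.mul_sum]; gcongr
                _ = _ := by ring
            have h3 : |q| ^ (d + 1) ≤ |q| := by
              rw [pow_succ]
              exact mul_le_of_le_one_left (abs_nonneg q) (pow_le_one₀ (abs_nonneg q) hq.le)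
            calc _ ≤ |q| * (D ^ (2 * (d + 1)) * (‖x‖ * Y)) + D ^ (2 * d + 1) * (‖x‖ * Y) := by
                  gcongr
              _ = D ^ (2 * d + 1) * (‖x‖ * Y) * (|q| * D + 1) := by ring
              _ = _ := by rw [hqD]; ring
        · refine ⟨0, by simp [V_eq_zero q n (r + 1) (by omega)], ?_⟩
          simpa using mul_le_of_le_one_left hX hq1
      refine ⟨q ^ (n - r) • ∑ i, LinearMap.lTensor (TPow H p) (tensL r (e i)) (w i) + v, ?_, ?_⟩
      · simp only [map_sum, V_succ_succ, LinearMap.sum_apply, Finset.sum_add_distrib, hv, hw,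
          rTensor_ins, map_add, map_smul, Finset.smul_sum]
      · rw [show n + 1 - (r + 1) = n - r by omega]
        refine (norm_add_le _ _).trans (le_trans ?_ hv')
        rw [norm_smul, norm_pow, Real.norm_eq_abs]
        gcongr

lemma norm_join (k : ℕ) : ∀ (r m : ℕ) (w : TPow H k ⊗[ℝ] TPow H r), m = k + r →
    ∃ v : TPow H m, join r (LinearMap.rTensor _ (lof H k) w) = lof H m v ∧ ‖v‖ = ‖w‖ := by
  induction k with
  | zero =>
    rintro r m w hm
    obtain rfl : m = r := by omega
    let φ : TPow H 0 ⊗[ℝ] TPow H m ≃ₗᵢ[ℝ] TPow H m :=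
      ((nil H).symm.rTensor (TPow H m)).trans (TensorProduct.lidIsometry ℝ _)
    refine ⟨φ w, ?_, φ.norm_map w⟩
    refine LinearMap.congr_fun (f := join m ∘ₗ LinearMap.rTensor _ (lof H 0))
        (g := lof H m ∘ₗ φ.toLinearEquiv.toLinearMap) (TensorProduct.ext' fun x y => ?_) w
    simp [φ]
  | succ k ih =>
    rintro r m w hm
    obtain ⟨m, rfl⟩ : ∃ m', m = m' + 1 := ⟨k + r, by omega⟩
    let ψ : TPow H (k + 1) ⊗[ℝ] TPow H r ≃ₗᵢ[ℝ] H ⊗[ℝ] (TPow H k ⊗[ℝ] TPow H r) :=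
      ((cons H k).symm.rTensor (TPow H r)).trans (TensorProduct.assocIsometry ℝ _ _ _)
    obtain ⟨t, rfl⟩ := ψ.symm.surjective w
    obtain ⟨a, e, u, he, rfl⟩ := exists_orthonormal t
    choose v hv hv' using fun i => ih r m (u i) (by omega)
    refine ⟨∑ i, tens (e i) (v i), ?_, ?_⟩
    · have h : ∀ (g : H) s, join r (LinearMap.rTensor _ (lof H (k + 1)) (ψ.symm (g ⊗ₜ s))) =
          cre g (join r (LinearMap.rTensor _ (lof H k) s)) := by
        intro g s
        induction s using TensorProduct.induction_on with
        | zero =>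
          rw [TensorProduct.tmul_zero, show ψ.symm 0 = 0 from ψ.symm.map_zero]; simp
        | add a b ha hb =>
          rw [TensorProduct.tmul_add, show ψ.symm (g ⊗ₜ a + g ⊗ₜ b) = ψ.symm (g ⊗ₜ a) + ψ.symm (g ⊗ₜ b)
            from ψ.symm.map_add _ _]
          simp only [map_add, ha, hb]
        | tmul x z =>
          have : ψ.symm (g ⊗ₜ (x ⊗ₜ z)) = tens g x ⊗ₜ z := by
            rw [LinearIsometryEquiv.symm_apply_eq]; simp [ψ, tens]
          simp [this]
      rw [show ψ.symm (∑ i, e i ⊗ₜ u i) = ∑ i, ψ.symm (e i ⊗ₜ u i) from map_sum ψ.symm.toLinearEquiv _ _]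
      simp only [map_sum, h, hv, cre_lof]
    · rw [ψ.symm.norm_map, ← sq_eq_sq₀ (norm_nonneg _) (norm_nonneg _), norm_sq_sum_tens he,
        norm_sq_sum_tmul he]
      simp only [hv']

/-- The constant `C_q = ∏_{n ≥ 1} (1 - |q|^n)⁻¹`. -/
def Cq (q : ℝ) : ℝ := ∏' n : ℕ, (1 - |q| ^ (n + 1))⁻¹

/-- The constant `D_q = (1 - |q|)⁻¹`. -/
def Dq (q : ℝ) : ℝ := (1 - |q|)⁻¹

/-- The norm `∑ₖ (k + 1) C_q^{3/2} D_q^k ‖zₖ‖` on the algebraic Fock space. -/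
def fockNorm (q : ℝ) (z : Fock H) : ℝ :=
  ∑' k : ℕ, ((k : ℝ) + 1) * Cq q ^ (3 / 2 : ℝ) * Dq q ^ k * ‖z k‖

lemma one_le_Cq {q : ℝ} (hq : |q| < 1) : 1 ≤ Cq q := by
  unfold Cq
  by_cases h : Multipliable fun n : ℕ => (1 - |q| ^ (n + 1))⁻¹
  · refine ge_of_tendsto' h.hasProd fun s => ?_
    refine Finset.prod_induction _ (fun x : ℝ => 1 ≤ x) (fun a b ha hb => one_le_mul_of_one_le_of_one_le ha hb)
      le_rfl fun n _ => ?_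
    have h1 : |q| ^ (n + 1) < 1 := pow_lt_one₀ (abs_nonneg q) hq (by omega)
    exact (one_le_inv₀ (by linarith)).2 (by linarith [pow_nonneg (abs_nonneg q) (n + 1)])
  · rw [tprod_eq_one_of_not_multipliable h]

lemma fockNorm_summable (q : ℝ) (z : Fock H) :
    Summable fun k : ℕ => ((k : ℝ) + 1) * Cq q ^ (3 / 2 : ℝ) * Dq q ^ k * ‖z k‖ := by
  classical
  refine summable_of_ne_finset_zero (s := DFinsupp.support z) fun k hk => ?_
  rw [DFinsupp.notMem_support_iff.1 hk]; simp

lemma Cq_pow_one_le {q : ℝ} (hq : |q| < 1) : 1 ≤ Cq q ^ (3 / 2 : ℝ) := Real.one_le_rpow (one_le_Cq hq) (by norm_num)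

lemma one_le_Dq {q : ℝ} (hq : |q| < 1) : 1 ≤ Dq q := (one_le_inv₀ (by linarith)).2 (by linarith [abs_nonneg q])

lemma weight_pos {q : ℝ} (hq : |q| < 1) (k : ℕ) : 0 < ((k : ℝ) + 1) * Cq q ^ (3 / 2 : ℝ) * Dq q ^ k := by
  have := Cq_pow_one_le hq
  have := one_le_Dq hq
  positivity

lemma fockNorm_nonneg {q : ℝ} (hq : |q| < 1) (z : Fock H) : 0 ≤ fockNorm q z :=
  tsum_nonneg fun k => mul_nonneg (weight_pos hq k).le (norm_nonneg _)

lemma fockNorm_add_le {q : ℝ} (hq : |q| < 1) (z w : Fock H) : fockNorm q (z + w) ≤ fockNorm q z + fockNorm q w := by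
  rw [fockNorm, fockNorm, fockNorm, ← (fockNorm_summable q z).tsum_add (fockNorm_summable q w)]
  refine (fockNorm_summable q _).tsum_le_tsum (fun k => ?_)
    ((fockNorm_summable q z).add (fockNorm_summable q w))
  rw [← mul_add]
  exact mul_le_mul_of_nonneg_left (norm_add_le _ _) (weight_pos hq k).le

lemma fockNorm_eq_zero {q : ℝ} (hq : |q| < 1) (z : Fock H) (h : fockNorm q z = 0) : z = 0 := by
  have h0 := (hasSum_zero_iff_of_nonneg
    (fun k => mul_nonneg (weight_pos hq k).le (norm_nonneg (z k)))).1
      (by rw [← h]; exact (fockNorm_summable q z).hasSum)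
  ext1 k
  have := congrFun h0 k
  simpa [(weight_pos hq k).ne'] using this

lemma fockNorm_sum_le {q : ℝ} (hq : |q| < 1) {ι : Type*} (s : Finset ι) (z : ι → Fock H) :
    fockNorm q (∑ i ∈ s, z i) ≤ ∑ i ∈ s, fockNorm q (z i) := by
  refine Finset.le_sum_of_subadditive (fockNorm q) ?_ (fockNorm_add_le hq) s z
  simp [fockNorm]

lemma fockNorm_smul (q c : ℝ) (z : Fock H) : fockNorm q (c • z) = |c| * fockNorm q z := by
  rw [fockNorm, fockNorm, ← tsum_mul_left]
  refine tsum_congr fun k => ?_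
  have : (c • z) k = c • z k := rfl
  rw [this, norm_smul, Real.norm_eq_abs]; ring

lemma fockNorm_lof (q : ℝ) (k : ℕ) (x : TPow H k) :
    fockNorm q (lof H k x) = ((k : ℝ) + 1) * Cq q ^ (3 / 2 : ℝ) * Dq q ^ k * ‖x‖ := by
  rw [fockNorm, tsum_eq_single k]
  · simp [DirectSum.lof_eq_of, DirectSum.of_eq_same]
  · intro j hj
    simp [DirectSum.lof_eq_of, DirectSum.of_eq_of_ne _ _ _ hj]

lemma count_sum (m n : ℕ) :
    ∑ r ∈ Finset.range (n + 1), (if n ≤ m + r then m + r - n + r + 1 else 0) = (m + 1) * (n + 1) := by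
  induction n generalizing m with
  | zero => simp
  | succ n ih =>
    rcases m with _ | m
    · rw [Finset.sum_range_succ, Finset.sum_eq_zero]
      · simp
      · intro r hr
        rw [Finset.mem_range] at hr
        rw [if_neg (by omega)]
    · rw [Finset.sum_range_succ]
      have : ∀ r, (if n + 1 ≤ m + 1 + r then m + 1 + r - (n + 1) + r + 1 else 0) =
          (if n ≤ m + r then m + r - n + r + 1 else 0) := by
        intro r
        split_ifs <;> omega
      simp only [this]
      rw [ih, if_pos (by omega), show m + (n + 1) - n = m + 1 by omega]
      ring

lemma star_bound {q : ℝ} (hq : |q| < 1) (m n : ℕ) (x : TPow H m) (y : TPow H n) :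
    fockNorm q (star q n y (lof H m x)) ≤ fockNorm q (lof H m x) * fockNorm q (lof H n y) := by
  have hC := Cq_pow_one_le hq
  have hD := one_le_Dq hq
  set C := Cq q ^ (3 / 2 : ℝ) with hCdef
  have key : ∀ r ∈ Finset.range (n + 1), fockNorm q (join r (V q n r y (lof H m x))) ≤
      ((if n ≤ m + r then m + r - n + r + 1 else 0 : ℕ) : ℝ) * (C * Dq q ^ (m + n) * (‖x‖ * ‖y‖)) := by
    intro r hr
    have hr : r ≤ n := by simpa [Nat.lt_succ_iff] using hr
    split_ifs with h
    · obtain ⟨p, hp⟩ : ∃ p, p = m + r - n := ⟨_, rfl⟩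
      obtain ⟨w, hw, hw'⟩ := V_est hq n m r p y x (by omega)
      obtain ⟨v, hv, hv'⟩ := norm_join p r (p + r) w rfl
      rw [hw, hv, fockNorm_lof, hv', ← hp, ← hCdef]
      rw [show m + n = p + r + 2 * (n - r) by omega, pow_add (Dq q) (p + r)]
      calc _ ≤ (((p + r : ℕ) : ℝ) + 1) * C * Dq q ^ (p + r) *
            (Dq q ^ (2 * (n - r)) * (‖x‖ * ‖y‖)) := by
            gcongr; exact hw'
        _ = _ := by push_cast; ring
    · rw [V_eq_zero_of_lt q n m r y x (by omega)]
      simp [fockNorm]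
  rw [star_apply]
  refine (fockNorm_sum_le hq _ _).trans ((Finset.sum_le_sum key).trans ?_)
  rw [← Finset.sum_mul, ← Nat.cast_sum, count_sum, fockNorm_lof, fockNorm_lof, ← hCdef]
  push_cast
  have : 0 ≤ ((m : ℝ) + 1) * (n + 1) * (C * Dq q ^ (m + n) * (‖x‖ * ‖y‖)) := by positivity
  calc _ ≤ C * (((m : ℝ) + 1) * (n + 1) * (C * Dq q ^ (m + n) * (‖x‖ * ‖y‖))) :=
        le_mul_of_one_le_left this hC
    _ = _ := by rw [pow_add]; ring

lemma fockNorm_eq_sum (q : ℝ) (z : Fock H) :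
    ∃ s : Finset ℕ, z = ∑ k ∈ s, lof H k (z k) ∧ fockNorm q z = ∑ k ∈ s, fockNorm q (lof H k (z k)) := by
  classical
  refine ⟨DFinsupp.support z, (DirectSum.sum_support_of z).symm, ?_⟩
  rw [fockNorm, tsum_eq_sum (s := DFinsupp.support z)]
  · simp only [fockNorm_lof]
  · intro k hk
    rw [DFinsupp.notMem_support_iff.1 hk]; simp

lemma fockNorm_apply_le {q : ℝ} (hq : |q| < 1) (A : Module.End ℝ (Fock H)) (hA : A ∈ fieldAlg H q)
    (z : Fock H) : fockNorm q (A z) ≤ fockNorm q (A (vac H)) * fockNorm q z := by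
  obtain ⟨s, hs, hs'⟩ := fockNorm_eq_sum q z
  obtain ⟨t, ht, ht'⟩ := fockNorm_eq_sum q (A (vac H))
  rw [hs', ht']
  conv_lhs => rw [hs]
  simp only [map_sum, apply_lof q _ _ A hA]
  rw [Finset.mul_sum]
  refine (fockNorm_sum_le hq _ _).trans (Finset.sum_le_sum fun k _ => ?_)
  conv_lhs => rw [ht]
  rw [map_sum, Finset.sum_mul]
  exact (fockNorm_sum_le hq _ _).trans (Finset.sum_le_sum fun j _ => star_bound hq _ _ _ _)

lemma secQ_apply (q : ℝ) (z : Fock H) (k : ℕ) : (secQ H q z) k = q ^ k • z k := by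
  suffices h : DirectSum.component ℝ ℕ (fun k => TPow H k) k ∘ₗ secQ H q =
      q ^ k • DirectSum.component ℝ ℕ (fun k => TPow H k) k from LinearMap.congr_fun h z
  refine fock_ext fun j x => ?_
  simp only [LinearMap.comp_apply, secQ_lof, map_smul, LinearMap.smul_apply]
  by_cases h : j = k
  · subst h; rfl
  · have : DirectSum.component ℝ ℕ (fun k => TPow H k) k (lof H j x) = 0 := by
      rw [DirectSum.component.of, dif_neg h]
    rw [this, smul_zero, smul_zero]

lemma fockNorm_secQ_le {q : ℝ} (hq : |q| < 1) (z : Fock H) :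
    fockNorm q (secQ H q z) ≤ fockNorm q z := by
  refine (fockNorm_summable q _).tsum_le_tsum (fun k => ?_) (fockNorm_summable q z)
  refine mul_le_mul_of_nonneg_left ?_ (weight_pos hq k).le
  rw [secQ_apply, norm_smul, norm_pow, Real.norm_eq_abs]
  exact mul_le_of_le_one_left (norm_nonneg _) (pow_le_one₀ (abs_nonneg q) hq.le)

end Fields

section Algebra

/-- The algebra generated by the field operators `ξ_q(f)`, `f ∈ H`, for `q ∈ (-1, 1)`. -/
def FieldAlgebra (H : Type) [NormedAddCommGroup H] [InnerProductSpace ℝ H]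
    (q : Set.Ioo (-1 : ℝ) 1) : Type := fieldAlg H (q : ℝ)

variable (H : Type) [NormedAddCommGroup H] [InnerProductSpace ℝ H] (q : Set.Ioo (-1 : ℝ) 1)

lemma abs_param : |(q : ℝ)| < 1 := abs_lt.2 q.2

instance : Ring (FieldAlgebra H q) := inferInstanceAs (Ring (fieldAlg H (q : ℝ)))
instance : Algebra ℝ (FieldAlgebra H q) := inferInstanceAs (Algebra ℝ (fieldAlg H (q : ℝ)))

/-- The vacuum map `A ↦ A 1`, a linear isomorphism onto the algebraic Fock space. -/
def vacuumEquiv : FieldAlgebra H q ≃ₗ[ℝ] Fock H := vacEquiv H (q : ℝ)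

/-- The norm `∑ₖ (k + 1) C_q^{3/2} D_q^k ‖F_k‖` of `A = ∑ₖ ξ_q^{◇k}(F_k)`, that is `A 1 = ∑ₖ F_k`. -/
def ringNorm : RingNorm (FieldAlgebra H q) where
  toFun A := fockNorm (q : ℝ) (vacuumEquiv H q A)
  map_zero' := by rw [map_zero]; simp [fockNorm]
  add_le' A B := by rw [map_add]; exact fockNorm_add_le (abs_param q) _ _
  neg' A := by rw [map_neg, ← neg_one_smul ℝ (vacuumEquiv H q A), fockNorm_smul]; simp
  mul_le' A B := fockNorm_apply_le (abs_param q) A.1 A.2 _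
  eq_zero_of_map_eq_zero' A h :=
    (vacuumEquiv H q).map_eq_zero_iff.1 (fockNorm_eq_zero (abs_param q) _ h)

instance : NormedRing (FieldAlgebra H q) := (ringNorm H q).toNormedRing

lemma norm_fieldAlgebra (A : FieldAlgebra H q) : ‖A‖ = fockNorm (q : ℝ) (vacuumEquiv H q A) := rfl

instance : NormedAlgebra ℝ (FieldAlgebra H q) where
  norm_smul_le c A := by
    rw [norm_fieldAlgebra, norm_fieldAlgebra, map_smul, fockNorm_smul, Real.norm_eq_abs]

/-- The field operator `ξ_q(f)` as an element of the algebra. -/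
def fieldOp (f : H) : FieldAlgebra H q := ⟨field (q : ℝ) f, Algebra.subset_adjoin ⟨f, rfl⟩⟩

/-- The Wick power `ξ_q^{◇k}(x)`: the unique element whose action on the vacuum is `x`. -/
def wick (k : ℕ) : TPow H k →ₗ[ℝ] FieldAlgebra H q :=
  (vacuumEquiv H q).symm.toLinearMap ∘ₗ lof H k

lemma wick_succ_succ (k : ℕ) (f : H) (x : TPow H (k + 1)) :
    wick H q (k + 2) (tens f x) =
      fieldOp H q f * wick H q (k + 1) x - wick H q k (annL (q : ℝ) k f x) := by
  apply (vacuumEquiv H q).injective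
  have h : ∀ A B : FieldAlgebra H q, vacuumEquiv H q (A * B) = A.1 (vacuumEquiv H q B) :=
    fun _ _ => rfl
  rw [map_sub, h]
  simp [wick, fieldOp, field]

lemma wick_one (f : H) : wick H q 1 (tens f (nil H 1)) = fieldOp H q f := by
  apply (vacuumEquiv H q).injective
  simp only [wick, LinearMap.comp_apply, LinearEquiv.coe_coe, LinearEquiv.apply_symm_apply]
  exact (field_vac (q : ℝ) f).symm

lemma wick_zero : wick H q 0 (nil H 1) = 1 := by
  apply (vacuumEquiv H q).injective
  simp only [wick, LinearMap.comp_apply, LinearEquiv.coe_coe, LinearEquiv.apply_symm_apply]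
  rfl

lemma norm_wick (k : ℕ) (x : TPow H k) :
    ‖wick H q k x‖ = ((k : ℝ) + 1) * Cq q ^ (3 / 2 : ℝ) * Dq q ^ k * ‖x‖ := by
  rw [norm_fieldAlgebra, ← fockNorm_lof]
  simp [wick]

/-- The `q`-mezdon algebra: the completion of the algebra generated by the fields. -/
def MezdonAlgebra : Type := UniformSpace.Completion (FieldAlgebra H q)

instance : NormedRing (MezdonAlgebra H q) :=
  inferInstanceAs (NormedRing (UniformSpace.Completion (FieldAlgebra H q)))
instance : CompleteSpace (MezdonAlgebra H q) :=
  inferInstanceAs (CompleteSpace (UniformSpace.Completion (FieldAlgebra H q)))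
instance : Algebra ℝ (MezdonAlgebra H q) :=
  inferInstanceAs (Algebra ℝ (UniformSpace.Completion (FieldAlgebra H q)))
instance : NormedAlgebra ℝ (MezdonAlgebra H q) where
  norm_smul_le c A := @norm_smul_le ℝ (UniformSpace.Completion (FieldAlgebra H q)) _ _ _ _ c A

/-- The dense embedding of the algebra of fields. -/
def incl : FieldAlgebra H q →L[ℝ] MezdonAlgebra H q :=
  UniformSpace.Completion.toComplL (𝕜 := ℝ) (E := FieldAlgebra H q)

/-- `Γ_q` on the algebra of fields: multiplication by `q ^ k` on the `k`-th Wick powers. -/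
def gammaAlg : FieldAlgebra H q →L[ℝ] FieldAlgebra H q :=
  LinearMap.mkContinuous
    ((vacuumEquiv H q).symm.toLinearMap ∘ₗ secQ H (q : ℝ) ∘ₗ (vacuumEquiv H q).toLinearMap) 1 (by
      intro A
      rw [norm_fieldAlgebra, norm_fieldAlgebra, one_mul]
      simp only [LinearMap.comp_apply, LinearEquiv.coe_coe, LinearEquiv.apply_symm_apply]
      exact fockNorm_secQ_le (abs_param q) _)

lemma gammaAlg_wick (k : ℕ) (x : TPow H k) : gammaAlg H q (wick H q k x) = (q : ℝ) ^ k • wick H q k x := by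
  simp [gammaAlg, wick]

/-- `Γ_q` on the completed algebra. -/
def gamma : MezdonAlgebra H q →L[ℝ] MezdonAlgebra H q :=
  ((incl H q).comp (gammaAlg H q)).extend (incl H q)

lemma gamma_incl (A : FieldAlgebra H q) : gamma H q (incl H q A) = incl H q (gammaAlg H q A) :=
  ((incl H q).comp (gammaAlg H q)).extend_eq UniformSpace.Completion.denseRange_coe
    (UniformSpace.Completion.isUniformInducing_coe _) A

lemma norm_incl (A : FieldAlgebra H q) : ‖incl H q A‖ = ‖A‖ := UniformSpace.Completion.norm_coe A

lemma incl_mul (A B : FieldAlgebra H q) : incl H q (A * B) = incl H q A * incl H q B :=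
  UniformSpace.Completion.coe_mul A B

lemma denseRange_incl : DenseRange (incl H q) := UniformSpace.Completion.denseRange_coe

/-- The vacuum state on the algebra of fields: the component of `A 1` in `H^{⊗0} = ℝ`. -/
def vacuumAlg : FieldAlgebra H q →L[ℝ] ℝ :=
  LinearMap.mkContinuous
    ((nil H).symm.toLinearEquiv.toLinearMap ∘ₗ DirectSum.component ℝ ℕ (fun k => TPow H k) 0 ∘ₗ
      (vacuumEquiv H q).toLinearMap) 1 (by
      intro A
      rw [norm_fieldAlgebra, one_mul]
      simp only [LinearMap.comp_apply, LinearEquiv.coe_coe]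
      refine ((nil H).symm.norm_map _).le.trans ?_
      have h := (fockNorm_summable (q : ℝ) (vacuumEquiv H q A)).le_tsum 0
        fun k _ => mul_nonneg (weight_pos (abs_param q) k).le (norm_nonneg _)
      refine le_trans ?_ h
      have hC := Cq_pow_one_le (abs_param q)
      simp only [Nat.cast_zero, zero_add, one_mul, pow_zero, mul_one]
      exact le_mul_of_one_le_left (norm_nonneg _) hC)

/-- The vacuum state `ω_q`. -/
def vacuumState : MezdonAlgebra H q →L[ℝ] ℝ := (vacuumAlg H q).extend (incl H q)

lemma vacuumState_incl (A : FieldAlgebra H q) : vacuumState H q (incl H q A) = vacuumAlg H q A :=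
  (vacuumAlg H q).extend_eq UniformSpace.Completion.denseRange_coe
    (UniformSpace.Completion.isUniformInducing_coe _) A

lemma vacuumState_one : vacuumState H q (incl H q 1) = 1 := by
  rw [vacuumState_incl]
  have h : vacuumEquiv H q 1 = lof H 0 (nil H 1) := rfl
  simp [vacuumAlg, h]

end Algebra

section Analytic

variable (E : Type) [NormedRing E] [NormedAlgebra ℝ E]

/-- The `k`-fold completed projective tensor power of `E`. -/
def TP (k : ℕ) : Type := UniformSpace.Completion (PiTensorProduct ℝ fun _ : Fin k => E)

instance (k : ℕ) : NormedAddCommGroup (TP E k) :=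
  inferInstanceAs (NormedAddCommGroup (UniformSpace.Completion (PiTensorProduct ℝ fun _ : Fin k => E)))
instance (k : ℕ) : NormedSpace ℝ (TP E k) :=
  inferInstanceAs (NormedSpace ℝ (UniformSpace.Completion (PiTensorProduct ℝ fun _ : Fin k => E)))
instance (k : ℕ) : CompleteSpace (TP E k) :=
  inferInstanceAs (CompleteSpace (UniformSpace.Completion (PiTensorProduct ℝ fun _ : Fin k => E)))

/-- The inclusion of the algebraic tensor power. -/
def TP.ofAlg (k : ℕ) : (PiTensorProduct ℝ fun _ : Fin k => E) →L[ℝ] TP E k :=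
  UniformSpace.Completion.toComplL (𝕜 := ℝ) (E := PiTensorProduct ℝ fun _ : Fin k => E)

variable {E}

/-- The elementary tensor `a₀ ⊗ ⋯ ⊗ a_{k-1}`. -/
def TP.pure {k : ℕ} (a : Fin k → E) : TP E k := TP.ofAlg E k (PiTensorProduct.tprod ℝ a)

/-- The continuous linear map on the completed tensor power induced by a continuous multilinear
map. -/
def TP.lift {k : ℕ} {F : Type} [NormedAddCommGroup F] [NormedSpace ℝ F] [CompleteSpace F]
    (f : ContinuousMultilinearMap ℝ (fun _ : Fin k => E) F) : TP E k →L[ℝ] F :=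
  (PiTensorProduct.liftIsometry ℝ (fun _ : Fin k => E) F f).extend (TP.ofAlg E k)

lemma TP.lift_pure {k : ℕ} {F : Type} [NormedAddCommGroup F] [NormedSpace ℝ F] [CompleteSpace F]
    (f : ContinuousMultilinearMap ℝ (fun _ : Fin k => E) F) (a : Fin k → E) :
    TP.lift f (TP.pure a) = f a := by
  have := (PiTensorProduct.liftIsometry ℝ (fun _ : Fin k => E) F f).extend_eq (e := TP.ofAlg E k)
    UniformSpace.Completion.denseRange_coe (UniformSpace.Completion.isUniformInducing_coe _)
      (PiTensorProduct.tprod ℝ a)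
  rw [TP.lift, TP.pure, this]
  simp

/-- The product of the letters `a_l * Y l` over the block `β l = b`, in increasing order. -/
def blockProd {m j : ℕ} (Y : Fin (m + 1) → E) (β : Fin (m + 1) → Fin j) (b : Fin j)
    (a : Fin (m + 1) → E) : E :=
  (List.ofFn fun l => if β l = b then a l * Y l else 1).prod

lemma blockProd_update {m j : ℕ} (Y : Fin (m + 1) → E) (β : Fin (m + 1) → Fin j)
    (a : Fin (m + 1) → E) (l : Fin (m + 1)) (c : E) :
    (fun b => blockProd Y β b (Function.update a l c)) =
      Function.update (fun b => blockProd Y β b a) (β l)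
        (MultilinearMap.mkPiAlgebraFin ℝ (m + 1) E
          (Function.update (fun i => if β i = β l then a i * Y i else 1) l (c * Y l))) := by
  funext b
  by_cases hb : b = β l
  · subst hb
    rw [Function.update_self, MultilinearMap.mkPiAlgebraFin_apply, blockProd]
    congr 2
    funext i
    by_cases hi : i = l
    · subst hi; simp
    · simp [Function.update_of_ne hi]
  · rw [Function.update_of_ne hb, blockProd, blockProd]
    congr 2
    funext i
    by_cases hi : i = l
    · subst hi; simp [Ne.symm hb]
    · simp [Function.update_of_ne hi]

/-- The continuous multilinear map `a ↦ ⨂_b ∏_{β l = b} a_l * Y l`. -/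
def blockMap {m j : ℕ} (Y : Fin (m + 1) → E) (β : Fin (m + 1) → Fin j) :
    ContinuousMultilinearMap ℝ (fun _ : Fin (m + 1) => E) (TP E j) where
  toFun a := TP.pure fun b => blockProd Y β b a
  map_update_add' := by
    intro dec a l c d
    obtain rfl : dec = instDecidableEqFin (m + 1) := Subsingleton.elim _ _
    simp only [blockProd_update, add_mul, MultilinearMap.map_update_add, TP.pure, map_add]
  map_update_smul' := by
    intro dec a l c d
    obtain rfl : dec = instDecidableEqFin (m + 1) := Subsingleton.elim _ _
    simp only [blockProd_update, smul_mul_assoc, MultilinearMap.map_update_smul, TP.pure, map_smul]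
  cont := by
    have h : ∀ v : Fin j → E, PiTensorProduct.tprod ℝ v = PiTensorProduct.tprodL ℝ v := fun v => by
      simp
    have hb : ∀ b, Continuous (blockProd Y β b) := by
      intro b
      refine (ContinuousMultilinearMap.mkPiAlgebraFin ℝ (m + 1) E).cont.comp
        (continuous_pi fun l => ?_)
      split_ifs <;> fun_prop
    change Continuous fun a => TP.ofAlg E j (PiTensorProduct.tprod ℝ fun b => blockProd Y β b a)
    simp only [h]
    exact (TP.ofAlg E j).continuous.comp
      ((PiTensorProduct.tprodL ℝ).cont.comp (continuous_pi fun b => hb b))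

/-- The letters between the coefficients: `X_{k_1}, …, X_{k_m}` except at the cuts of `β`, where
the two adjacent coefficients lie in different blocks. -/
def letters {n m j : ℕ} (X : Fin n → E) (k : Fin m → Fin n) (β : Fin (m + 1) → Fin j) :
    Fin (m + 1) → E :=
  Fin.snoc (α := fun _ => E) (fun l : Fin m => if β l.castSucc = β l.succ then X (k l) else 1) 1

/-- Insert `X_{k_1}, …, X_{k_m}` between the `m + 1` factors of a tensor and multiply out within
each block of `β`, dropping the letters at the cuts: with `m = 3` and a cut at the second letter,
`a₁ ⊗ a₂ ⊗ a₃ ⊗ a₄ ↦ (a₁ X_{k₁} a₂) ⊗ (a₃ X_{k₃} a₄)`. -/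
def collect {n m j : ℕ} (X : Fin n → E) (k : Fin m → Fin n) (β : Fin (m + 1) → Fin j) :
    TP E (m + 1) →L[ℝ] TP E j :=
  TP.lift (blockMap (letters X k β) β)

/-- Two blocks, cut at the letter `r`. -/
def cut {m : ℕ} (r : Fin m) : Fin (m + 1) → Fin 2 := fun l => if l ≤ r.castSucc then 0 else 1

/-- Three blocks, cut at the letters `r < s`. -/
def cut₂ {m : ℕ} (r s : Fin m) : Fin (m + 1) → Fin 3 :=
  fun l => if l ≤ r.castSucc then 0 else if l ≤ s.castSucc then 1 else 2

/-- `a₀ ⊗ a₁ ↦ a₀ h a₁`. -/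
def pair (h : E) [CompleteSpace E] : TP E 2 →L[ℝ] E :=
  TP.lift ((ContinuousMultilinearMap.mkPiAlgebraFin ℝ 2 E).compContinuousLinearMap
    ![(ContinuousLinearMap.mul ℝ E).flip h, ContinuousLinearMap.id ℝ E])

/-- `a₀ ⊗ a₁ ⊗ a₂ ↦ a₀ T(a₁) a₂`. -/
def sandwich [CompleteSpace E] (T : E →L[ℝ] E) : TP E 3 →L[ℝ] E :=
  TP.lift ((ContinuousMultilinearMap.mkPiAlgebraFin ℝ 3 E).compContinuousLinearMap
    ![ContinuousLinearMap.id ℝ E, T, ContinuousLinearMap.id ℝ E])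

/-- `[[u; X^k]]`: the map `a₁ ⊗ ⋯ ⊗ a_{m+1} ↦ a₁ X_{k_1} a₂ ⋯ X_{k_m} a_{m+1}`. -/
def word [CompleteSpace E] {n m : ℕ} (X : Fin n → E) (k : Fin m → Fin n) : TP E (m + 1) →L[ℝ] E :=
  TP.lift ((ContinuousMultilinearMap.mkPiAlgebraFin ℝ (m + 1) E).compContinuousLinearMap
    fun l => (ContinuousLinearMap.mul ℝ E).flip (Fin.snoc (α := fun _ => E) (fun l => X (k l)) 1 l))

variable (E) in
/-- Coefficients `A_{m,k} ∈ E^{⊗(m+1)}`, `k ∈ [n]^m`, of a noncommutative power series. -/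
abbrev Coeffs (n : ℕ) : Type := (m : ℕ) → (Fin m → Fin n) → TP E (m + 1)

/-- The power series with coefficients `A` has radius of convergence at least `R`. -/
def HasRadius {n : ℕ} (A : Coeffs E n) (R : ENNReal) : Prop :=
  ∀ r : NNReal, (r : ENNReal) < R → Summable fun m : ℕ => (r : ℝ) ^ m * ∑ k, ‖A m k‖

/-- `A` defines an analytic function on the ball of radius `R`: either its radius of convergence is
at least `R`, or it is the lift `∑ c_{m,k} X_{k_1} ⋯ X_{k_m}` of a scalar power series with radius
of convergence at least `R`. (The unit has norm `‖1‖ ≥ 1` in general, so that the second case is not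
quite contained in the first when `R` is finite.) -/
def AnalyticOnBall {n : ℕ} (A : Coeffs E n) (R : ENNReal) : Prop :=
  HasRadius A R ∨ ∃ c : (m : ℕ) → (Fin m → Fin n) → ℝ,
    (∀ m k, A m k = c m k • TP.pure fun _ => 1) ∧
      ∀ r : NNReal, (r : ENNReal) < R → Summable fun m : ℕ => (r : ℝ) ^ m * ∑ k, |c m k|

/-- `F(X) = ∑_m ∑_k [[A_{m,k}; X^k]]`. -/
def evalSeries [CompleteSpace E] {n : ℕ} (A : Coeffs E n) (X : Fin n → E) : E :=
  ∑' m : ℕ, ∑ k, word X k (A m k)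

/-- The noncommutative derivative `D_i F(X) ∈ E ⊗ E`. -/
def deriv₁ {n : ℕ} (A : Coeffs E n) (i : Fin n) (X : Fin n → E) : TP E 2 :=
  ∑' m : ℕ, ∑ k, ∑ r, if k r = i then collect X k (cut r) (A m k) else 0

/-- The second noncommutative derivative `D_i D_j F(X) ∈ E ⊗ E ⊗ E`: an occurrence of `X_i` and a
later occurrence of `X_j` are removed. -/
def deriv₂ {n : ℕ} (A : Coeffs E n) (i j : Fin n) (X : Fin n → E) : TP E 3 :=
  ∑' m : ℕ, ∑ k, ∑ r, ∑ s,
    if r < s ∧ k r = i ∧ k s = j then collect X k (cut₂ r s) (A m k) else 0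

end Analytic

section Ito

open MeasureTheory Filter Topology TopologicalSpace
open scoped Distributions ContDiff ENNReal

section Noise

variable (q : Set.Ioo (-1 : ℝ) 1) (n : ℕ)

/-- The Hilbert space `L²(ℝ)ⁿ` of the noises. -/
abbrev NoiseSpace (n : ℕ) : Type := PiLp 2 fun _ : Fin n => Lp ℝ 2 (volume : Measure ℝ)

/-- The algebra `𝒜_q = 𝒜_q(L²(ℝ)ⁿ)`. -/
abbrev Alg : Type := MezdonAlgebra (NoiseSpace n) q

variable {n}

/-- The class in `L²(ℝ)` of a square integrable function (and `0` for any other function). -/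
def toL2 (f : ℝ → ℝ) : Lp ℝ 2 (volume : Measure ℝ) :=
  open Classical in if h : MemLp f 2 volume then h.toLp f else 0

/-- The noise `ξ_q^i(f) = ξ_q(f e_i)`, for `f ∈ L²(ℝ)`. -/
def noise (i : Fin n) (f : Lp ℝ 2 (volume : Measure ℝ)) : Alg q n :=
  incl _ q (fieldOp _ q (PiLp.single 2 i f))

/-- `B_q^i(s, t) = sgn(t - s) ξ_q^i(1_{[s,t]})`. -/
def increment (i : Fin n) (s t : ℝ) : Alg q n :=
  noise q i (toL2 ((Set.Ioc s t).indicator 1) - toL2 ((Set.Ioc t s).indicator 1))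

/-- The `n`-dimensional `q`-Brownian motion `B_q(t) = B_q(0, t)`. -/
def brownian (t : ℝ) : Fin n → Alg q n := fun i => increment q i 0 t

/-- Smooth compactly supported even probability densities. -/
structure IsMollifier (ρ : ℝ → ℝ) : Prop where
  smooth : ContDiff ℝ ∞ ρ
  compact : HasCompactSupport ρ
  nonneg : ∀ x, 0 ≤ ρ x
  even : ∀ x, ρ (-x) = ρ x
  integral : ∫ x, ρ x = 1

variable (ρ : ℝ → ℝ) (ε : ℝ)

/-- The mollified noise `ξ_q^{i,(ε)}(t) = ξ_q^i(ε⁻¹ ρ((· - t) / ε))`. -/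
def noiseM (i : Fin n) (t : ℝ) : Alg q n := noise q i (toL2 fun u => ε⁻¹ * ρ ((u - t) / ε))

/-- `B_q^{i,(ε)}(s, t) = ∫_s^t ξ_q^{i,(ε)}`. -/
def incrementM (i : Fin n) (s t : ℝ) : Alg q n := ∫ u in s..t, noiseM q ρ ε i u

/-- `B_q^{(ε)}(t) = B_q^{(ε)}(0, t)`. -/
def brownianM (t : ℝ) : Fin n → Alg q n := fun i => incrementM q ρ ε i 0 t

end Noise

section Lift

variable (q : Set.Ioo (-1 : ℝ) 1) (n : ℕ)

/-- `Δ_q = Γ_q` on `𝒜_q`: multiplication by `q ^ k` on the `k`-th chaos. -/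
abbrev deltaQ : Alg q n →L[ℝ] Alg q n := gamma (NoiseSpace n) q

/-- `Δ_q^{R;(1,1),(1,2)} = Id × Γ_q × Id`, that is `a₀ ⊗ a₁ ⊗ a₂ ↦ a₀ Δ_q(a₁) a₂`. -/
def deltaR : TP (Alg q n) 3 →L[ℝ] Alg q n := sandwich (deltaQ q n)

/-- The data that a lift of the noise has to specify beyond `ξ_q^i` and `B_q^i(s, t)`: the values of
the model based at `s` on the two products of a noise `Ξ` with an integrated noise `I(Ξ)`,
tested against `φ`, as operators acting on the algebra element `a` between the two factors:
`L i j s φ a` stands for `∫ φ(t) B_q^i(s, t) a ξ_q^j(dt)` (the product `I(Ξ_i) Ξ_j`) and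
`R i j s φ a` for `∫ φ(t) ξ_q^i(dt) a B_q^j(s, t)` (the product `Ξ_i I(Ξ_j)`). -/
structure Lift where
  L : Fin n → Fin n → ℝ → 𝓓((⊤ : Opens ℝ), ℝ) → (Alg q n →L[ℝ] Alg q n)
  R : Fin n → Fin n → ℝ → 𝓓((⊤ : Opens ℝ), ℝ) → (Alg q n →L[ℝ] Alg q n)

variable {n}

/-- The value of the renormalised mollified model on `I(Ξ_i) Ξ_j`:
`a ↦ ∫ φ(t) (B_q^{i,(ε)}(s, t) a ξ_q^{j,(ε)}(t) - c Δ_q(a)) dt`. -/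
def liftML (ρ : ℝ → ℝ) (ε c : ℝ) (i j : Fin n) (s : ℝ) (φ : 𝓓((⊤ : Opens ℝ), ℝ)) :
    Alg q n →L[ℝ] Alg q n :=
  (∫ t, φ t • ContinuousLinearMap.mulLeftRight ℝ (Alg q n) (incrementM q ρ ε i s t) (noiseM q ρ ε j t)) -
    (c * ∫ t, φ t) • deltaQ q n

/-- The value of the renormalised mollified model on `Ξ_i I(Ξ_j)`:
`a ↦ ∫ φ(t) (ξ_q^{i,(ε)}(t) a B_q^{j,(ε)}(s, t) - c Δ_q(a)) dt`. -/
def liftMR (ρ : ℝ → ℝ) (ε c : ℝ) (i j : Fin n) (s : ℝ) (φ : 𝓓((⊤ : Opens ℝ), ℝ)) :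
    Alg q n →L[ℝ] Alg q n :=
  (∫ t, φ t • ContinuousLinearMap.mulLeftRight ℝ (Alg q n) (noiseM q ρ ε i t) (incrementM q ρ ε j s t)) -
    (c * ∫ t, φ t) • deltaQ q n

/-- The values `l ε i j` on `I(Ξ_i) Ξ_j` and `r ε i j` on `Ξ_i I(Ξ_j)` of the renormalisation characters
converge, as `ε ↓ 0`, to `C i j` and `C j i` respectively. -/
def CountertermsTo (C : Fin n → Fin n → ℝ) (l r : ℝ → Fin n → Fin n → ℝ) : Prop :=
  ∀ i j, Tendsto (fun ε => l ε i j) (𝓝[>] 0) (𝓝 (C i j)) ∧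
    Tendsto (fun ε => r ε i j) (𝓝[>] 0) (𝓝 (C j i))

/-- `Z` is the lift of the noise with constants `C`: the limit in operator norm of the mollified models,
renormalised by characters that converge to `C`, whatever the mollifier and the characters. -/
def IsLift (C : Fin n → Fin n → ℝ) (Z : Lift q n) : Prop :=
  ∀ ρ, IsMollifier ρ → ∀ l r, CountertermsTo C l r → ∀ i j s φ,
    Tendsto (fun ε => liftML q ρ ε (l ε i j) i j s φ) (𝓝[>] 0) (𝓝 (Z.L i j s φ)) ∧
    Tendsto (fun ε => liftMR q ρ ε (r ε i j) i j s φ) (𝓝[>] 0) (𝓝 (Z.R i j s φ))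

/-- The model based at `s`, applied to the value at `s` of the lift of `∑ᵢ D_iF(B_q)[ξ_q^i]`, that is
`∑ᵢ D_iF(B_q(s))[Ξ_i] + ∑_{i,j} D_iD_jF(B_q(s))[I(Ξ_i), Ξ_j] + ∑_{i,j} D_iD_jF(B_q(s))[Ξ_i, I(Ξ_j)]`, and
tested against `φ`. -/
def germ (Z : Lift q n) (A : Coeffs (Alg q n) n) (s : ℝ) (φ : 𝓓((⊤ : Opens ℝ), ℝ)) : Alg q n :=
  (∑ i, pair (noise q i (toL2 φ)) (deriv₁ A i (brownian q s))) +
    ∑ i, ∑ j, sandwich (Z.L i j s φ + Z.R i j s φ) (deriv₂ A i j (brownian q s))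

/-- `ζ` is the reconstruction on `Ω` of the germ `G`: for some `γ > 0`, locally uniformly in `s`,
`‖(ζ - G s)(η_s^λ)‖ ≲ λ ^ γ`, where `η_s^λ(t) = λ⁻¹ η((t - s) / λ)` and `η` is a smooth function
supported in the unit ball with `C¹` norm at most one. -/
def IsReconstruction {Ω : Opens ℝ} (G : ℝ → 𝓓((⊤ : Opens ℝ), ℝ) → Alg q n) (ζ : 𝓓'(Ω, Alg q n)) : Prop :=
  ∃ γ : ℝ, 0 < γ ∧ ∀ K : Set ℝ, IsCompact K → K ⊆ Ω → ∃ c : ℝ, ∀ s l : ℝ, 0 < l → l ≤ 1 →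
    Set.Icc (s - l) (s + l) ⊆ K → ∀ η : ℝ → ℝ, ContDiff ℝ ∞ η → tsupport η ⊆ Set.Icc (-1) 1 →
      (∀ x, |η x| ≤ 1) → (∀ x, |deriv η x| ≤ 1) → ∀ φ : 𝓓(Ω, ℝ), (∀ t, φ t = l⁻¹ * η ((t - s) / l)) →
          ‖ζ φ - G s (TestFunction.monoCLM (𝕜 := ℝ) φ)‖ ≤ c * l ^ γ
end Lift

end Ito

end Mezdon

end

open Mezdon MeasureTheory Filter Topology TopologicalSpace
open scoped Distributions

/-!
The Itô formula reduces to a statement about a single path in a Banach algebra. By `brownian_eq`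
the `q`-Brownian motion is the image of the curve `bm t = sgn(t) 1_{[0,t]}` of `L²(ℝ)` under the
bounded linear maps `noiseL q i`, and `‖bm t - bm s‖ = |t - s|^{1/2}`: the path is Hölder
continuous of exponent `1/2` in the norm of the algebra, and no martingale property is needed.

*The lift.* The product `B^i(s,t) a ξ^j(t)` splits into a contraction of the two fields with each
other, which is `⟨B^i(s,t), ξ^j(t)⟩ Γ_q(a)`, and a remainder `chaosProd` that is bounded in the
Hilbert tensor norm of the two arguments (`norm_chaosProd_le`). The mollified scalar contraction is
half the derivative of `‖B(s,t)‖²` and converges (`exists_tendsto_integral_inner`). The mollified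
tensors `∫ φ(t) B(s,t) ⊗ ξ(t) dt` have inner products that converge to the squared `L²` norm of the
kernel `φ(t) 1_{[s,t]}(u)`, so that they form a Cauchy net in the Hilbert tensor square
(`exists_tendsto_integral_htmul`). Convergence is taken along the filter `kernels` of even
probability densities of radius tending to zero, which makes the limit independent of the
mollifier. The product in the other order then follows by the Leibniz rule: the sum of both
products is the derivative of `B^i(s,t) a B^j(s,t)`. Hence in the sum of the two models, the only
part of a lift that enters the germ, everything but the constants is an increment of the path
(`IsLift.L_add_R`).

*The formula.* It follows that the germ is `-∫ φ' P_s - (∫ φ) g(B_s)`, where `P_s(t)` is the Taylor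
polynomial of second order of `F` at `B_s`, evaluated at `B_t - B_s`, and `g` is the Itô correction
(`IsLift.germ_eq`). The remainder of the Taylor expansion is `O(|t - s|^{3/2})`
(`Dominated.taylor`); one derivative costs one power of the scale, so the distribution `∂ₜ F(B) -
g(B)` differs from the germ by `O(l^{1/2})` at scale `l` (`AnalyticOnBall.exists_local_bound`) and
is its reconstruction. A distribution that is `O(l^γ)` at scale `l` for some `γ > 0` vanishes
(`eq_zero_of_scaling`), so there is no other. This is the Itô formula. The mollified paths are
differentiable and converge uniformly, so that the mollified formula is the chain rule, and its
limit is a limit of continuous functions of the path after an integration by parts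
(`AnalyticOnBall.tendsto_integral`).

The analysis of `F` rests on one device: for a fixed coefficient a word is a multilinear map of its
letters (`interleave`), and so are its derivatives, with some letters replaced by the unit or by
the direction of differentiation. Estimates of multilinear maps by weights `w` (`IsWeight`) then
treat general coefficients, with `w` their norm, and lifts of scalar series, with `w` the absolute
value of the scalar, on the same footing.
-/

set_option linter.unusedSectionVars false

namespace Mezdon

noncomputable section

/-! ### Words as multilinear maps of their letters -/

section Interleave

variable {E : Type} [NormedRing E] [NormedAlgebra ℝ E]
  {F : Type} [NormedAddCommGroup F] [NormedSpace ℝ F] [CompleteSpace F]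

lemma TP.ext_pure {k : ℕ} {f g : TP E k →L[ℝ] F} (h : ∀ a, f (TP.pure a) = g (TP.pure a)) :
    f = g := by
  have h1 : f.comp (TP.ofAlg E k) = g.comp (TP.ofAlg E k) := by
    refine ContinuousLinearMap.coe_injective (PiTensorProduct.ext (MultilinearMap.ext fun a => ?_))
    exact h a
  refine ContinuousLinearMap.ext fun x => ?_
  have h2 : Set.EqOn f g (Set.range (TP.ofAlg E k)) := by
    rintro _ ⟨y, rfl⟩
    exact DFunLike.congr_fun h1 y
  have h3 : DenseRange (TP.ofAlg E k) := UniformSpace.Completion.denseRange_coe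
  exact congrFun (Continuous.ext_on h3 f.continuous g.continuous h2) x

lemma TP.norm_pure_le {k : ℕ} (a : Fin k → E) : ‖TP.pure a‖ ≤ ∏ l, ‖a l‖ := by
  refine (UniformSpace.Completion.norm_coe _).le.trans ?_
  exact PiTensorProduct.projectiveSeminorm_tprod_le a

lemma TP.norm_lift_apply_le {k : ℕ} (f : ContinuousMultilinearMap ℝ (fun _ : Fin k => E) F) {C : ℝ}
    (hC : 0 ≤ C) (hf : ∀ a, ‖f a‖ ≤ C * ∏ l, ‖a l‖) (u : TP E k) : ‖TP.lift f u‖ ≤ C * ‖u‖ := by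
  have h1 : ‖f‖ ≤ C := f.opNorm_le_bound hC hf
  have h3 : DenseRange (TP.ofAlg E k) := UniformSpace.Completion.denseRange_coe
  refine h3.induction_on (p := fun u => ‖TP.lift f u‖ ≤ C * ‖u‖) u
    (isClosed_le (by fun_prop) (by fun_prop)) fun x => ?_
  have := (PiTensorProduct.liftIsometry ℝ (fun _ : Fin k => E) F f).extend_eq (e := TP.ofAlg E k)
    UniformSpace.Completion.denseRange_coe (UniformSpace.Completion.isUniformInducing_coe _) x
  rw [TP.lift, this]
  have h4 : ‖TP.ofAlg E k x‖ = ‖x‖ := UniformSpace.Completion.norm_coe x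
  rw [h4]
  refine (ContinuousLinearMap.le_opNorm _ x).trans ?_
  rw [LinearIsometryEquiv.norm_map]
  gcongr

/-- Multiplication of the letters `Y` into the arguments of `G`:
`a ↦ G (a₀ * Y₀, …, a_{m-1} * Y_{m-1}, a_m)`. -/
def insertLetters {m : ℕ} (G : ContinuousMultilinearMap ℝ (fun _ : Fin (m + 1) => E) F)
    (Y : Fin m → E) : ContinuousMultilinearMap ℝ (fun _ : Fin (m + 1) => E) F :=
  G.compContinuousLinearMap fun l =>
    (ContinuousLinearMap.mul ℝ E).flip (Fin.snoc (α := fun _ => E) Y 1 l)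

lemma insertLetters_apply {m : ℕ} (G : ContinuousMultilinearMap ℝ (fun _ : Fin (m + 1) => E) F)
    (Y : Fin m → E) (a : Fin (m + 1) → E) :
    insertLetters G Y a = G fun l => a l * Fin.snoc (α := fun _ => E) Y 1 l := rfl

lemma mul_snoc_update {m : ℕ} (a : Fin (m + 1) → E) (Y : Fin m → E) (r : Fin m) (y : E) :
    (fun l => a l * Fin.snoc (α := fun _ => E) (Function.update Y r y) 1 l) =
      Function.update (fun l => a l * Fin.snoc (α := fun _ => E) Y 1 l) r.castSucc
        (a r.castSucc * y) := by
  funext l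
  refine Fin.lastCases ?_ (fun i => ?_) l
  · rw [Function.update_of_ne (Fin.castSucc_lt_last r).ne']
    simp
  · by_cases h : i = r
    · subst h; simp
    · rw [Function.update_of_ne (by simpa using h)]
      simp [h]

/-- For a fixed tensor `u`, the value at `u` of `insertLetters G Y` is multilinear in the letters. -/
def interleave {m : ℕ} (G : ContinuousMultilinearMap ℝ (fun _ : Fin (m + 1) => E) F)
    (u : TP E (m + 1)) : MultilinearMap ℝ (fun _ : Fin m => E) F where
  toFun Y := TP.lift (insertLetters G Y) u
  map_update_add' := by
    intro dec Y r x y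
    obtain rfl : dec = instDecidableEqFin m := Subsingleton.elim _ _
    rw [← add_apply]
    congr 1
    refine TP.ext_pure fun a => ?_
    simp only [add_apply, TP.lift_pure, insertLetters_apply, mul_snoc_update,
      mul_add, ContinuousMultilinearMap.map_update_add]
  map_update_smul' := by
    intro dec Y r c y
    obtain rfl : dec = instDecidableEqFin m := Subsingleton.elim _ _
    rw [← smul_apply]
    congr 1
    refine TP.ext_pure fun a => ?_
    simp only [smul_apply, TP.lift_pure, insertLetters_apply, mul_snoc_update,
      mul_smul_comm, ContinuousMultilinearMap.map_update_smul]

lemma interleave_apply {m : ℕ} (G : ContinuousMultilinearMap ℝ (fun _ : Fin (m + 1) => E) F)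
    (u : TP E (m + 1)) (Y : Fin m → E) : interleave G u Y = TP.lift (insertLetters G Y) u := rfl

lemma interleave_pure {m : ℕ} (G : ContinuousMultilinearMap ℝ (fun _ : Fin (m + 1) => E) F)
    (a : Fin (m + 1) → E) (Y : Fin m → E) :
    interleave G (TP.pure a) Y = G fun l => a l * Fin.snoc (α := fun _ => E) Y 1 l := by
  rw [interleave_apply, TP.lift_pure, insertLetters_apply]

/-- `‖G a‖` is bounded by `K` times the product of the norms of the entries of `a`, where entries
equal to the unit may be counted as having norm one. -/
def UnitBounded {m : ℕ} (G : ContinuousMultilinearMap ℝ (fun _ : Fin m => E) F) (K : ℝ) : Prop :=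
  ∀ (a : Fin m → E) (c : Fin m → ℝ), (∀ l, (a l = 1 ∧ c l = 1) ∨ ‖a l‖ ≤ c l) →
    ‖G a‖ ≤ K * ∏ l, c l

lemma norm_list_prod_ofFn_le {m : ℕ} (x : Fin m → E) (c : Fin m → ℝ)
    (h : ∀ l, (x l = 1 ∧ c l = 1) ∨ ‖x l‖ ≤ c l) :
    ‖(List.ofFn x).prod‖ ≤ ‖(1 : E)‖ * ∏ l, c l := by
  induction m with
  | zero => simp
  | succ m ih =>
    have hc : ∀ l, 0 ≤ c l := fun l => by
      rcases h l with ⟨-, h⟩ | h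
      · rw [h]; exact zero_le_one
      · exact (norm_nonneg _).trans h
    have := ih (fun l => x l.succ) (fun l => c l.succ) fun l => h l.succ
    rw [List.ofFn_succ, List.prod_cons, Fin.prod_univ_succ]
    rcases h 0 with ⟨h0, h1⟩ | h0
    · rw [h0, h1, one_mul, one_mul]; exact this
    · refine (norm_mul_le _ _).trans ?_
      rw [mul_left_comm]
      exact mul_le_mul h0 this (norm_nonneg _) (hc 0)

lemma unitBounded_mkPiAlgebraFin (m : ℕ) :
    UnitBounded (ContinuousMultilinearMap.mkPiAlgebraFin ℝ m E) ‖(1 : E)‖ := fun a c h => by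
  rw [ContinuousMultilinearMap.mkPiAlgebraFin_apply]
  exact norm_list_prod_ofFn_le a c h

lemma unitBounded_blockMap {m j : ℕ} (β : Fin (m + 1) → Fin j) :
    UnitBounded (blockMap (E := E) 1 β) (‖(1 : E)‖ ^ j) := fun a c h => by
  refine (TP.norm_pure_le _).trans ?_
  have h1 : ∀ b, ‖blockProd 1 β b a‖ ≤ ‖(1 : E)‖ * ∏ l, if β l = b then c l else 1 := fun b => by
    refine norm_list_prod_ofFn_le _ _ fun l => ?_
    split_ifs
    · simpa using h l
    · exact Or.inl ⟨rfl, rfl⟩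
  refine (Finset.prod_le_prod (fun _ _ => norm_nonneg _) fun b _ => h1 b).trans ?_
  rw [Finset.prod_mul_distrib, Finset.prod_comm]
  simp

/-- `w` bounds the coefficient `u`: it plays the role of `‖u‖` in all estimates on words with
coefficient `u`. -/
def IsWeight {m : ℕ} (u : TP E (m + 1)) (w : ℝ) : Prop :=
  0 ≤ w ∧ ∀ (F : Type) [NormedAddCommGroup F] [NormedSpace ℝ F] [CompleteSpace F]
    (G : ContinuousMultilinearMap ℝ (fun _ : Fin (m + 1) => E) F) (K : ℝ), 0 ≤ K →
      UnitBounded G K → ∀ Y, ‖interleave G u Y‖ ≤ K * w * ∏ l, ‖Y l‖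

lemma isWeight_norm {m : ℕ} (u : TP E (m + 1)) : IsWeight u ‖u‖ := by
  refine ⟨norm_nonneg _, fun F _ _ _ G K hK hG Y => ?_⟩
  rw [interleave_apply, mul_right_comm]
  refine TP.norm_lift_apply_le _ (by positivity) (fun a => ?_) u
  rw [insertLetters_apply]
  refine (hG _ (Fin.snoc (α := fun _ => ℝ) (fun l => ‖a l.castSucc‖ * ‖Y l‖) ‖a (Fin.last m)‖)
    fun l => Or.inr ?_).trans ?_
  · refine Fin.lastCases ?_ (fun i => ?_) l
    · simp
    · simpa using norm_mul_le _ _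
  · rw [Fin.prod_univ_castSucc, Fin.prod_univ_castSucc]
    simp only [Fin.snoc_castSucc, Fin.snoc_last, Finset.prod_mul_distrib]
    exact le_of_eq (by ring)

/-- The unit has norm `‖1‖ ≥ 1` in general, and the norm of `1 ⊗ ⋯ ⊗ 1` may grow with the number of
factors; the scalar `c` is nevertheless a weight for `c • (1 ⊗ ⋯ ⊗ 1)`. -/
lemma isWeight_smul_one {m : ℕ} (c : ℝ) : IsWeight (c • TP.pure fun _ : Fin (m + 1) => (1 : E)) |c| := by
  refine ⟨abs_nonneg _, fun F _ _ _ G K hK hG Y => ?_⟩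
  have h1 : interleave G (c • TP.pure fun _ : Fin (m + 1) => (1 : E)) Y =
      c • interleave G (TP.pure fun _ : Fin (m + 1) => (1 : E)) Y := by
    simp only [interleave_apply, map_smul]
  rw [h1, interleave_pure, norm_smul, Real.norm_eq_abs, mul_comm K, mul_assoc]
  refine mul_le_mul_of_nonneg_left ?_ (abs_nonneg c)
  refine (hG _ (Fin.snoc (α := fun _ => ℝ) (fun l => ‖Y l‖) 1) fun l => ?_).trans ?_
  · refine Fin.lastCases ?_ (fun i => ?_) l
    · left; simp
    · right; simp
  · rw [Fin.prod_univ_castSucc]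
    simp

end Interleave

/-! ### Removing and replacing letters of a word -/

section Identities

variable {E : Type} [NormedRing E] [NormedAlgebra ℝ E] {n m : ℕ}

lemma collect_eq_interleave {j : ℕ} (X : Fin n → E) (k : Fin m → Fin n) (β : Fin (m + 1) → Fin j)
    (u : TP E (m + 1)) : collect X k β u = interleave (blockMap 1 β) u
      (fun l => if β l.castSucc = β l.succ then X (k l) else 1) := by
  rw [interleave_apply, collect]
  congr 1
  refine TP.ext_pure fun a => ?_
  rw [TP.lift_pure, TP.lift_pure, insertLetters_apply]
  change TP.pure _ = TP.pure _
  congr 1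
  funext b
  simp [blockProd, letters]

lemma cut_eq_iff (r l : Fin m) : cut r l.castSucc = cut r l.succ ↔ l ≠ r := by
  unfold cut
  simp only [Fin.le_def, Fin.val_castSucc, Fin.val_succ, ne_eq, Fin.ext_iff]
  split_ifs <;> simp <;> omega

lemma cut₂_eq_iff {r s : Fin m} (h : r < s) (l : Fin m) :
    cut₂ r s l.castSucc = cut₂ r s l.succ ↔ l ≠ r ∧ l ≠ s := by
  unfold cut₂
  simp only [Fin.le_def, Fin.val_castSucc, Fin.val_succ, ne_eq, Fin.ext_iff, Fin.lt_def] at *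
  split_ifs <;> simp <;> omega

lemma collect_cut (X : Fin n → E) (k : Fin m → Fin n) (r : Fin m) (u : TP E (m + 1)) :
    collect X k (cut r) u =
      interleave (blockMap 1 (cut r)) u (Function.update (fun l => X (k l)) r 1) := by
  rw [collect_eq_interleave]
  congr 1
  funext l
  by_cases h : l = r
  · subst h; simp [cut_eq_iff]
  · simp [cut_eq_iff, h]

lemma collect_cut₂ (X : Fin n → E) (k : Fin m → Fin n) {r s : Fin m} (h : r < s)
    (u : TP E (m + 1)) : collect X k (cut₂ r s) u = interleave (blockMap 1 (cut₂ r s)) u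
      (Function.update (Function.update (fun l => X (k l)) r 1) s 1) := by
  rw [collect_eq_interleave]
  congr 1
  funext l
  by_cases hs : l = s
  · subst hs; simp [cut₂_eq_iff h]
  · by_cases hr : l = r
    · subst hr; simp [cut₂_eq_iff h, hs]
    · simp [cut₂_eq_iff h, hr, hs]

/-- The ordered product of the factors `f l` with `c ≤ l < d`. -/
def segProd {M : Type*} [Monoid M] {N : ℕ} (f : Fin N → M) (c d : ℕ) : M :=
  (List.ofFn fun l : Fin N => if c ≤ (l : ℕ) ∧ (l : ℕ) < d then f l else 1).prod

section SegProd

variable {M : Type*} [Monoid M] {N : ℕ}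

lemma segProd_eq (f : Fin N → M) (c d : ℕ) :
    segProd f c d = (((List.ofFn f).take d).drop c).prod := by
  induction N generalizing c d with
  | zero => simp [segProd]
  | succ N ih =>
    rw [segProd, List.ofFn_succ, List.ofFn_succ, List.prod_cons]
    rcases d with _ | d
    · simp
    · rcases c with _ | c
      · have := ih (fun l => f l.succ) 0 d
        simp [segProd] at this
        simp [this]
      · have := ih (fun l => f l.succ) c d
        simpa [segProd] using this

lemma segProd_mul (f : Fin N → M) {c d e : ℕ} (h : c ≤ d) (h' : d ≤ e) :
    segProd f c d * segProd f d e = segProd f c e := by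
  simp only [segProd_eq]
  obtain ⟨x, rfl⟩ := Nat.exists_eq_add_of_le h
  obtain ⟨y, rfl⟩ := Nat.exists_eq_add_of_le h'
  rw [List.drop_take, List.drop_take, List.drop_take, ← List.prod_append]
  congr 1
  rw [show c + x + y - c = x + y by omega, show c + x - c = x by omega,
    show c + x + y - (c + x) = y by omega, List.take_add, List.drop_drop]

lemma segProd_single (f : Fin N → M) (r : Fin N) : segProd f r (r + 1) = f r := by
  rw [segProd_eq, List.drop_take, Nat.add_sub_cancel_left,
    List.take_one_drop_eq_of_lt_length (by simp)]
  simp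

lemma segProd_full (f : Fin N → M) : segProd f 0 N = (List.ofFn f).prod := by
  rw [segProd_eq, List.take_of_length_le (by simp), List.drop_zero]

lemma segProd_congr {f g : Fin N → M} {c d : ℕ} (h : ∀ l : Fin N, c ≤ l → (l : ℕ) < d → f l = g l) :
    segProd f c d = segProd g c d := by
  rw [segProd, segProd]
  congr 2
  funext l
  split_ifs with hl
  · exact h l hl.1 hl.2
  · rfl

end SegProd

lemma blockProd_one_eq {j : ℕ} (β : Fin (m + 1) → Fin j) (b : Fin j) (a : Fin (m + 1) → E) (c d : ℕ)
    (h : ∀ l : Fin (m + 1), β l = b ↔ c ≤ (l : ℕ) ∧ (l : ℕ) < d) :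
    blockProd 1 β b a = segProd a c d := by
  rw [blockProd, segProd]
  simp [h]

lemma blockProd_cut (r : Fin m) (a : Fin (m + 1) → E) :
    blockProd 1 (cut r) 0 a = segProd a 0 (r + 1) ∧
      blockProd 1 (cut r) 1 a = segProd a (r + 1) (m + 1) := by
  constructor <;> refine blockProd_one_eq _ _ _ _ _ fun l => ?_ <;> have := l.2 <;>
    simp only [cut, Fin.le_def, Fin.val_castSucc] <;> split_ifs <;> simp <;> omega

lemma blockProd_cut₂ {r s : Fin m} (hrs : r < s) (a : Fin (m + 1) → E) :
    blockProd 1 (cut₂ r s) 0 a = segProd a 0 (r + 1) ∧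
      blockProd 1 (cut₂ r s) 1 a = segProd a (r + 1) (s + 1) ∧
      blockProd 1 (cut₂ r s) 2 a = segProd a (s + 1) (m + 1) := by
  rw [Fin.lt_def] at hrs
  refine ⟨?_, ?_, ?_⟩ <;> refine blockProd_one_eq _ _ _ _ _ fun l => ?_ <;> have := l.2 <;>
    simp only [cut₂, Fin.le_def, Fin.val_castSucc] <;> split_ifs <;> simp <;> omega

/-- An entry multiplied from the right by `h` multiplies the product up to that entry by `h`. -/
lemma segProd_update_mul {N : ℕ} (f : Fin N → E) (r : Fin N) (x h : E) {c : ℕ} (hc : c ≤ r) :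
    segProd (Function.update f r (x * h)) c (r + 1) =
      segProd (Function.update f r (x * 1)) c (r + 1) * h := by
  rw [← segProd_mul _ hc (Nat.le_succ _), ← segProd_mul _ hc (Nat.le_succ _), segProd_single,
    segProd_single, Function.update_self, Function.update_self, mul_one, mul_assoc]
  congr 1
  refine segProd_congr fun l _ hl => ?_
  have : l ≠ r := fun h => by subst h; omega
  simp [this]

lemma segProd_update_of_lt {N : ℕ} (f : Fin N → E) (r : Fin N) (x : E) {c d : ℕ} (hc : (r : ℕ) < c) :
    segProd (Function.update f r x) c d = segProd f c d := by
  refine segProd_congr fun l hl _ => ?_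
  have : l ≠ r := fun h => by subst h; omega
  simp [this]

lemma segProd_update_of_le {N : ℕ} (f : Fin N → E) (r : Fin N) (x : E) {c d : ℕ} (hc : d ≤ r) :
    segProd (Function.update f r x) c d = segProd f c d := by
  refine segProd_congr fun l _ hl => ?_
  have : l ≠ r := fun h => by subst h; omega
  simp [this]

variable [CompleteSpace E]

lemma pair_pure (h : E) (a : Fin 2 → E) : pair h (TP.pure a) = a 0 * h * a 1 := by
  rw [pair, TP.lift_pure]
  simp [mul_assoc]

lemma sandwich_pure (T : E →L[ℝ] E) (a : Fin 3 → E) :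
    sandwich T (TP.pure a) = a 0 * T (a 1) * a 2 := by
  rw [sandwich, TP.lift_pure]
  simp [List.ofFn_succ, mul_assoc]

/-- Filling the gap left by a removed letter with `h` substitutes `h` for that letter. -/
lemma pair_collect_cut (X : Fin n → E) (k : Fin m → Fin n) (r : Fin m) (u : TP E (m + 1)) (h : E) :
    pair h (collect X k (cut r) u) =
      interleave (ContinuousMultilinearMap.mkPiAlgebraFin ℝ (m + 1) E) u
        (Function.update (fun l => X (k l)) r h) := by
  rw [collect_cut, interleave_apply, interleave_apply, ← ContinuousLinearMap.comp_apply]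
  refine DFunLike.congr_fun (TP.ext_pure fun a => ?_) u
  rw [ContinuousLinearMap.comp_apply, TP.lift_pure, TP.lift_pure, insertLetters_apply,
    insertLetters_apply, ContinuousMultilinearMap.mkPiAlgebraFin_apply, mul_snoc_update,
    mul_snoc_update]
  change pair h (TP.pure _) = _
  set f : Fin (m + 1) → E := fun l => a l * Fin.snoc (α := fun _ => E) (fun l => X (k l)) 1 l
  have hr : (r : ℕ) = (r.castSucc : Fin (m + 1)) := rfl
  rw [pair_pure, (blockProd_cut r _).1, (blockProd_cut r _).2, ← segProd_full,
    ← segProd_mul (e := m + 1) _ (Nat.zero_le (r + 1)) (by omega), hr, segProd_update_mul _ _ _ h (Nat.zero_le _),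
    segProd_update_of_lt _ _ _ (Nat.lt_succ_self _), segProd_update_of_lt _ _ _ (Nat.lt_succ_self _)]

lemma sandwich_collect_cut₂ (X : Fin n → E) (k : Fin m → Fin n) {r s : Fin m} (hrs : r < s)
    (u : TP E (m + 1)) (g h : E) :
    sandwich (ContinuousLinearMap.mulLeftRight ℝ E g h) (collect X k (cut₂ r s) u) =
      interleave (ContinuousMultilinearMap.mkPiAlgebraFin ℝ (m + 1) E) u
        (Function.update (Function.update (fun l => X (k l)) r g) s h) := by
  rw [collect_cut₂ X k hrs, interleave_apply, interleave_apply, ← ContinuousLinearMap.comp_apply]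
  refine DFunLike.congr_fun (TP.ext_pure fun a => ?_) u
  rw [ContinuousLinearMap.comp_apply, TP.lift_pure, TP.lift_pure, insertLetters_apply,
    insertLetters_apply, ContinuousMultilinearMap.mkPiAlgebraFin_apply]
  simp only [mul_snoc_update]
  change sandwich _ (TP.pure _) = _
  set f : Fin (m + 1) → E := fun l => a l * Fin.snoc (α := fun _ => E) (fun l => X (k l)) 1 l
  have hr : (r : ℕ) = (r.castSucc : Fin (m + 1)) := rfl
  have hs : (s : ℕ) = (s.castSucc : Fin (m + 1)) := rfl
  have hrs' : (r.castSucc : ℕ) < s.castSucc := hrs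
  rw [sandwich_pure, (blockProd_cut₂ hrs _).1, (blockProd_cut₂ hrs _).2.1,
    (blockProd_cut₂ hrs _).2.2, ← segProd_full, ← segProd_mul (e := m + 1) _ (Nat.zero_le (s + 1)) (by omega),
    ← segProd_mul (e := (s : ℕ) + 1) _ (Nat.zero_le (r + 1)) (by omega), hr, hs,
    ContinuousLinearMap.mulLeftRight_apply]
  have e0 : ∀ y, segProd (Function.update (Function.update f r.castSucc y) s.castSucc
      (a s.castSucc * h)) (r.castSucc + 1) (s.castSucc + 1) = segProd (Function.update f s.castSucc
      (a s.castSucc * 1)) (r.castSucc + 1) (s.castSucc + 1) * h := fun y => by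
    rw [segProd_update_mul _ _ _ h (by omega), Function.update_comm (by simp [Fin.ext_iff]; omega),
      segProd_update_of_lt _ _ _ (by omega)]
  have e1 : segProd (Function.update (Function.update f r.castSucc (a r.castSucc * 1)) s.castSucc
      (a s.castSucc * 1)) (r.castSucc + 1) (s.castSucc + 1) = segProd (Function.update f s.castSucc
      (a s.castSucc * 1)) (r.castSucc + 1) (s.castSucc + 1) := by
    rw [Function.update_comm (by simp [Fin.ext_iff]; omega), segProd_update_of_lt _ _ _ (by omega)]
  have e2 : ∀ y z, segProd (Function.update (Function.update f r.castSucc y) s.castSucc z) 0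
      (r.castSucc + 1) = segProd (Function.update f r.castSucc y) 0 (r.castSucc + 1) :=
    fun y z => segProd_update_of_le _ _ _ (by omega)
  have e3 : ∀ y z, segProd (Function.update (Function.update f r.castSucc y) s.castSucc z)
      (s.castSucc + 1) (m + 1) = segProd f (s.castSucc + 1) (m + 1) :=
    fun y z => by rw [segProd_update_of_lt _ _ _ (by omega), segProd_update_of_lt _ _ _ (by omega)]
  rw [e0, e1, e2, e2, e3, e3, segProd_update_mul _ _ _ g (Nat.zero_le _)]
  simp only [mul_assoc]

end Identities

/-! ### Taylor expansion of multilinear maps -/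

section MultilinearTaylor

variable {E F : Type} [NormedAddCommGroup E] [NormedSpace ℝ E] [NormedAddCommGroup F]
  [NormedSpace ℝ F] {m : ℕ}

lemma sum_powersetCard_two {M : Type*} [AddCommMonoid M] (f : Finset (Fin m) → M) :
    ∑ S ∈ Finset.powersetCard 2 Finset.univ, f S = ∑ r, ∑ s, if r < s then f {r, s} else 0 := by
  rw [← Finset.sum_product', ← Finset.sum_filter]
  symm
  refine Finset.sum_bij (fun p _ => {p.1, p.2}) ?_ ?_ ?_ ?_
  · intro p hp
    have : p.1 < p.2 := by simpa using hp
    simp [Finset.mem_powersetCard, Finset.card_pair this.ne]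
  · rintro ⟨a, b⟩ hp ⟨c, d⟩ hq h
    have hab : a < b := by simpa using hp
    have hcd : c < d := by simpa using hq
    have h1 : a ∈ ({c, d} : Finset (Fin m)) := h ▸ by simp
    have h2 : b ∈ ({c, d} : Finset (Fin m)) := h ▸ by simp
    simp only [Finset.mem_insert, Finset.mem_singleton] at h1 h2
    simp only [Prod.mk.injEq]
    omega
  · intro S hS
    obtain ⟨a, b, hab, rfl⟩ := Finset.card_eq_two.1 (Finset.mem_powersetCard.1 hS).2
    rcases lt_or_gt_of_ne hab with h | h
    · exact ⟨(a, b), by simpa using h, rfl⟩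
    · exact ⟨(b, a), by simpa using h, Finset.pair_comm _ _⟩
  · intro p _; rfl

lemma piecewise_pair {ι : Type*} [DecidableEq ι] {α : Type*} (r s : ι) (h x : ι → α) :
    ({r, s} : Finset ι).piecewise h x = Function.update (Function.update x r (h r)) s (h s) := by
  funext l
  by_cases hs : l = s
  · subst hs; simp
  · by_cases hr : l = r
    · subst hr; simp [hs]
    · simp [hs, hr]

/-- Taylor expansion of a multilinear map to second order. The comparison with the binomial
expansion of `(ρ + θ) ^ m` keeps the bound summable over `m` for any power series that converges
at radius `ρ + θ`. -/
lemma norm_multilinear_taylor_le (P : MultilinearMap ℝ (fun _ : Fin m => E) F) {C ρ θ η : ℝ}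
    (hC : 0 ≤ C) (hθ : 0 < θ) (hη : 0 ≤ η) (hρ : 0 ≤ ρ) (hP : ∀ Y, ‖P Y‖ ≤ C * ∏ l, ‖Y l‖)
    {x h : Fin m → E} (hx : ∀ l, ‖x l‖ ≤ ρ) (hxh : ∀ l, ‖x l + h l‖ ≤ ρ) (hh : ∀ l, ‖h l‖ ≤ η) :
    ‖P (x + h) - P x - ∑ r, P (Function.update x r (h r)) -
      ∑ r, ∑ s, (if r < s then P (Function.update (Function.update x r (h r)) s (h s)) else 0)‖ ≤
      4 * C * (η / θ) ^ 3 * (ρ + θ) ^ m := by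
  classical
  set A : ℕ → F := fun j => ∑ S ∈ Finset.powersetCard j Finset.univ, P (S.piecewise h x)
  have hA0 : A 0 = P x := by simp [A]
  have hA1 : A 1 = ∑ r, P (Function.update x r (h r)) := by
    simp [A, Finset.powersetCard_one, Finset.piecewise_singleton]
  have hA2 : A 2 = ∑ r, ∑ s,
      (if r < s then P (Function.update (Function.update x r (h r)) s (h s)) else 0) := by
    simp only [A, sum_powersetCard_two, piecewise_pair]
  rw [← hA0, ← hA1, ← hA2]
  have hterm : ∀ S : Finset (Fin m), ‖P (S.piecewise h x)‖ ≤
      C * ((η / θ) ^ S.card * (θ ^ S.card * ρ ^ (m - S.card))) := fun S => by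
    refine (hP _).trans (mul_le_mul_of_nonneg_left ?_ hC)
    have : ∏ l, ‖S.piecewise h x l‖ ≤ ∏ l, (if l ∈ S then η else ρ) := by
      refine Finset.prod_le_prod (fun _ _ => norm_nonneg _) fun l _ => ?_
      by_cases hl : l ∈ S
      · simpa [hl] using hh l
      · simpa [hl] using hx l
    refine this.trans (le_of_eq ?_)
    rw [Finset.prod_ite, Finset.prod_const, Finset.prod_const, ← mul_assoc, ← mul_pow,
      div_mul_cancel₀ _ hθ.ne']
    congr 2
    · congr 1; ext l; simp
    · rw [Finset.filter_not, Finset.card_sdiff]; simp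
  have hsum : ∑ S : Finset (Fin m), θ ^ S.card * ρ ^ (m - S.card) = (ρ + θ) ^ m := by
    have := Finset.sum_pow_mul_eq_add_pow θ ρ (Finset.univ : Finset (Fin m))
    simpa [add_comm] using this
  have hpos : ∀ S : Finset (Fin m), 0 ≤ θ ^ S.card * ρ ^ (m - S.card) := fun S => by positivity
  rcases le_total η θ with hηθ | hηθ
  · have hq : η / θ ≤ 1 := (div_le_one hθ).2 hηθ
    have key : P (x + h) - A 0 - A 1 - A 2 =
        ∑ S : Finset (Fin m) with 3 ≤ S.card, P (S.piecewise h x) := by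
      rw [add_comm, MultilinearMap.map_add_univ,
        ← Finset.sum_filter_add_sum_filter_not _ (fun S : Finset (Fin m) => 3 ≤ S.card)]
      have : ∑ S : Finset (Fin m) with ¬ 3 ≤ S.card, P (S.piecewise h x) = A 0 + A 1 + A 2 := by
        have h3 : (Finset.univ.filter fun S : Finset (Fin m) => ¬ 3 ≤ S.card) =
            (Finset.range 3).biUnion fun j => Finset.powersetCard j Finset.univ := by
          ext S; simp [Finset.mem_powersetCard]
        rw [h3, Finset.sum_biUnion (fun a _ b _ hab =>
          Finset.univ.pairwise_disjoint_powersetCard hab)]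
        simp [Finset.sum_range_succ, A]
      rw [this]; abel
    rw [key]
    calc _ ≤ ∑ S : Finset (Fin m) with 3 ≤ S.card, C * (η / θ) ^ 3 * (θ ^ S.card * ρ ^ (m - S.card)) := by
          refine norm_sum_le_of_le _ fun S hS => (hterm S).trans ?_
          rw [mul_assoc]
          have h3 : 3 ≤ S.card := by simpa using hS
          have := pow_le_pow_of_le_one (by positivity) hq h3
          gcongr
      _ ≤ ∑ S : Finset (Fin m), C * (η / θ) ^ 3 * (θ ^ S.card * ρ ^ (m - S.card)) :=
          Finset.sum_le_univ_sum_of_nonneg fun S => by have := hpos S; positivity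
      _ = C * (η / θ) ^ 3 * (ρ + θ) ^ m := by rw [← Finset.mul_sum, hsum]
      _ ≤ _ := by
          have : 0 ≤ C * (η / θ) ^ 3 * (ρ + θ) ^ m := by positivity
          linarith
  · -- for `η > θ` the four terms are bounded one by one
    have hq : 1 ≤ η / θ := (one_le_div hθ).2 hηθ
    have hA : ∀ j ≤ 3, ‖A j‖ ≤ C * (η / θ) ^ 3 * (ρ + θ) ^ m := fun j hj => by
      calc _ ≤ ∑ S ∈ Finset.powersetCard j Finset.univ,
            C * (η / θ) ^ 3 * (θ ^ S.card * ρ ^ (m - S.card)) := by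
            refine norm_sum_le_of_le _ fun S hS => (hterm S).trans ?_
            rw [mul_assoc]
            have h3 : S.card ≤ 3 := (Finset.mem_powersetCard.1 hS).2.trans_le hj
            have := pow_le_pow_right₀ hq h3
            gcongr
        _ ≤ ∑ S : Finset (Fin m), C * (η / θ) ^ 3 * (θ ^ S.card * ρ ^ (m - S.card)) :=
            Finset.sum_le_univ_sum_of_nonneg fun S => by have := hpos S; positivity
        _ = _ := by rw [← Finset.mul_sum, hsum]
    have hx0 : ‖P (x + h)‖ ≤ C * (η / θ) ^ 3 * (ρ + θ) ^ m := by
      refine (hP _).trans ?_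
      rw [mul_assoc]
      refine mul_le_mul_of_nonneg_left ?_ hC
      calc _ ≤ ∏ _l : Fin m, (ρ + θ) := Finset.prod_le_prod (fun _ _ => norm_nonneg _) fun l _ =>
            (hxh l).trans (by linarith)
        _ = 1 * (ρ + θ) ^ m := by simp
        _ ≤ _ := by gcongr; exact one_le_pow₀ hq
    have h0 := hA 0 (by norm_num)
    have h1 := hA 1 (by norm_num)
    have h2 := hA 2 (by norm_num)
    have := norm_sub_le (P (x + h) - A 0 - A 1) (A 2)
    have := norm_sub_le (P (x + h) - A 0) (A 1)
    have := norm_sub_le (P (x + h)) (A 0)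
    linarith

/-- A multilinear map is bounded and Lipschitz on the ball of radius `ρ`, also when the entries
over a set `T` of at most two places are kept equal to a fixed vector `e`. -/
lemma norm_multilinear_le (P : MultilinearMap ℝ (fun _ : Fin m => E) F) {C ρ δ : ℝ} (e : E)
    (hC : 0 ≤ C) (hρ : 0 < ρ) (hδ : 0 ≤ δ) (hP : ∀ Y, ‖P Y‖ ≤ C * ∏ l, ‖Y l‖)
    {x y : Fin m → E} (T : Finset (Fin m)) (hT : T.card ≤ 2)
    (hxT : ∀ l ∈ T, x l = e ∧ y l = e)
    (hx : ∀ l ∉ T, ‖x l‖ ≤ ρ ∧ ‖y l‖ ≤ ρ ∧ ‖x l - y l‖ ≤ δ) :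
    ‖P x‖ ≤ C * (max 1 (‖e‖ / ρ)) ^ 2 * ρ ^ m ∧
      ‖P x - P y‖ ≤ C * (max 1 (‖e‖ / ρ)) ^ 2 / ρ * (m * ρ ^ m) * δ := by
  classical
  set κ := max 1 (‖e‖ / ρ)
  have hκ1 : 1 ≤ κ := le_max_left _ _
  have he : ‖e‖ ≤ ρ * κ := by
    rw [← div_le_iff₀' hρ]; exact le_max_right _ _
  set c : Fin m → ℝ := fun l => if l ∈ T then κ else 1
  have hc1 : ∀ l, 1 ≤ c l := fun l => by simp only [c]; split_ifs <;> simp [hκ1]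
  have hc : ∏ l, c l ≤ κ ^ 2 := by
    simp only [c, Finset.prod_ite_mem, Finset.univ_inter, Finset.prod_const]
    exact pow_le_pow_right₀ hκ1 hT
  have hxc : ∀ l, ‖x l‖ ≤ ρ * c l ∧ ‖y l‖ ≤ ρ * c l := fun l => by
    by_cases hl : l ∈ T
    · simp [c, hl, (hxT l hl).1, (hxT l hl).2, he]
    · simp [c, hl, (hx l hl).1, (hx l hl).2.1]
  constructor
  · refine (hP x).trans ?_
    rw [mul_assoc]
    refine mul_le_mul_of_nonneg_left ?_ hC
    calc _ ≤ ∏ l, (ρ * c l) := Finset.prod_le_prod (fun _ _ => norm_nonneg _) fun l _ => (hxc l).1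
      _ = ρ ^ m * ∏ l, c l := by rw [Finset.prod_mul_distrib]; simp
      _ ≤ _ := by rw [mul_comm]; gcongr
  · refine (P.norm_image_sub_le_of_bound' hC hP x y).trans ?_
    rw [mul_div_assoc, mul_assoc, mul_assoc]
    refine mul_le_mul_of_nonneg_left ?_ hC
    have hi : ∀ i, ∏ j, (if j = i then ‖x i - y i‖ else max ‖x j‖ ‖y j‖) ≤ κ ^ 2 / ρ * ρ ^ m * δ := by
      intro i
      calc _ ≤ ∏ j, (ρ * c j * if j = i then δ / ρ else 1) := by
            refine Finset.prod_le_prod (fun j _ => by split_ifs <;> positivity) fun j _ => ?_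
            split_ifs with h
            · subst h
              have : ‖x j - y j‖ ≤ δ := by
                by_cases hl : j ∈ T
                · simp [(hxT j hl).1, (hxT j hl).2, hδ]
                · exact (hx j hl).2.2
              calc _ ≤ δ * 1 := by linarith
                _ ≤ δ * c j := by gcongr; exact hc1 j
                _ = _ := by field_simp
            · rw [mul_one]
              exact max_le (hxc j).1 (hxc j).2
        _ = ρ ^ m * (∏ l, c l) * (δ / ρ) := by
            rw [Finset.prod_mul_distrib, Finset.prod_mul_distrib]; simp
        _ ≤ ρ ^ m * κ ^ 2 * (δ / ρ) := by gcongr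
        _ = _ := by ring
    refine (Finset.sum_le_sum fun i _ => hi i).trans (le_of_eq ?_)
    simp
    ring

lemma exists_cube_mul_pow_le {ρ θ : ℝ} (hρ : 0 < ρ) (hθ : 0 < θ) :
    ∃ c : ℝ, 0 ≤ c ∧ ∀ m : ℕ, (m : ℝ) ^ 3 * ρ ^ m ≤ c * (ρ + θ) ^ m := by
  have h : |ρ / (ρ + θ)| < 1 := by
    rw [abs_of_pos (by positivity), div_lt_one (by positivity)]; linarith
  obtain ⟨c, hc⟩ := (tendsto_pow_const_mul_const_pow_of_abs_lt_one 3 h).bddAbove_range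
  refine ⟨c, ?_, fun m => ?_⟩
  · exact le_trans (by positivity) (hc ⟨0, rfl⟩)
  · have := hc ⟨m, rfl⟩
    simp only [div_pow] at this
    rwa [← mul_div_assoc, div_le_iff₀ (by positivity)] at this

end MultilinearTaylor

/-! ### Noncommutative power series -/

section Series

variable {E : Type} [NormedRing E] [NormedAlgebra ℝ E] [CompleteSpace E] {n : ℕ}

/-- Weights `w` of the coefficients `A`, with radius of convergence at least `R`. -/
structure Majorizes (A : Coeffs E n) (w : (m : ℕ) → (Fin m → Fin n) → ℝ) (R : ENNReal) : Prop where
  isWeight : ∀ m k, IsWeight (A m k) (w m k)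
  summable : ∀ r : NNReal, (r : ENNReal) < R → Summable fun m : ℕ => (r : ℝ) ^ m * ∑ k, w m k

/-- Both kinds of analytic functions have a majorant: the norms of the coefficients, or the absolute
values of the scalar coefficients. -/
lemma AnalyticOnBall.exists_majorizes {A : Coeffs E n} {R : ENNReal} (h : AnalyticOnBall A R) :
    ∃ w, Majorizes A w R := by
  rcases h with h | ⟨c, hc, h⟩
  · exact ⟨fun m k => ‖A m k‖, fun m k => isWeight_norm _, h⟩
  · exact ⟨fun m k => |c m k|, fun m k => by rw [hc]; exact isWeight_smul_one _, h⟩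

/-- Without variables there is only the constant term. -/
lemma Majorizes.top_of_isEmpty {A : Coeffs E n} {w : (m : ℕ) → (Fin m → Fin n) → ℝ} {R : ENNReal}
    (h : Majorizes A w R) (hn : n = 0) : Majorizes A w ⊤ := by
  refine ⟨h.isWeight, fun r _ => summable_of_ne_finset_zero (s := {0}) fun m hm => ?_⟩
  subst hn
  have : IsEmpty (Fin m → Fin 0) := ⟨fun k => (k ⟨0, by
    have : m ≠ 0 := by simpa using hm
    omega⟩).elim0⟩
  simp

/-- The weights `w` are summable at the radius `ρ + θ`, which gives estimates on the ball of
radius `ρ`. -/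
structure Dominated (A : Coeffs E n) (w : (m : ℕ) → (Fin m → Fin n) → ℝ) (ρ θ : ℝ) : Prop where
  ρ_pos : 0 < ρ
  θ_pos : 0 < θ
  isWeight : ∀ m k, IsWeight (A m k) (w m k)
  summable : Summable fun m : ℕ => (ρ + θ) ^ m * ∑ k, w m k

lemma Majorizes.dominated {A : Coeffs E n} {w : (m : ℕ) → (Fin m → Fin n) → ℝ} {R : ENNReal}
    (h : Majorizes A w R) {ρ : NNReal} (hρ0 : 0 < ρ) (hρ : (ρ : ENNReal) < R) :
    ∃ θ : ℝ, Dominated A w ρ θ := by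
  obtain ⟨r, hr, hr'⟩ := ENNReal.lt_iff_exists_nnreal_btwn.1 hρ
  have hr : ρ < r := by exact_mod_cast hr
  exact ⟨r - ρ, hρ0, by simpa using hr, h.isWeight, by simpa using h.summable r hr'⟩

variable {A : Coeffs E n} {w : (m : ℕ) → (Fin m → Fin n) → ℝ} {ρ θ : ℝ}

/-- The terms of degree `m` of `evalSeries`. -/
def seriesTerm (A : Coeffs E n) (X : Fin n → E) (m : ℕ) : E := ∑ k, word X k (A m k)

/-- The terms of degree `m` of `deriv₁`. -/
def deriv₁Term (A : Coeffs E n) (i : Fin n) (X : Fin n → E) (m : ℕ) : TP E 2 :=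
  ∑ k, ∑ r, if k r = i then collect X k (cut r) (A m k) else 0

/-- The terms of degree `m` of `deriv₂`. -/
def deriv₂Term (A : Coeffs E n) (i j : Fin n) (X : Fin n → E) (m : ℕ) : TP E 3 :=
  ∑ k, ∑ r, ∑ s, if r < s ∧ k r = i ∧ k s = j then collect X k (cut₂ r s) (A m k) else 0

/-- `f` is bounded and Lipschitz on the ball of radius `ρ` with a constant which is summable over the
degrees. -/
def TermBound (w : (m : ℕ) → (Fin m → Fin n) → ℝ) (ρ θ : ℝ) {F : Type} [NormedAddCommGroup F]
    (f : (Fin n → E) → ℕ → F) : Prop :=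
  ∃ c : ℝ, 0 ≤ c ∧ ∀ X Y : Fin n → E, (∀ i, ‖X i‖ ≤ ρ) → (∀ i, ‖Y i‖ ≤ ρ) → ∀ δ, 0 ≤ δ →
    (∀ i, ‖X i - Y i‖ ≤ δ) → ∀ m : ℕ, 1 ≤ m →
      ‖f X m‖ ≤ c * ((ρ + θ) ^ m * ∑ k, w m k) ∧
        ‖f X m - f Y m‖ ≤ c * ((ρ + θ) ^ m * ∑ k, w m k) * δ

lemma Dominated.interleave_le (h : Dominated A w ρ θ) {F : Type} [NormedAddCommGroup F]
    [NormedSpace ℝ F] [CompleteSpace F] {K : ℝ} (hK : 0 ≤ K) : ∃ c : ℝ, 0 ≤ c ∧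
    ∀ (m : ℕ) (k : Fin m → Fin n) (G : ContinuousMultilinearMap ℝ (fun _ : Fin (m + 1) => E) F),
      UnitBounded G K → ∀ (x y : Fin m → E) (T : Finset (Fin m)), T.card ≤ 2 →
      (∀ l ∈ T, x l = 1 ∧ y l = 1) → ∀ δ, 0 ≤ δ →
      (∀ l ∉ T, ‖x l‖ ≤ ρ ∧ ‖y l‖ ≤ ρ ∧ ‖x l - y l‖ ≤ δ) → 1 ≤ m →
        (m : ℝ) ^ 2 * ‖interleave G (A m k) x‖ ≤ c * ((ρ + θ) ^ m * w m k) ∧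
        (m : ℝ) ^ 2 * ‖interleave G (A m k) x - interleave G (A m k) y‖ ≤
          c * ((ρ + θ) ^ m * w m k) * δ := by
  obtain ⟨c, hc, hc'⟩ := exists_cube_mul_pow_le h.ρ_pos h.θ_pos
  have hρ := h.ρ_pos
  set κ := max 1 (‖(1 : E)‖ / ρ)
  refine ⟨K * κ ^ 2 * c * (1 + ρ⁻¹), by positivity, fun m k G hG x y T hT hxT δ hδ hx hm => ?_⟩
  have hw := (h.isWeight m k).1
  have hm1 : (1 : ℝ) ≤ m := by exact_mod_cast hm
  obtain ⟨h1, h2⟩ := norm_multilinear_le (interleave G (A m k)) (C := K * w m k) 1 (by positivity) hρ hδ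
    ((h.isWeight m k).2 F G K hK hG) T hT hxT hx
  have hinv : 0 ≤ ρ⁻¹ := by positivity
  have hθ := h.θ_pos
  constructor
  · calc _ ≤ (m : ℝ) ^ 2 * (K * w m k * κ ^ 2 * ρ ^ m) := by gcongr
      _ = K * w m k * κ ^ 2 * ((m : ℝ) ^ 2 * ρ ^ m) := by ring
      _ ≤ K * w m k * κ ^ 2 * ((m : ℝ) ^ 3 * ρ ^ m) := by
          gcongr <;> first | exact hm1 | omega
      _ ≤ K * w m k * κ ^ 2 * (c * (ρ + θ) ^ m) :=
          mul_le_mul_of_nonneg_left (hc' m) (by positivity)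
      _ = K * κ ^ 2 * c * 1 * ((ρ + θ) ^ m * w m k) := by ring
      _ ≤ _ := by gcongr; linarith
  · calc _ ≤ (m : ℝ) ^ 2 * (K * w m k * κ ^ 2 / ρ * (m * ρ ^ m) * δ) := by gcongr
      _ = K * w m k * κ ^ 2 / ρ * ((m : ℝ) ^ 3 * ρ ^ m) * δ := by ring
      _ ≤ K * w m k * κ ^ 2 / ρ * (c * (ρ + θ) ^ m) * δ :=
          mul_le_mul_of_nonneg_right (mul_le_mul_of_nonneg_left (hc' m) (by positivity)) hδ
      _ = K * κ ^ 2 * c * ρ⁻¹ * ((ρ + θ) ^ m * w m k) * δ := by ring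
      _ ≤ _ := by gcongr; linarith

lemma Dominated.termBound_eval (h : Dominated A w ρ θ) : TermBound w ρ θ (seriesTerm A) := by
  obtain ⟨c, hc, hc'⟩ := h.interleave_le (F := E) (norm_nonneg (1 : E))
  refine ⟨c, hc, fun X Y hX hY δ hδ hXY m hm => ?_⟩
  have hm1 : (1 : ℝ) ≤ (m : ℝ) ^ 2 := one_le_pow₀ (by exact_mod_cast hm)
  have key := fun k => hc' m k _ (unitBounded_mkPiAlgebraFin (m + 1)) (fun l => X (k l))
    (fun l => Y (k l)) ∅ (by simp) (by simp) δ hδ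
    (fun l _ => ⟨hX _, hY _, hXY _⟩) hm
  rw [Finset.mul_sum, Finset.mul_sum, Finset.sum_mul]
  constructor
  · exact norm_sum_le_of_le _ fun k _ => (le_mul_of_one_le_left (norm_nonneg _) hm1).trans (key k).1
  · rw [seriesTerm, seriesTerm, ← Finset.sum_sub_distrib]
    exact norm_sum_le_of_le _ fun k _ => (le_mul_of_one_le_left (norm_nonneg _) hm1).trans (key k).2

lemma norm_sum_const_le {F : Type} [NormedAddCommGroup F] {m : ℕ} (f : Fin m → F) {b : ℝ}
    (h : ∀ r, ‖f r‖ ≤ b) : ‖∑ r, f r‖ ≤ m * b := by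
  refine (norm_sum_le_of_le _ fun r _ => h r).trans (le_of_eq ?_)
  simp

lemma Dominated.termBound_deriv₁ (h : Dominated A w ρ θ) (i : Fin n) :
    TermBound w ρ θ (deriv₁Term A i) := by
  obtain ⟨c, hc, hc'⟩ := h.interleave_le (F := TP E 2) (by positivity : 0 ≤ ‖(1 : E)‖ ^ 2)
  refine ⟨c, hc, fun X Y hX hY δ hδ hXY m hm => ?_⟩
  have hm1 : (1 : ℝ) ≤ m := by exact_mod_cast hm
  have hm0 : (0 : ℝ) < (m : ℝ) ^ 2 := by positivity
  have hθ := h.θ_pos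
  have hρ := h.ρ_pos
  have key := fun k r => hc' m k _ (unitBounded_blockMap (cut r))
    (Function.update (fun l => X (k l)) r 1)
    (Function.update (fun l => Y (k l)) r 1) {r} (by simp) (by simp) δ hδ
    (fun l hl => by
      rw [Finset.mem_singleton] at hl
      simp only [Function.update_of_ne hl]
      exact ⟨hX _, hY _, hXY _⟩) hm
  have hb : ∀ {a b : ℝ}, (m : ℝ) ^ 2 * a ≤ b → 0 ≤ a → m * a ≤ b := fun h1 h2 => by
    refine le_trans ?_ h1
    gcongr
    nlinarith
  rw [Finset.mul_sum, Finset.mul_sum, Finset.sum_mul]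
  simp only [deriv₁Term, collect_cut]
  constructor
  · refine norm_sum_le_of_le _ fun k _ => ?_
    refine (norm_sum_const_le (b := c * ((ρ + θ) ^ m * w m k) / m) _ fun r => ?_).trans
      (le_of_eq (by field_simp))
    rw [le_div_iff₀' (by positivity)]
    split_ifs
    · exact hb (key k r).1 (norm_nonneg _)
    · have := (h.isWeight m k).1
      simp; positivity
  · rw [← Finset.sum_sub_distrib]
    refine norm_sum_le_of_le _ fun k _ => ?_
    rw [← Finset.sum_sub_distrib]
    refine (norm_sum_const_le (b := c * ((ρ + θ) ^ m * w m k) * δ / m) _ fun r => ?_).trans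
      (le_of_eq (by field_simp))
    rw [le_div_iff₀' (by positivity)]
    split_ifs
    · exact hb (key k r).2 (norm_nonneg _)
    · have := (h.isWeight m k).1
      simp; positivity

lemma Dominated.termBound_deriv₂ (h : Dominated A w ρ θ) (i j : Fin n) :
    TermBound w ρ θ (deriv₂Term A i j) := by
  obtain ⟨c, hc, hc'⟩ := h.interleave_le (F := TP E 3) (by positivity : 0 ≤ ‖(1 : E)‖ ^ 3)
  refine ⟨c, hc, fun X Y hX hY δ hδ hXY m hm => ?_⟩
  have hm1 : (1 : ℝ) ≤ m := by exact_mod_cast hm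
  have hθ := h.θ_pos
  have hρ := h.ρ_pos
  have key := fun k {r s : Fin m} (hrs : r < s) => hc' m k _ (unitBounded_blockMap (cut₂ r s))
    (Function.update (Function.update (fun l => X (k l)) r 1) s 1)
    (Function.update (Function.update (fun l => Y (k l)) r 1) s 1) {r, s} Finset.card_le_two
    (fun l hl => by
      rcases eq_or_ne l s with rfl | hs
      · simp
      · have : l = r := by simpa [hs] using hl
        subst this
        simp [hs]) δ hδ
    (fun l hl => by
      simp only [Finset.mem_insert, Finset.mem_singleton, not_or] at hl
      simp only [Function.update_of_ne hl.1, Function.update_of_ne hl.2]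
      exact ⟨hX _, hY _, hXY _⟩) hm
  rw [Finset.mul_sum, Finset.mul_sum, Finset.sum_mul]
  simp only [deriv₂Term]
  constructor
  · refine norm_sum_le_of_le _ fun k _ => ?_
    refine (norm_sum_const_le (b := m * (c * ((ρ + θ) ^ m * w m k) / m ^ 2)) _ fun r =>
      norm_sum_const_le _ fun s => ?_).trans (le_of_eq (by field_simp))
    rw [le_div_iff₀' (by positivity)]
    split_ifs with hrs
    · rw [collect_cut₂ X k hrs.1]
      exact (key k hrs.1).1
    · have := (h.isWeight m k).1
      simp; positivity
  · rw [← Finset.sum_sub_distrib]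
    refine norm_sum_le_of_le _ fun k _ => ?_
    simp only [← Finset.sum_sub_distrib]
    refine (norm_sum_const_le (b := m * (c * ((ρ + θ) ^ m * w m k) * δ / m ^ 2)) _ fun r =>
      norm_sum_const_le _ fun s => ?_).trans (le_of_eq (by field_simp))
    rw [le_div_iff₀' (by positivity)]
    split_ifs with hrs
    · rw [collect_cut₂ X k hrs.1, collect_cut₂ Y k hrs.1]
      exact (key k hrs.1).2
    · have := (h.isWeight m k).1
      simp; positivity

section TermBound

variable {F : Type} [NormedAddCommGroup F] [CompleteSpace F] {f : (Fin n → E) → ℕ → F}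

lemma TermBound.summable (hf : TermBound w ρ θ f)
    (hw : Summable fun m : ℕ => (ρ + θ) ^ m * ∑ k, w m k) {X : Fin n → E} (hX : ∀ i, ‖X i‖ ≤ ρ) :
    Summable (f X) := by
  obtain ⟨c, hc, h⟩ := hf
  rw [← summable_nat_add_iff 1]
  refine Summable.of_norm_bounded ((summable_nat_add_iff 1).2 (hw.mul_left c)) fun m => ?_
  exact (h X X hX hX 0 le_rfl (by simp) (m + 1) (by omega)).1

/-- The constant terms need to be bounded separately, since the constants of `TermBound` do not
control them; they do not depend on the point. -/
lemma TermBound.bounded_lipschitz (hf : TermBound w ρ θ f)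
    (hw : Summable fun m : ℕ => (ρ + θ) ^ m * ∑ k, w m k) (h0 : ∀ X Y, f X 0 = f Y 0) :
    ∃ c : ℝ, 0 ≤ c ∧ ∀ X Y : Fin n → E, (∀ i, ‖X i‖ ≤ ρ) → (∀ i, ‖Y i‖ ≤ ρ) → ∀ δ, 0 ≤ δ →
      (∀ i, ‖X i - Y i‖ ≤ δ) → ‖∑' m, f X m‖ ≤ c ∧ ‖∑' m, f X m - ∑' m, f Y m‖ ≤ c * δ := by
  obtain ⟨c, hc, h⟩ := hf
  set a : ℕ → ℝ := fun m => c * ((ρ + θ) ^ (m + 1) * ∑ k, w (m + 1) k)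
  have ha : Summable a := (summable_nat_add_iff 1).2 (hw.mul_left c)
  refine ⟨‖f 0 0‖ + |∑' m, a m|, by positivity, fun X Y hX hY δ hδ hXY => ?_⟩
  have hsX := TermBound.summable ⟨c, hc, h⟩ hw hX
  have hsY := TermBound.summable ⟨c, hc, h⟩ hw hY
  have hX1 : ∀ m, ‖f X (m + 1)‖ ≤ a m := fun m => (h X Y hX hY δ hδ hXY (m + 1) (by omega)).1
  have hXY1 : ∀ m, ‖f X (m + 1) - f Y (m + 1)‖ ≤ a m * δ :=
    fun m => (h X Y hX hY δ hδ hXY (m + 1) (by omega)).2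
  have hle := le_abs_self (∑' m, a m)
  constructor
  · rw [hsX.tsum_eq_zero_add]
    refine (norm_add_le _ _).trans (add_le_add (by rw [h0 X 0]) ?_)
    exact (tsum_of_norm_bounded ha.hasSum hX1).trans hle
  · rw [hsX.tsum_eq_zero_add, hsY.tsum_eq_zero_add, h0 X Y, add_sub_add_left_eq_sub,
      ← ((summable_nat_add_iff 1).2 hsX).tsum_sub ((summable_nat_add_iff 1).2 hsY)]
    refine (tsum_of_norm_bounded (ha.mul_right δ).hasSum hXY1).trans ?_
    rw [tsum_mul_right]
    gcongr
    linarith [norm_nonneg (f 0 0)]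

end TermBound

lemma Dominated.deriv₁_lipschitz (h : Dominated A w ρ θ) (i : Fin n) :
    ∃ c : ℝ, 0 ≤ c ∧ ∀ X Y : Fin n → E, (∀ i, ‖X i‖ ≤ ρ) → (∀ i, ‖Y i‖ ≤ ρ) → ∀ δ, 0 ≤ δ →
      (∀ i, ‖X i - Y i‖ ≤ δ) → ‖deriv₁ A i X‖ ≤ c ∧ ‖deriv₁ A i X - deriv₁ A i Y‖ ≤ c * δ :=
  (h.termBound_deriv₁ i).bounded_lipschitz h.summable fun _ _ => by simp [deriv₁Term]

lemma Dominated.deriv₂_lipschitz (h : Dominated A w ρ θ) (i j : Fin n) :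
    ∃ c : ℝ, 0 ≤ c ∧ ∀ X Y : Fin n → E, (∀ i, ‖X i‖ ≤ ρ) → (∀ i, ‖Y i‖ ≤ ρ) → ∀ δ, 0 ≤ δ →
      (∀ i, ‖X i - Y i‖ ≤ δ) → ‖deriv₂ A i j X‖ ≤ c ∧ ‖deriv₂ A i j X - deriv₂ A i j Y‖ ≤ c * δ :=
  (h.termBound_deriv₂ i j).bounded_lipschitz h.summable fun _ _ => by simp [deriv₂Term]

lemma sum_pair_deriv₁Term (X H : Fin n → E) (m : ℕ) :
    ∑ i, pair (H i) (deriv₁Term A i X m) = ∑ k, ∑ r,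
      interleave (ContinuousMultilinearMap.mkPiAlgebraFin ℝ (m + 1) E) (A m k)
        (Function.update (fun l => X (k l)) r (H (k r))) := by
  simp only [deriv₁Term, map_sum]
  rw [Finset.sum_comm]
  refine Finset.sum_congr rfl fun k _ => ?_
  rw [Finset.sum_comm]
  refine Finset.sum_congr rfl fun r _ => ?_
  rw [Finset.sum_eq_single (k r)]
  · rw [if_pos rfl, pair_collect_cut]
  · intro i _ hi
    rw [if_neg hi.symm, map_zero]
  · simp

lemma sum_sandwich_deriv₂Term (X H : Fin n → E) (m : ℕ) :
    ∑ i, ∑ j, sandwich (ContinuousLinearMap.mulLeftRight ℝ E (H i) (H j)) (deriv₂Term A i j X m) =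
      ∑ k, ∑ r, ∑ s, if r < s then
        interleave (ContinuousMultilinearMap.mkPiAlgebraFin ℝ (m + 1) E) (A m k)
          (Function.update (Function.update (fun l => X (k l)) r (H (k r))) s (H (k s))) else 0 := by
  simp only [deriv₂Term, map_sum]
  have e : ∀ f : Fin n → Fin n → (Fin m → Fin n) → Fin m → Fin m → E,
      ∑ i, ∑ j, ∑ k, ∑ r, ∑ s, f i j k r s = ∑ k, ∑ r, ∑ s, ∑ i, ∑ j, f i j k r s := fun f => by
    simp only [← Fintype.sum_prod_type']
    refine Fintype.sum_equiv ⟨fun p => (p.2.2.1, p.2.2.2.1, p.2.2.2.2, p.1, p.2.1),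
      fun p => (p.2.2.2.1, p.2.2.2.2, p.1, p.2.1, p.2.2.1), fun _ => rfl, fun _ => rfl⟩ _ _ fun _ => rfl
  rw [e]
  refine Finset.sum_congr rfl fun k _ => Finset.sum_congr rfl fun r _ =>
    Finset.sum_congr rfl fun s _ => ?_
  split_ifs with hrs
  · rw [Finset.sum_eq_single (k r), Finset.sum_eq_single (k s)]
    · rw [if_pos ⟨hrs, rfl, rfl⟩, sandwich_collect_cut₂ X k hrs]
    · intro j _ hj
      rw [if_neg (fun h => hj h.2.2.symm), map_zero]
    · simp
    · intro i _ hi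
      refine Finset.sum_eq_zero fun j _ => ?_
      rw [if_neg (fun h => hi h.2.1.symm), map_zero]
    · simp
  · refine Finset.sum_eq_zero fun i _ => Finset.sum_eq_zero fun j _ => ?_
    rw [if_neg (fun h => hrs h.1), map_zero]

/-- Taylor expansion to second order. -/
lemma Dominated.taylor (h : Dominated A w ρ θ) :
    ∃ c : ℝ, 0 ≤ c ∧ ∀ X Y : Fin n → E, (∀ i, ‖X i‖ ≤ ρ) → (∀ i, ‖Y i‖ ≤ ρ) → ∀ δ, 0 ≤ δ →
      (∀ i, ‖Y i - X i‖ ≤ δ) →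
      ‖evalSeries A Y - evalSeries A X - ∑ i, pair (Y i - X i) (deriv₁ A i X) -
        ∑ i, ∑ j, sandwich (ContinuousLinearMap.mulLeftRight ℝ E (Y i - X i) (Y j - X j))
          (deriv₂ A i j X)‖ ≤ c * δ ^ 3 := by
  have hρ := h.ρ_pos
  have hθ := h.θ_pos
  set a : ℕ → ℝ := fun m => 4 * ‖(1 : E)‖ / θ ^ 3 * ((ρ + θ) ^ m * ∑ k, w m k)
  have ha : Summable a := h.summable.mul_left _
  have ha0 : ∀ m, 0 ≤ a m := fun m => by
    have : 0 ≤ ∑ k, w m k := Finset.sum_nonneg fun k _ => (h.isWeight m k).1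
    positivity
  refine ⟨∑' m, a m, tsum_nonneg ha0, fun X Y hX hY δ hδ hXY => ?_⟩
  set H : Fin n → E := fun i => Y i - X i with hH
  have s0 := h.termBound_eval.summable h.summable hX
  have s0' := h.termBound_eval.summable h.summable hY
  have s1 := fun i => (h.termBound_deriv₁ i).summable h.summable hX
  have s2 := fun i j => (h.termBound_deriv₂ i j).summable h.summable hX
  have s1' : ∀ i, Summable fun m => pair (H i) (deriv₁Term A i X m) :=
    fun i => (s1 i).map (pair (H i)) (pair (H i)).continuous
  have s2' : ∀ i j, Summable fun m =>
      sandwich (ContinuousLinearMap.mulLeftRight ℝ E (H i) (H j)) (deriv₂Term A i j X m) :=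
    fun i j => (s2 i j).map (sandwich _) (sandwich _).continuous
  have e1 : ∑ i, pair (H i) (deriv₁ A i X) = ∑' m, ∑ i, pair (H i) (deriv₁Term A i X m) := by
    rw [Summable.tsum_finsetSum fun i _ => s1' i]
    exact Finset.sum_congr rfl fun i _ => (pair (H i)).map_tsum (s1 i)
  have e2 : ∑ i, ∑ j, sandwich (ContinuousLinearMap.mulLeftRight ℝ E (H i) (H j)) (deriv₂ A i j X) =
      ∑' m, ∑ i, ∑ j, sandwich (ContinuousLinearMap.mulLeftRight ℝ E (H i) (H j))
        (deriv₂Term A i j X m) := by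
    rw [Summable.tsum_finsetSum fun i _ => summable_sum fun j _ => s2' i j]
    refine Finset.sum_congr rfl fun i _ => ?_
    rw [Summable.tsum_finsetSum fun j _ => s2' i j]
    exact Finset.sum_congr rfl fun j _ => (sandwich _).map_tsum (s2 i j)
  have e0 : ∀ X, evalSeries A X = ∑' m, seriesTerm A X m := fun _ => rfl
  rw [e1, e2, e0, e0, ← s0'.tsum_sub s0, ← (s0'.sub s0).tsum_sub (summable_sum fun i _ => s1' i),
    ← ((s0'.sub s0).sub (summable_sum fun i _ => s1' i)).tsum_sub
      (summable_sum fun i _ => summable_sum fun j _ => s2' i j), ← tsum_mul_right]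
  refine tsum_of_norm_bounded (ha.mul_right _).hasSum fun m => ?_
  rw [sum_pair_deriv₁Term, sum_sandwich_deriv₂Term, seriesTerm, seriesTerm, ← Finset.sum_sub_distrib,
    ← Finset.sum_sub_distrib, ← Finset.sum_sub_distrib]
  simp only [a, Finset.mul_sum, Finset.sum_mul]
  refine norm_sum_le_of_le _ fun k _ => ?_
  have := norm_multilinear_taylor_le
    (interleave (ContinuousMultilinearMap.mkPiAlgebraFin ℝ (m + 1) E) (A m k))
    (C := ‖(1 : E)‖ * w m k) (mul_nonneg (norm_nonneg _) (h.isWeight m k).1) hθ hδ hρ.le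
    ((h.isWeight m k).2 E _ _ (norm_nonneg _) (unitBounded_mkPiAlgebraFin (m + 1)))
    (x := fun l => X (k l)) (h := fun l => H (k l)) (fun l => hX _)
    (fun l => by simpa [hH] using hY (k l)) (fun l => hXY _)
  have e3 : (fun l => X (k l)) + (fun l => H (k l)) = fun l => Y (k l) := by
    funext l; simp [hH]
  rw [e3] at this
  refine this.trans (le_of_eq ?_)
  rw [div_pow]
  ring

lemma norm_pair_le (h : E) (u : TP E 2) : ‖pair h u‖ ≤ ‖h‖ * ‖u‖ := by
  refine TP.norm_lift_apply_le _ (norm_nonneg h) (fun a => ?_) u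
  have := pair_pure h a
  rw [pair, TP.lift_pure] at this
  rw [this, Fin.prod_univ_two]
  calc _ ≤ ‖a 0‖ * ‖h‖ * ‖a 1‖ := (norm_mul_le _ _).trans (by gcongr; exact norm_mul_le _ _)
    _ = _ := by ring

lemma norm_sandwich_le (T : E →L[ℝ] E) (u : TP E 3) : ‖sandwich T u‖ ≤ ‖T‖ * ‖u‖ := by
  refine TP.norm_lift_apply_le _ (norm_nonneg T) (fun a => ?_) u
  have := sandwich_pure T a
  rw [sandwich, TP.lift_pure] at this
  rw [this, Fin.prod_univ_three]
  calc _ ≤ ‖a 0‖ * (‖T‖ * ‖a 1‖) * ‖a 2‖ := by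
        refine (norm_mul_le _ _).trans ?_
        gcongr
        exact (norm_mul_le _ _).trans (by gcongr; exact T.le_opNorm _)
    _ = _ := by ring

lemma sandwich_add_apply (S T : E →L[ℝ] E) (u : TP E 3) :
    sandwich (S + T) u = sandwich S u + sandwich T u := by
  rw [← add_apply]
  refine DFunLike.congr_fun (TP.ext_pure fun a => ?_) u
  simp [sandwich_pure, mul_add, add_mul]

lemma sandwich_smul_apply (c : ℝ) (T : E →L[ℝ] E) (u : TP E 3) :
    sandwich (c • T) u = c • sandwich T u := by
  rw [← smul_apply]
  refine DFunLike.congr_fun (TP.ext_pure fun a => ?_) u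
  simp [sandwich_pure]

lemma pair_add_apply (g h : E) (u : TP E 2) : pair (g + h) u = pair g u + pair h u := by
  rw [← add_apply]
  refine DFunLike.congr_fun (TP.ext_pure fun a => ?_) u
  simp [pair_pure, mul_add, add_mul]

lemma pair_smul_apply (c : ℝ) (h : E) (u : TP E 2) : pair (c • h) u = c • pair h u := by
  rw [← smul_apply]
  refine DFunLike.congr_fun (TP.ext_pure fun a => ?_) u
  simp [pair_pure]

/-- `sandwich` as a continuous linear map of the operator, for a fixed tensor. -/
def sandwichL (u : TP E 3) : (E →L[ℝ] E) →L[ℝ] E :=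
  LinearMap.mkContinuous
    { toFun := fun T => sandwich T u
      map_add' := fun S T => sandwich_add_apply S T u
      map_smul' := fun c T => sandwich_smul_apply c T u } ‖u‖
    fun T => (norm_sandwich_le T u).trans (by rw [mul_comm])

lemma sandwichL_apply (u : TP E 3) (T : E →L[ℝ] E) : sandwichL u T = sandwich T u := rfl

/-- `pair` as a continuous linear map of the inserted element, for a fixed tensor. -/
def pairL (u : TP E 2) : E →L[ℝ] E :=
  LinearMap.mkContinuous
    { toFun := fun h => pair h u
      map_add' := fun g h => pair_add_apply g h u
      map_smul' := fun c h => pair_smul_apply c h u } ‖u‖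
    fun h => (norm_pair_le h u).trans (by rw [mul_comm])

lemma pairL_apply (u : TP E 2) (h : E) : pairL u h = pair h u := rfl

/-- The Fréchet derivative of `F` at `X` is `h ↦ ∑ᵢ D_iF(X)[h_i]`. -/
lemma Dominated.hasFDerivAt (h : Dominated A w ρ θ) {X : Fin n → E} (hX : ∀ i, ‖X i‖ < ρ) :
    HasFDerivAt (evalSeries A)
      (∑ i, (pairL (deriv₁ A i X)).comp (ContinuousLinearMap.proj (R := ℝ) i)) X := by
  obtain ⟨c, hc, hT⟩ := h.taylor
  rw [hasFDerivAt_iff_isLittleO_nhds_zero]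
  set C : ℝ := c + ∑ i, ∑ j, ‖deriv₂ A i j X‖
  have hC : 0 ≤ C := by positivity
  have hmem : ∀ᶠ H : Fin n → E in 𝓝 0, (∀ i, ‖X i + H i‖ ≤ ρ) ∧ ‖H‖ ≤ 1 := by
    refine Filter.Eventually.and ?_ ?_
    · refine Filter.eventually_all.2 fun i => ?_
      have : Tendsto (fun H : Fin n → E => ‖X i + H i‖) (𝓝 0) (𝓝 ‖X i + (0 : Fin n → E) i‖) :=
        (Continuous.tendsto (by fun_prop) 0)
      simp only [Pi.zero_apply, add_zero] at this
      exact (this.eventually (gt_mem_nhds (hX i))).mono fun _ h => le_of_lt h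
    · have : Tendsto (fun H : Fin n → E => ‖H‖) (𝓝 0) (𝓝 ‖(0 : Fin n → E)‖) :=
        continuous_norm.tendsto 0
      rw [norm_zero] at this
      exact (this.eventually (gt_mem_nhds one_pos)).mono fun _ h => le_of_lt h
  have hO : (fun H : Fin n → E => evalSeries A (X + H) - evalSeries A X -
      (∑ i, (pairL (deriv₁ A i X)).comp (ContinuousLinearMap.proj (R := ℝ) i)) H) =O[𝓝 0]
      fun H => ‖H‖ ^ 2 := by
    refine Asymptotics.IsBigO.of_bound C ?_
    filter_upwards [hmem] with H hH
    have := hT X (X + H) (fun i => (hX i).le) (fun i => hH.1 i) ‖H‖ (norm_nonneg _)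
      (fun i => by simpa using norm_le_pi_norm H i)
    simp only [Pi.add_apply, add_sub_cancel_left] at this
    have e : (∑ i, (pairL (deriv₁ A i X)).comp (ContinuousLinearMap.proj (R := ℝ) i)) H =
        ∑ i, pair (H i) (deriv₁ A i X) := by
      simp [pairL_apply]
    rw [e, norm_pow, norm_norm]
    have h2 : ‖∑ i, ∑ j, sandwich (ContinuousLinearMap.mulLeftRight ℝ E (H i) (H j))
        (deriv₂ A i j X)‖ ≤ (∑ i, ∑ j, ‖deriv₂ A i j X‖) * ‖H‖ ^ 2 := by
      rw [Finset.sum_mul]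
      refine norm_sum_le_of_le _ fun i _ => ?_
      rw [Finset.sum_mul]
      refine norm_sum_le_of_le _ fun j _ => ?_
      refine (norm_sandwich_le _ _).trans ?_
      rw [mul_comm]
      gcongr
      refine (ContinuousLinearMap.opNorm_mulLeftRight_apply_apply_le ℝ E _ _).trans ?_
      rw [sq]
      gcongr <;> exact norm_le_pi_norm H _
    have h3 := norm_le_norm_sub_add (evalSeries A (X + H) - evalSeries A X -
      ∑ i, pair (H i) (deriv₁ A i X)) (∑ i, ∑ j,
        sandwich (ContinuousLinearMap.mulLeftRight ℝ E (H i) (H j)) (deriv₂ A i j X))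
    have h4 : c * ‖H‖ ^ 3 ≤ c * ‖H‖ ^ 2 := by
      refine mul_le_mul_of_nonneg_left ?_ hc
      exact pow_le_pow_of_le_one (norm_nonneg _) hH.2 (by norm_num)
    rw [add_mul]
    linarith
  refine hO.trans_isLittleO ?_
  exact (Asymptotics.isLittleO_norm_pow_id (by norm_num : 1 < 2))

end Series

open scoped TensorProduct

/-! ### Two-sided multiplication by fields on Fock space -/

section Chaos

variable {H : Type} [NormedAddCommGroup H] [InnerProductSpace ℝ H]

/-- Annihilation from the left is bounded as a map into `H ⊗ H^{⊗k}`, which is what the sum over an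
orthonormal family measures; the bound does not see the size of the family. -/
lemma sum_annL_sq_le (q : ℝ) (k : ℕ) {ι : Type*} [Fintype ι] {e : ι → H}
    (he : Orthonormal ℝ e) (x : TPow H (k + 1)) :
    ∑ i, ‖annL q k (e i) x‖ ^ 2 ≤ ((∑ j ∈ Finset.range (k + 1), |q| ^ j) * ‖x‖) ^ 2 := by
  induction k with
  | zero => simpa [annL] using sum_contr_sq_le he x
  | succ k ih =>
    obtain ⟨m, f, y, hf, rfl⟩ := exists_orthonormal_tens x
    set x := ∑ a, tens (f a) (y a) with hx
    have e1 : ∀ i, annL q (k + 1) (e i) x = contr (e i) ((cons H (k + 1)).symm x) +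
        q • ∑ a, tens (f a) (annL q k (e i) (y a)) := by
      intro i
      simp only [hx, map_sum, annL_succ_tens, Finset.sum_add_distrib, Finset.smul_sum]
      simp [tens]
    simp only [e1]
    rw [Finset.sum_range_succ', pow_zero, add_comm (∑ j ∈ _, _), add_mul, one_mul]
    refine sum_norm_add_sq_le _ _ _ (by positivity) (by positivity) (sum_contr_sq_le he x) ?_
    have e2 : ∑ j ∈ Finset.range (k + 1), |q| ^ (j + 1) = |q| * ∑ j ∈ Finset.range (k + 1), |q| ^ j := by
      rw [Finset.mul_sum]; exact Finset.sum_congr rfl fun j _ => pow_succ' _ _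
    simp only [norm_smul, mul_pow, ← Finset.mul_sum, Real.norm_eq_abs, e2]
    rw [mul_assoc]
    refine mul_le_mul_of_nonneg_left ?_ (by positivity)
    simp only [norm_sq_sum_tens hf]
    rw [Finset.sum_comm, norm_sq_sum_tens hf, Finset.mul_sum]
    refine Finset.sum_le_sum fun a _ => ?_
    rw [← mul_pow]
    exact ih (y a)

lemma sum_annL_sq_le' {q : ℝ} (hq : |q| < 1) (k : ℕ) {ι : Type*} [Fintype ι] {e : ι → H}
    (he : Orthonormal ℝ e) (x : TPow H (k + 1)) :
    ∑ i, ‖annL q k (e i) x‖ ^ 2 ≤ (Dq q * ‖x‖) ^ 2 := by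
  refine (sum_annL_sq_le q k he x).trans ?_
  gcongr
  exact geom_le q hq _

lemma norm_annR_le {q : ℝ} (hq : |q| < 1) (k : ℕ) (g : H) (x : TPow H (k + 1)) :
    ‖annR q k g x‖ ≤ Dq q * ‖g‖ * ‖x‖ := by
  have hD := one_le_Dq hq
  rcases eq_or_ne g 0 with rfl | hg
  · simp
  · have he : Orthonormal ℝ (fun _ : Unit => ‖g‖⁻¹ • g) := by
      refine ⟨fun _ => ?_, fun i j hij => (hij rfl).elim⟩
      rw [norm_smul, norm_inv, norm_norm, inv_mul_cancel₀ (norm_ne_zero_iff.2 hg)]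
    have h1 := sum_annR_sq_le q k he x
    simp only [Finset.univ_unique, Finset.sum_singleton, map_smul, LinearMap.smul_apply] at h1
    have h2 := abs_le_of_sq_le_sq h1 (by positivity)
    rw [norm_smul, norm_inv, norm_norm, abs_of_nonneg (by positivity),
      inv_mul_le_iff₀ (norm_pos_iff.2 hg)] at h2
    refine h2.trans ?_
    have := geom_le q hq (k + 1)
    calc _ ≤ ‖g‖ * (Dq q * ‖x‖) := by gcongr; exact this
      _ = _ := by ring

lemma cat_nil (k : ℕ) (x : TPow H k) : cat k 0 x (nil H 1) = lof H k x := by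
  induction k with
  | zero => simp [← map_smul]
  | succ k ih =>
    refine ext_tens_apply ((cat (k + 1) 0).flip (nil H 1)) (lof H (k + 1)) (fun g y => ?_) x
    simp [ih]

lemma join_nil (w : Fock H) : join 0 (w ⊗ₜ nil H 1) = w := by
  suffices h : join 0 ∘ₗ (TensorProduct.mk ℝ (Fock H) (TPow H 0)).flip (nil H 1) = LinearMap.id from
    LinearMap.congr_fun h w
  refine fock_ext fun k x => ?_
  simp [cat_nil]

/-- Right multiplication by a field: creation and annihilation at the right end. -/
lemma star_one (q : ℝ) (g : H) (k : ℕ) (x : TPow H k) :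
    star q 1 (tens g (nil H 1)) (lof H k x) =
      annRF q g (lof H k x) + cat k 1 x (tens g (nil H 1)) := by
  rw [star_apply, Finset.sum_range_succ, Finset.sum_range_one, V_succ_zero, V_zero_zero, join_nil,
    V_succ_succ, V_zero_zero, V_zero_succ, Nat.sub_self, pow_zero, one_smul, add_zero]
  simp [ins]

lemma exists_cat_one (k : ℕ) (x : TPow H k) (g : H) :
    ∃ v : TPow H (k + 1), cat k 1 x (tens g (nil H 1)) = lof H (k + 1) v ∧ ‖v‖ = ‖x‖ * ‖g‖ := by
  obtain ⟨v, hv, hv'⟩ := norm_join k 1 (k + 1) (x ⊗ₜ tens g (nil H 1)) rfl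
  refine ⟨v, by simpa using hv, ?_⟩
  rw [hv', TensorProduct.norm_tmul]
  congr 1
  rw [tens, (cons H 0).norm_map, TensorProduct.norm_tmul, (nil H).norm_map]
  simp

/-- The constant in the bound of `w ↦ ξ(f) w ξ(g) - ⟨f, g⟩ Γ_q w`. -/
def chaosConst (q : ℝ) : ℝ := 4 * Dq q ^ 2 + 2 * Dq q

/-- The operator `w ↦ ∑ₐ (ξ(eₐ) w ξ(yₐ) - ⟨eₐ, yₐ⟩ Γ_q w)` is bounded by the Hilbert tensor norm of
`∑ₐ eₐ ⊗ yₐ`. It splits into four terms, according to whether each of the two fields creates or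
annihilates: the subtraction removes exactly the contraction of the two fields with each other,
the only term that the Hilbert tensor norm does not control. -/
lemma fockNorm_chaos_le {q : ℝ} (hq : |q| < 1) {M : ℕ} {e : Fin M → H} (he : Orthonormal ℝ e)
    (y : Fin M → H) (k : ℕ) (x : TPow H k) :
    fockNorm q (∑ a, (field q (e a) (star q 1 (tens (y a) (nil H 1)) (lof H k x)) -
        (inner ℝ (e a) (y a) : ℝ) • secQ H q (lof H k x))) ≤
      chaosConst q * ‖∑ a, e a ⊗ₜ[ℝ] y a‖ * fockNorm q (lof H k x) := by
  have hD := one_le_Dq hq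
  have hC := Cq_pow_one_le hq
  set C := Cq q ^ (3 / 2 : ℝ) with hCdef
  set D := Dq q with hDdef
  set S := ‖∑ a, e a ⊗ₜ[ℝ] y a‖ with hS
  have hS2 : ∑ a, ‖y a‖ ^ 2 ≤ S ^ 2 := (norm_sq_sum_tmul he y).ge
  have hS0 : 0 ≤ S := norm_nonneg _
  choose v hv hv' using fun a => exists_cat_one k x (y a)
  -- creation at both ends
  have hA : fockNorm q (∑ a, cre (e a) (cat k 1 x (tens (y a) (nil H 1)))) ≤
      3 * D ^ 2 * S * fockNorm q (lof H k x) := by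
    simp only [hv, cre_lof]
    rw [← map_sum, fockNorm_lof, fockNorm_lof]
    have h1 : ‖∑ a, tens (e a) (v a)‖ ≤ S * ‖x‖ := by
      refine abs_le_of_sq_le_sq' (?_ : _ ≤ _ ^ 2) (by positivity) |>.2
      rw [norm_sq_sum_tens he, mul_pow, mul_comm]
      simp only [hv', mul_pow, ← Finset.mul_sum]
      gcongr
    calc _ ≤ (((k + 2 : ℕ) : ℝ) + 1) * C * D ^ (k + 2) * (S * ‖x‖) := by gcongr
      _ ≤ (3 * ((k : ℝ) + 1)) * C * D ^ (k + 2) * (S * ‖x‖) := by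
          gcongr
          push_cast
          linarith [(Nat.cast_nonneg k : (0 : ℝ) ≤ k)]
      _ = _ := by ring
  -- the contractions with `x`, present only if `x` has at least one letter
  have hB : ∃ B : Fock H, ∑ a, join 1 (annF q (e a) (lof H k x) ⊗ₜ tens (y a) (nil H 1)) = B ∧
      fockNorm q B ≤ D * S * fockNorm q (lof H k x) := by
    refine ⟨_, rfl, ?_⟩
    rcases k with _ | k
    · simp only [annF_lof_zero, TensorProduct.zero_tmul, map_zero, Finset.sum_const_zero]
      have : fockNorm q (0 : Fock H) = 0 := by simp [fockNorm]
      rw [this]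
      have := fockNorm_nonneg hq (lof H 0 x)
      positivity
    · simp only [annF_lof_succ, join_lof]
      choose u hu hu' using fun a => exists_cat_one k (annL q k (e a) x) (y a)
      simp only [hu]
      rw [← map_sum, fockNorm_lof, fockNorm_lof]
      have h1 : ‖∑ a, u a‖ ≤ (D * ‖x‖) * S := by
        refine (norm_sum_le _ _).trans ?_
        simp only [hu']
        exact sum_mul_le _ _ _ (by positivity) hS0 (sum_annL_sq_le' hq k he x) hS2
      calc _ ≤ (((k + 1 : ℕ) : ℝ) + 1) * C * D ^ (k + 1) * ((D * ‖x‖) * S) := by gcongr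
        _ = _ := by ring
  have hCc : fockNorm q (∑ a, cre (e a) (annRF q (y a) (lof H k x))) ≤
      D * S * fockNorm q (lof H k x) := by
    rcases k with _ | k
    · simp only [annRF_lof_zero, map_zero, Finset.sum_const_zero]
      have : fockNorm q (0 : Fock H) = 0 := by simp [fockNorm]
      rw [this]
      have := fockNorm_nonneg hq (lof H 0 x)
      positivity
    · simp only [annRF_lof_succ, cre_lof]
      rw [← map_sum, fockNorm_lof, fockNorm_lof]
      have h1 : ‖∑ a, tens (e a) (annR q k (y a) x)‖ ≤ (D * ‖x‖) * S := by
        refine abs_le_of_sq_le_sq' (?_ : _ ≤ _ ^ 2) (by positivity) |>.2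
        rw [norm_sq_sum_tens he, mul_pow]
        calc _ ≤ ∑ a, (D * ‖x‖) ^ 2 * ‖y a‖ ^ 2 := by
              refine Finset.sum_le_sum fun a _ => ?_
              rw [← mul_pow]
              refine pow_le_pow_left₀ (norm_nonneg _) ((norm_annR_le hq k (y a) x).trans ?_) 2
              exact le_of_eq (by ring)
          _ ≤ _ := by rw [← Finset.mul_sum]; gcongr
      calc _ ≤ (((k + 1 : ℕ) : ℝ) + 1) * C * D ^ (k + 1) * ((D * ‖x‖) * S) := by gcongr
        _ = _ := by ring
  have hE : fockNorm q (∑ a, annF q (e a) (annRF q (y a) (lof H k x))) ≤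
      D ^ 2 * S * fockNorm q (lof H k x) := by
    have h0 : fockNorm q (0 : Fock H) = 0 := by simp [fockNorm]
    rcases k with _ | _ | k
    · simp only [annRF_lof_zero, map_zero, Finset.sum_const_zero, h0]
      have := fockNorm_nonneg hq (lof H 0 x)
      positivity
    · simp only [annRF_lof_succ, annF_lof_zero, Finset.sum_const_zero, h0]
      have := fockNorm_nonneg hq (lof H 1 x)
      positivity
    · simp only [annRF_lof_succ, annF_lof_succ]
      rw [← map_sum, fockNorm_lof, fockNorm_lof]
      have h1 : ‖∑ a, annL q k (e a) (annR q (k + 1) (y a) x)‖ ≤ D * ((D * ‖x‖) * S) := by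
        calc _ ≤ ∑ a, D * (‖annL q (k + 1) (e a) x‖ * ‖y a‖) := by
              refine norm_sum_le_of_le _ fun a _ => ?_
              have := LinearMap.congr_fun (annL_annR q k (e a) (y a)) x
              simp only [LinearMap.comp_apply] at this
              rw [this]
              refine (norm_annR_le hq k _ _).trans (le_of_eq (by ring))
          _ ≤ _ := by
              rw [← Finset.mul_sum]
              gcongr
              exact sum_mul_le _ _ _ (by positivity) hS0 (sum_annL_sq_le' hq (k + 1) he x) hS2
      calc _ ≤ ((k : ℝ) + 1) * C * D ^ k * (D * ((D * ‖x‖) * S)) := by gcongr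
        _ ≤ (((k + 2 : ℕ) : ℝ) + 1) * C * D ^ (k + 2) * (D * ((D * ‖x‖) * S)) := by
            gcongr
            · linarith
            · omega
        _ = _ := by ring
  obtain ⟨B, hB1, hB2⟩ := hB
  have key : ∑ a, (field q (e a) (star q 1 (tens (y a) (nil H 1)) (lof H k x)) -
        (inner ℝ (e a) (y a) : ℝ) • secQ H q (lof H k x)) =
      ((∑ a, cre (e a) (cat k 1 x (tens (y a) (nil H 1))) + B) +
        ∑ a, cre (e a) (annRF q (y a) (lof H k x))) +
          ∑ a, annF q (e a) (annRF q (y a) (lof H k x)) := by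
    rw [← hB1, ← Finset.sum_add_distrib, ← Finset.sum_add_distrib, ← Finset.sum_add_distrib]
    refine Finset.sum_congr rfl fun a _ => ?_
    rw [star_one, field, LinearMap.add_apply, map_add, map_add, cat_annF_succ, annL_zero_tens,
      map_smul, cat_nil, secQ_lof]
    module
  rw [key]
  refine (fockNorm_add_le hq _ _).trans ((add_le_add_left ((fockNorm_add_le hq _ _).trans
    (add_le_add_left (fockNorm_add_le hq _ _) _)) _).trans ?_)
  rw [chaosConst, ← hDdef]
  linarith

end Chaos

/-! ### The two-sided product of two fields as an operator -/

section ChaosAlgebra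

variable (H : Type) [NormedAddCommGroup H] [InnerProductSpace ℝ H] (q : Set.Ioo (-1 : ℝ) 1)

/-- The field `ξ_q(f)` in the completed algebra, as a continuous linear function of `f`. -/
def fieldCLM : H →L[ℝ] MezdonAlgebra H q :=
  (incl H q).comp <| LinearMap.mkContinuous (wick H q 1 ∘ₗ (tensL 0).flip (nil H 1))
    (2 * Cq q ^ (3 / 2 : ℝ) * Dq q) fun f => by
      have h : ‖tens f (nil H 1)‖ = ‖f‖ := by
        rw [tens, (cons H 0).norm_map, TensorProduct.norm_tmul, (nil H).norm_map]
        simp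
      simp only [LinearMap.comp_apply, LinearMap.flip_apply, tensL_apply]
      rw [norm_wick, h]
      norm_num

lemma fieldCLM_apply (f : H) : fieldCLM H q f = incl H q (fieldOp H q f) := by
  rw [← wick_one]; rfl

lemma vacuumEquiv_fieldOp_mul (f : H) (A : FieldAlgebra H q) :
    vacuumEquiv H q (fieldOp H q f * A) = field (q : ℝ) f (vacuumEquiv H q A) := rfl

lemma vacuumEquiv_mul_fieldOp (A : FieldAlgebra H q) (g : H) :
    vacuumEquiv H q (A * fieldOp H q g) =
      star (q : ℝ) 1 (tens g (nil H 1)) (vacuumEquiv H q A) := by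
  change A.1 (field (q : ℝ) g (vac H)) = star (q : ℝ) 1 (tens g (nil H 1)) (A.1 (vac H))
  rw [field_vac, apply_lof (q : ℝ) _ _ A.1 A.2]

lemma vacuumEquiv_gammaAlg (A : FieldAlgebra H q) :
    vacuumEquiv H q (gammaAlg H q A) = secQ H (q : ℝ) (vacuumEquiv H q A) := by
  simp [gammaAlg]

/-- The covariance of the field. -/
lemma vacuumState_field_mul_field (f g : H) :
    vacuumState H q (fieldCLM H q f * fieldCLM H q g) = inner ℝ f g := by
  rw [fieldCLM_apply, fieldCLM_apply, ← incl_mul, vacuumState_incl]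
  have h : vacuumEquiv H q (fieldOp H q f * fieldOp H q g) =
      field (q : ℝ) f (lof H 1 (tens g (nil H 1))) := by
    rw [vacuumEquiv_fieldOp_mul]
    congr 1
    exact field_vac (q : ℝ) g
  simp only [vacuumAlg, LinearMap.mkContinuous_apply, LinearMap.comp_apply, LinearEquiv.coe_coe, h]
  rw [field, LinearMap.add_apply, cre_lof, annF_lof_succ, annL_zero_tens, map_add,
    DirectSum.component.of, DirectSum.component.of, dif_neg (by omega), dif_pos rfl]
  simp

/-- `f ⊗ g ↦ (w ↦ ξ(f) w ξ(g) - ⟨f, g⟩ Γ_q w)`, the part of the two-sided product without a direct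
contraction of the two fields. -/
def chaosProd : H ⊗[ℝ] H →ₗ[ℝ] (MezdonAlgebra H q →L[ℝ] MezdonAlgebra H q) :=
  TensorProduct.lift (LinearMap.mk₂ ℝ
    (fun f g => ContinuousLinearMap.mulLeftRight ℝ (MezdonAlgebra H q) (fieldCLM H q f)
      (fieldCLM H q g) - (inner ℝ f g : ℝ) • gamma H q)
    (by intros; simp only [map_add, add_apply, inner_add_left]; module)
    (by intros; simp only [map_smul, smul_apply, real_inner_smul_left]; module)
    (by intros; simp only [map_add, inner_add_right]; module)
    (by intros; simp only [map_smul, real_inner_smul_right]; module))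

lemma chaosProd_tmul (f g : H) : chaosProd H q (f ⊗ₜ g) =
    ContinuousLinearMap.mulLeftRight ℝ (MezdonAlgebra H q) (fieldCLM H q f)
      (fieldCLM H q g) - (inner ℝ f g : ℝ) • gamma H q := rfl

/-- The two-sided product without direct contraction is bounded in the Hilbert tensor norm. -/
lemma norm_chaosProd_le (z : H ⊗[ℝ] H) : ‖chaosProd H q z‖ ≤ chaosConst q * ‖z‖ := by
  have hD := one_le_Dq (abs_param q)
  have hc : 0 ≤ chaosConst q := by unfold chaosConst; positivity
  obtain ⟨M, e, y, he, rfl⟩ := exists_orthonormal z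
  refine ContinuousLinearMap.opNorm_le_bound _ (by positivity) fun w => ?_
  refine (denseRange_incl H q).induction_on w (isClosed_le (by fun_prop) (by fun_prop)) fun A => ?_
  have h1 : chaosProd H q (∑ a, e a ⊗ₜ[ℝ] y a) (incl H q A) =
      incl H q (∑ a, (fieldOp H q (e a) * (A * fieldOp H q (y a)) -
        (inner ℝ (e a) (y a) : ℝ) • gammaAlg H q A)) := by
    rw [map_sum, sum_apply, map_sum]
    refine Finset.sum_congr rfl fun a _ => ?_
    rw [chaosProd_tmul, sub_apply, smul_apply, gamma_incl, ContinuousLinearMap.mulLeftRight_apply,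
      fieldCLM_apply, fieldCLM_apply, ← incl_mul, ← incl_mul, mul_assoc, map_sub, map_smul]
  rw [h1, norm_incl, norm_incl, norm_fieldAlgebra, norm_fieldAlgebra, map_sum]
  simp only [map_sub, vacuumEquiv_fieldOp_mul, vacuumEquiv_mul_fieldOp, map_smul,
    vacuumEquiv_gammaAlg]
  set x := vacuumEquiv H q A
  obtain ⟨s, hs, hs'⟩ := fockNorm_eq_sum (q : ℝ) x
  rw [hs', Finset.mul_sum]
  conv_lhs => rw [hs]
  simp only [map_sum, Finset.smul_sum, ← Finset.sum_sub_distrib]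
  rw [Finset.sum_comm]
  exact (fockNorm_sum_le (abs_param q) _ _).trans
    (Finset.sum_le_sum fun k _ => fockNorm_chaos_le (abs_param q) he y k _)

lemma integral_smul_gamma (f : ℝ → ℝ) :
    (∫ t, f t) • gamma H q = ∫ t, f t • gamma H q := (integral_smul_const f (gamma H q)).symm

/-- The Hilbert tensor square of `H`. -/
abbrev HTensor : Type := UniformSpace.Completion (H ⊗[ℝ] H)

/-- The elementary tensors, as a continuous bilinear map into the Hilbert tensor square. -/
def htmul : H →L[ℝ] H →L[ℝ] HTensor H :=
  LinearMap.mkContinuous₂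
    ((TensorProduct.mk ℝ H H).compr₂
      (UniformSpace.Completion.toComplL (𝕜 := ℝ) (E := H ⊗[ℝ] H)).toLinearMap) 1 fun f g => by
    simp [TensorProduct.norm_tmul]

variable {H}

lemma htmul_apply (f g : H) : htmul H f g = ((f ⊗ₜ[ℝ] g : H ⊗[ℝ] H) : HTensor H) := rfl

lemma inner_htmul (f g f' g' : H) :
    inner ℝ (htmul H f g) (htmul H f' g') = (inner ℝ f f' * inner ℝ g g' : ℝ) := by
  rw [htmul_apply, htmul_apply, UniformSpace.Completion.inner_coe, TensorProduct.inner_tmul]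

variable (H) in
/-- The extension of `chaosProd` to the Hilbert tensor square. -/
def chaosProdCLM : HTensor H →L[ℝ] (MezdonAlgebra H q →L[ℝ] MezdonAlgebra H q) :=
  (LinearMap.mkContinuous (chaosProd H q) (chaosConst q) (norm_chaosProd_le H q)).extend
    (UniformSpace.Completion.toComplL (𝕜 := ℝ) (E := H ⊗[ℝ] H))

lemma mulLeftRight_field (f g : H) :
    ContinuousLinearMap.mulLeftRight ℝ (MezdonAlgebra H q) (fieldCLM H q f) (fieldCLM H q g) =
      chaosProdCLM H q (htmul H f g) + (inner ℝ f g : ℝ) • gamma H q := by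
  have h : chaosProdCLM H q (htmul H f g) = chaosProd H q (f ⊗ₜ g) :=
    (LinearMap.mkContinuous (chaosProd H q) (chaosConst q) (norm_chaosProd_le H q)).extend_eq
      UniformSpace.Completion.denseRange_coe (UniformSpace.Completion.isUniformInducing_coe _) _
  rw [h, chaosProd_tmul, sub_add_cancel]

end ChaosAlgebra

open scoped Convolution ContDiff

/-! ### Mollifying kernels -/

section Kernels

/-- `κ` is an even `C¹` probability density that vanishes outside the ball of radius `a`. -/
structure IsKernel (κ : ℝ → ℝ) (a : ℝ) : Prop where
  smooth : ContDiff ℝ 1 κ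
  nonneg : ∀ x, 0 ≤ κ x
  even : ∀ x, κ (-x) = κ x
  integral : ∫ x, κ x = 1
  support : Function.support κ ⊆ Metric.ball 0 a

lemma IsKernel.hasCompactSupport {κ : ℝ → ℝ} {a : ℝ} (h : IsKernel κ a) : HasCompactSupport κ :=
  HasCompactSupport.intro (isCompact_closedBall (0 : ℝ) a) fun x hx => by
    by_contra h0
    exact hx (Metric.ball_subset_closedBall (h.support h0))

lemma IsKernel.mono {κ : ℝ → ℝ} {a b : ℝ} (h : IsKernel κ a) (hab : a ≤ b) : IsKernel κ b :=
  { h with support := h.support.trans (Metric.ball_subset_ball hab) }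

lemma IsKernel.integrable {κ : ℝ → ℝ} {a : ℝ} (h : IsKernel κ a) : Integrable κ :=
  h.smooth.continuous.integrable_of_hasCompactSupport h.hasCompactSupport

lemma IsKernel.convolution {κ κ' : ℝ → ℝ} {a a' : ℝ} (h : IsKernel κ a) (h' : IsKernel κ' a') :
    IsKernel (κ ⋆[ContinuousLinearMap.lsmul ℝ ℝ, volume] κ') (a + a') where
  smooth := h.hasCompactSupport.contDiff_convolution_left _ h.smooth
    h'.smooth.continuous.locallyIntegrable
  nonneg x := integral_nonneg fun u => mul_nonneg (h.nonneg _) (h'.nonneg _)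
  even x := by
    rw [convolution_def, convolution_def, ← integral_neg_eq_self]
    refine integral_congr_ae (.of_forall fun u => ?_)
    simp only [ContinuousLinearMap.lsmul_apply, h.even]
    rw [← h'.even (-x - -u)]
    ring_nf
  integral := by
    rw [integral_convolution _ h.integrable h'.integrable, h.integral, h'.integral]
    simp
  support := by
    refine (support_convolution_subset _).trans ((Set.add_subset_add h.support h'.support).trans ?_)
    rintro _ ⟨x, hx, y, hy, rfl⟩
    rw [mem_ball_zero_iff] at *
    exact (norm_add_le x y).trans_lt (add_lt_add hx hy)

/-- Averaging against a kernel of radius `a` moves a function by at most its oscillation at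
distance `a`. -/
lemma IsKernel.norm_convolution_sub_le {κ : ℝ → ℝ} {a : ℝ} (h : IsKernel κ a) {E : Type*}
    [NormedAddCommGroup E] [NormedSpace ℝ E] [CompleteSpace E] {g : ℝ → E} (hg : Continuous g)
    (t : ℝ) (v : E) {η : ℝ} (hη : 0 ≤ η) (hv : ∀ u, |u - t| < a → ‖g u - v‖ ≤ η) :
    ‖(κ ⋆[ContinuousLinearMap.lsmul ℝ ℝ, volume] g) t - v‖ ≤ η := by
  rw [← dist_eq_norm]
  refine dist_convolution_le hη h.support h.nonneg h.integral hg.aestronglyMeasurable fun u hu => ?_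
  rw [dist_eq_norm]
  exact hv u (by simpa [Real.dist_eq] using hu)

/-- Convergence of kernels to the delta function: their radii tend to zero. -/
def kernels : Filter (ℝ → ℝ) := ⨅ a ∈ Set.Ioi (0 : ℝ), 𝓟 {κ | IsKernel κ a}

lemma hasBasis_kernels : kernels.HasBasis (fun a : ℝ => 0 < a) fun a => {κ | IsKernel κ a} := by
  refine hasBasis_biInf_principal ?_ ⟨1, Set.mem_Ioi.2 one_pos⟩
  intro a ha b hb
  exact ⟨min a b, Set.mem_Ioi.2 (lt_min ha hb), fun κ hκ => hκ.mono (min_le_left _ _),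
    fun κ hκ => hκ.mono (min_le_right _ _)⟩

lemma eventually_isKernel {a : ℝ} (ha : 0 < a) : ∀ᶠ κ in kernels, IsKernel κ a :=
  hasBasis_kernels.mem_of_mem ha

/-- The rescaled function `ε⁻¹ ρ(· / ε)`. -/
def rescale (ρ : ℝ → ℝ) (ε : ℝ) : ℝ → ℝ := fun u => ε⁻¹ * ρ (u / ε)

lemma IsMollifier.exists_isKernel {ρ : ℝ → ℝ} (hρ : IsMollifier ρ) :
    ∃ M, 0 < M ∧ ∀ ε, 0 < ε → IsKernel (rescale ρ ε) (M * ε) := by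
  obtain ⟨M, hM0, hM⟩ := hρ.compact.isCompact.isBounded.subset_ball_lt 0 (0 : ℝ)
  refine ⟨M, hM0, fun ε hε => ⟨?_, fun x => ?_, fun x => ?_, ?_, fun x hx => ?_⟩⟩
  · exact contDiff_const.mul ((hρ.smooth.of_le (by norm_cast)).comp
      (contDiff_id.div_const ε))
  · exact mul_nonneg (inv_nonneg.2 hε.le) (hρ.nonneg _)
  · simp only [rescale, neg_div, hρ.even]
  · simp only [rescale]
    rw [integral_const_mul, Measure.integral_comp_div, hρ.integral, abs_of_pos hε]
    simp [hε.ne']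
  · have h1 : ρ (x / ε) ≠ 0 := fun h0 => hx (by simp [rescale, h0])
    have h2 := hM (subset_tsupport _ h1)
    rw [mem_ball_zero_iff, norm_div, Real.norm_eq_abs ε, abs_of_pos hε, div_lt_iff₀ hε] at h2
    rwa [mem_ball_zero_iff]

lemma IsMollifier.tendsto_rescale {ρ : ℝ → ℝ} (hρ : IsMollifier ρ) :
    Tendsto (rescale ρ) (𝓝[>] 0) kernels := by
  obtain ⟨M, hM, h⟩ := hρ.exists_isKernel
  refine hasBasis_kernels.tendsto_right_iff.2 fun a ha => ?_
  have h1 : ∀ᶠ ε in 𝓝[>] (0 : ℝ), ε < a / M :=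
    eventually_nhdsWithin_of_eventually_nhds (eventually_lt_nhds (by positivity))
  filter_upwards [h1, self_mem_nhdsWithin] with ε h2 h3
  exact (h ε h3).mono (by rw [lt_div_iff₀ hM] at h2; linarith)

lemma exists_isMollifier : ∃ ρ : ℝ → ℝ, IsMollifier ρ := by
  let f : ContDiffBump (0 : ℝ) := default
  refine ⟨f.normed volume, f.contDiff_normed, f.hasCompactSupport_normed, fun x => f.nonneg_normed x,
    fun x => f.normed_neg x, f.integral_normed⟩

instance : NeBot kernels := by
  obtain ⟨ρ, hρ⟩ := exists_isMollifier
  exact hρ.tendsto_rescale.neBot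

end Kernels

/-! ### The Brownian curve in `L²(ℝ)` -/

section Path

/-- `L²(ℝ)`. -/
abbrev L2R : Type := Lp ℝ 2 (volume : Measure ℝ)

/-- The class in `L²(ℝ)` of `sgn(t - s) 1_{[s,t]}`. -/
def bmInc (s t : ℝ) : L2R :=
  toL2 ((Set.Ioc s t).indicator 1) - toL2 ((Set.Ioc t s).indicator 1)

/-- The curve in `L²(ℝ)` underlying Brownian motion. -/
def bm (t : ℝ) : L2R := bmInc 0 t

lemma toL2_of_memLp {f : ℝ → ℝ} (h : MemLp f 2 volume) : toL2 f = h.toLp f := by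
  rw [toL2, dif_pos h]

lemma toL2_indicator (s t : ℝ) : toL2 ((Set.Ioc s t).indicator 1) =
    indicatorConstLp 2 (measurableSet_Ioc (a := s) (b := t)) measure_Ioc_lt_top.ne (1 : ℝ) := by
  have h : MemLp ((Set.Ioc s t).indicator (1 : ℝ → ℝ)) 2 volume :=
    memLp_indicator_const 2 measurableSet_Ioc (1 : ℝ) (Or.inr measure_Ioc_lt_top.ne)
  rw [toL2_of_memLp h]
  rfl

lemma locallyIntegrable_L2 (g : L2R) : LocallyIntegrable g volume :=
  (Lp.memLp g).locallyIntegrable (by norm_num)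

lemma intervalIntegrable_L2 (g : L2R) (s t : ℝ) : IntervalIntegrable g volume s t :=
  intervalIntegrable_iff.mpr <|
    ((locallyIntegrable_L2 g).integrableOn_isCompact isCompact_uIcc).mono_set Set.uIoc_subset_uIcc

lemma inner_bmInc (s t : ℝ) (g : L2R) : inner ℝ (bmInc s t) g = ∫ u in s..t, g u := by
  rw [bmInc, inner_sub_left, toL2_indicator, toL2_indicator, L2.inner_indicatorConstLp_one,
    L2.inner_indicatorConstLp_one, intervalIntegral]

lemma bmInc_eq (s t : ℝ) : bmInc s t = bm t - bm s := by
  refine ext_inner_right ℝ fun g => ?_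
  rw [bm, bm, inner_sub_left, inner_bmInc, inner_bmInc, inner_bmInc,
    intervalIntegral.integral_interval_sub_left (intervalIntegrable_L2 g _ _)
      (intervalIntegrable_L2 g _ _)]

lemma norm_bm_sub_sq (s t : ℝ) : ‖bm t - bm s‖ ^ 2 = |t - s| := by
  wlog hst : s ≤ t generalizing s t
  · rw [norm_sub_rev, abs_sub_comm]
    exact this t s (le_of_not_ge hst)
  have h0 : toL2 ((Set.Ioc t s).indicator 1) = 0 := by
    rw [toL2_indicator]
    simp [Set.Ioc_eq_empty (not_lt.2 hst)]
  rw [← bmInc_eq, bmInc, h0, sub_zero, toL2_indicator, norm_indicatorConstLp (by norm_num)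
    (by norm_num), norm_one, one_mul, ← Real.rpow_natCast, ← Real.rpow_mul (by positivity)]
  simp [Measure.real, hst, abs_of_nonneg (sub_nonneg.2 hst)]

lemma norm_bm_sub (s t : ℝ) : ‖bm t - bm s‖ = √|t - s| := by
  rw [← norm_bm_sub_sq, Real.sqrt_sq (norm_nonneg _)]

lemma continuous_bm : Continuous bm := by
  refine continuous_iff_continuousAt.2 fun s => ?_
  rw [ContinuousAt, tendsto_iff_norm_sub_tendsto_zero]
  simp only [norm_bm_sub]
  exact Continuous.tendsto' (by fun_prop) _ _ (by simp)

/-- In the sense of distributions, the white noise `φ ↦ toL2 φ` is the derivative of `bm`. -/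
lemma toL2_eq_neg_integral {φ : ℝ → ℝ} (hφ : ContDiff ℝ 1 φ) (hc : HasCompactSupport φ) :
    toL2 φ = -∫ t, deriv φ t • bm t := by
  have hφ' : Continuous (deriv φ) := hφ.continuous_deriv le_rfl
  have hi : Integrable fun t => deriv φ t • bm t :=
    (hφ'.smul continuous_bm).integrable_of_hasCompactSupport hc.deriv.smul_right
  refine ext_inner_left ℝ fun g => ?_
  have hm : MemLp φ 2 volume := hφ.continuous.memLp_of_hasCompactSupport hc
  rw [inner_neg_right, ← integral_inner hi, toL2_of_memLp hm, L2.inner_def]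
  have e1 : ∀ t, inner ℝ g (deriv φ t • bm t) = deriv φ t * ∫ u in (0 : ℝ)..t, g u := by
    intro t
    rw [real_inner_smul_right, real_inner_comm, bm, inner_bmInc]
  simp only [e1]
  have e2 : ∫ t, inner ℝ (g t) (hm.toLp φ t) = ∫ t, φ t * g t := by
    refine integral_congr_ae ?_
    filter_upwards [hm.coeFn_toLp] with t ht
    rw [ht]; rfl
  rw [e2]
  obtain ⟨L, hL0, hL⟩ := hc.isCompact.isBounded.subset_ball_lt 0 (0 : ℝ)
  have hz : ∀ t, t ∉ Set.Ioc (-L) L → φ t = 0 ∧ deriv φ t = 0 := by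
    intro t ht
    have : t ∉ tsupport φ := fun h => ht (by
      have := hL h
      rw [mem_ball_zero_iff, Real.norm_eq_abs, abs_lt] at this
      exact ⟨this.1, this.2.le⟩)
    exact ⟨image_eq_zero_of_notMem_tsupport this,
      image_eq_zero_of_notMem_tsupport fun h => this (tsupport_deriv_subset h)⟩
  have hzL : φ (-L) = 0 := (hz _ (by simp)).1
  have hzR : φ L = 0 := by
    refine image_eq_zero_of_notMem_tsupport fun h => ?_
    simpa [abs_of_pos hL0] using hL h
  have e3 : ∀ f : ℝ → ℝ, (∀ t, t ∉ Set.Ioc (-L) L → f t = 0) → ∫ t, f t = ∫ t in (-L)..L, f t := by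
    intro f hf
    rw [intervalIntegral.integral_of_le (by linarith), setIntegral_eq_integral_of_forall_compl_eq_zero hf]
  rw [e3 _ fun t ht => by rw [(hz t ht).1, zero_mul], e3 _ fun t ht => by rw [(hz t ht).2, zero_mul]]
  have hG := (intervalIntegrable_L2 g (-L) L).absolutelyContinuousOnInterval_intervalIntegral
    (c := 0) (by rw [Set.uIcc_of_le (by linarith)]; exact ⟨by linarith, hL0.le⟩)
  have hF : AbsolutelyContinuousOnInterval φ (-L) L := by
    have h := (hφ'.intervalIntegrable (μ := volume) (-L) L).absolutelyContinuousOnInterval_intervalIntegral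
      (c := -L) (by simp)
    have e : φ = fun x => ∫ v in (-L)..x, deriv φ v := by
      funext x
      rw [intervalIntegral.integral_deriv_eq_sub (fun y _ => hφ.differentiable one_ne_zero y)
        (hφ'.intervalIntegrable _ _), hzL, sub_zero]
    rwa [e]
  have key := hF.integral_mul_deriv_eq_deriv_mul hG
  rw [hzL, hzR, zero_mul, zero_mul, sub_zero, zero_sub] at key
  rw [← key]
  refine intervalIntegral.integral_congr_ae ?_
  filter_upwards [LocallyIntegrable.ae_hasDerivAt_integral (locallyIntegrable_L2 g)] with t ht _
  rw [(ht 0).deriv]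

/-- The mollified noise as a curve in `L²(ℝ)`. -/
def molNoise (κ : ℝ → ℝ) (t : ℝ) : L2R := toL2 fun u => κ (u - t)

/-- The mollified Brownian curve. It differs from the integral of `molNoise κ` by a constant. -/
def molPath (κ : ℝ → ℝ) : ℝ → L2R := κ ⋆[ContinuousLinearMap.lsmul ℝ ℝ, volume] bm

variable {κ κ' : ℝ → ℝ} {a a' : ℝ}

lemma IsKernel.molNoise_eq (h : IsKernel κ a) :
    molNoise κ = deriv κ ⋆[ContinuousLinearMap.lsmul ℝ ℝ, volume] bm := by
  funext t
  have e : (fun u => κ (u - t)) = fun u => κ (t - u) := by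
    funext u; rw [← h.even, neg_sub]
  have hc : HasCompactSupport fun u => κ (t - u) :=
    h.hasCompactSupport.comp_homeomorph (Homeomorph.subLeft t)
  have hd : ∀ u, deriv (fun u => κ (t - u)) u = -deriv κ (t - u) := fun u => deriv_comp_const_sub ..
  have hs : ContDiff ℝ 1 fun u => κ (t - u) := h.smooth.comp (contDiff_const.sub contDiff_id)
  rw [molNoise, e, toL2_eq_neg_integral hs hc, convolution_eq_swap]
  simp only [hd, neg_smul, integral_neg, neg_neg, ContinuousLinearMap.lsmul_apply]

lemma IsKernel.hasDerivAt_molPath (h : IsKernel κ a) (t : ℝ) :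
    HasDerivAt (molPath κ) (molNoise κ t) t := by
  rw [h.molNoise_eq]
  exact h.hasCompactSupport.hasDerivAt_convolution_left _ h.smooth
    continuous_bm.locallyIntegrable t

lemma IsKernel.continuous_molNoise (h : IsKernel κ a) : Continuous (molNoise κ) := by
  rw [h.molNoise_eq]
  exact h.hasCompactSupport.deriv.continuous_convolution_left _ (h.smooth.continuous_deriv le_rfl)
    continuous_bm.locallyIntegrable

lemma IsKernel.continuous_molPath (h : IsKernel κ a) : Continuous (molPath κ) :=
  continuous_iff_continuousAt.2 fun t => (h.hasDerivAt_molPath t).continuousAt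

lemma IsKernel.norm_molPath_sub_le (h : IsKernel κ a) (t : ℝ) : ‖molPath κ t - bm t‖ ≤ √a := by
  refine h.norm_convolution_sub_le continuous_bm t _ (Real.sqrt_nonneg _) fun u hu => ?_
  rw [norm_bm_sub]
  exact Real.sqrt_le_sqrt hu.le

lemma IsKernel.memLp (h : IsKernel κ a) (t : ℝ) : MemLp (fun u => κ (u - t)) 2 volume :=
  (h.smooth.continuous.comp (continuous_sub_right t)).memLp_of_hasCompactSupport
    (h.hasCompactSupport.comp_homeomorph (Homeomorph.subRight t))

lemma IsKernel.inner_molNoise (h : IsKernel κ a) (h' : IsKernel κ' a') (t t' : ℝ) :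
    inner ℝ (molNoise κ t) (molNoise κ' t') =
      (κ ⋆[ContinuousLinearMap.lsmul ℝ ℝ, volume] κ') (t - t') := by
  have e : inner ℝ (molNoise κ t) (molNoise κ' t') = ∫ u, κ (u - t) * κ' (u - t') := by
    rw [molNoise, molNoise, toL2_of_memLp (h.memLp t), toL2_of_memLp (h'.memLp t'), L2.inner_def]
    refine integral_congr_ae ?_
    filter_upwards [(h.memLp t).coeFn_toLp, (h'.memLp t').coeFn_toLp] with u hu hu'
    rw [hu, hu', RCLike.inner_apply, conj_trivial, mul_comm]
  rw [e, convolution_def, ← integral_sub_left_eq_self _ _ t]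
  refine integral_congr_ae (.of_forall fun u => ?_)
  simp only [ContinuousLinearMap.lsmul_apply, smul_eq_mul]
  rw [← h.even u]
  congr 2 <;> ring

/-- The covariance of the mollified noise at `0` with the Brownian path. -/
lemma IsKernel.inner_molNoise_bm (h : IsKernel κ a) (t : ℝ) :
    inner ℝ (bm t) (molNoise κ 0) = ∫ u in (0 : ℝ)..t, κ u := by
  rw [bm, inner_bmInc, molNoise, toL2_of_memLp (h.memLp 0)]
  refine intervalIntegral.integral_congr_ae ?_
  filter_upwards [(h.memLp 0).coeFn_toLp] with u hu _
  rw [hu, sub_zero]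

lemma IsKernel.integral_eq_half (h : IsKernel κ a) {t : ℝ} (ht : a ≤ t) :
    ∫ u in (0 : ℝ)..t, κ u = 1 / 2 := by
  have hi : ∀ s t, IntervalIntegrable κ volume s t := fun s t =>
    h.smooth.continuous.intervalIntegrable s t
  have ha : 0 < a := by
    by_contra ha
    have h0 : κ = 0 := by
      have := h.support
      rw [Metric.ball_eq_empty.2 (not_lt.1 ha), Set.subset_empty_iff, Function.support_eq_empty_iff] at this
      exact this
    have := h.integral
    simp [h0] at this
  have h1 : ∫ u in (-t)..0, κ u = ∫ u in (0 : ℝ)..t, κ u := by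
    have := intervalIntegral.integral_comp_neg (a := 0) (b := t) κ
    simp only [h.even, neg_zero] at this
    exact this.symm
  have h2 : ∫ u in (-t)..t, κ u = 1 := by
    rw [intervalIntegral.integral_of_le (by linarith), setIntegral_eq_integral_of_forall_compl_eq_zero,
      h.integral]
    intro u hu
    by_contra h0
    have := h.support h0
    rw [mem_ball_zero_iff, Real.norm_eq_abs, abs_lt] at this
    exact hu ⟨by linarith, by linarith⟩
  have h3 := intervalIntegral.integral_add_adjacent_intervals (hi (-t) 0) (hi 0 t)
  linarith

/-- The covariance of the noise at `0` with the past and future of the mollified path: half of the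
mass of the noise correlation lies to the right of `0`. -/
lemma IsKernel.inner_molPath_molNoise (h : IsKernel κ a) {T : ℝ} (hT : 2 * a ≤ T) :
    inner ℝ (molPath κ T - molPath κ 0) (molNoise κ 0) = (1 / 2 : ℝ) := by
  have hc : Continuous fun t => inner ℝ (bm t) (molNoise κ 0) := continuous_bm.inner continuous_const
  have e : ∀ t, inner ℝ (molPath κ t) (molNoise κ 0) =
      ∫ u, κ u * inner ℝ (bm (t - u)) (molNoise κ 0) := by
    intro t
    have hi : Integrable fun u => κ u • bm (t - u) :=
      (h.smooth.continuous.smul (continuous_bm.comp (continuous_const.sub continuous_id)))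
        |>.integrable_of_hasCompactSupport h.hasCompactSupport.smul_right
    rw [real_inner_comm, molPath, convolution_def]
    simp only [ContinuousLinearMap.lsmul_apply]
    rw [← integral_inner hi]
    refine integral_congr_ae (.of_forall fun u => ?_)
    simp only [real_inner_smul_right]
    rw [real_inner_comm]
  have h1 : inner ℝ (molPath κ T) (molNoise κ 0) = (1 / 2 : ℝ) := by
    rw [e]
    have : ∀ u, κ u * inner ℝ (bm (T - u)) (molNoise κ 0) = κ u * (1 / 2) := by
      intro u
      by_cases h0 : κ u = 0
      · simp [h0]
      · have := h.support h0
        rw [mem_ball_zero_iff, Real.norm_eq_abs, abs_lt] at this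
        rw [h.inner_molNoise_bm, h.integral_eq_half (by linarith)]
    simp only [this]
    rw [integral_mul_const, h.integral, one_mul]
  have h2 : inner ℝ (molPath κ 0) (molNoise κ 0) = (0 : ℝ) := by
    rw [e]
    have odd : ∀ u, inner ℝ (bm (-u)) (molNoise κ 0) = -inner ℝ (bm u) (molNoise κ 0) := by
      intro u
      rw [h.inner_molNoise_bm, h.inner_molNoise_bm]
      have := intervalIntegral.integral_comp_neg (a := 0) (b := u) κ
      simp only [h.even, neg_zero] at this
      rw [this, intervalIntegral.integral_symm]
    have h3 := integral_neg_eq_self (fun u => κ u * inner ℝ (bm (0 - u)) (molNoise κ 0)) volume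
    have h4 : ∀ u, κ (-u) * inner ℝ (bm (0 - -u)) (molNoise κ 0) =
        -(κ u * inner ℝ (bm (0 - u)) (molNoise κ 0)) := by
      intro u
      rw [h.even, zero_sub, zero_sub, odd (-u)]
      ring
    simp only [h4, integral_neg] at h3
    linarith
  rw [inner_sub_left, h1, h2, sub_zero]

end Path

/-! ### The product of path and noise in the Hilbert tensor square -/

section Hilbert

variable {H : Type} [NormedAddCommGroup H] [InnerProductSpace ℝ H] [CompleteSpace H]

/-- A family in a Hilbert space converges as soon as the inner products of its members with one
another converge. -/
lemma exists_tendsto_of_tendsto_inner {ι V : Type*} [NormedAddCommGroup V] [InnerProductSpace ℝ V]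
    [CompleteSpace V] {l : Filter ι} [NeBot l] {z : ι → V} {c : ℝ}
    (h : Tendsto (fun p : ι × ι => (inner ℝ (z p.1) (z p.2) : ℝ)) (l ×ˢ l) (𝓝 c)) :
    ∃ v, Tendsto z l (𝓝 v) := by
  refine cauchy_map_iff_exists_tendsto.1 (cauchy_map_iff'.2 ?_)
  rw [tendsto_uniformity_iff_dist_tendsto_zero]
  have hd : Tendsto (fun κ => (inner ℝ (z κ) (z κ) : ℝ)) l (𝓝 c) :=
    h.comp (tendsto_id.prodMk tendsto_id)
  have h2 : Tendsto (fun p : ι × ι => ‖z p.1 - z p.2‖ ^ 2) (l ×ˢ l) (𝓝 0) := by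
    have := ((hd.comp tendsto_fst).sub (h.const_mul 2)).add (hd.comp (tendsto_snd (f := l) (g := l)))
    refine (this.congr fun p => ?_).trans (by ring_nf; rfl)
    rw [norm_sub_sq_real]
    simp only [Function.comp_apply, real_inner_self_eq_norm_sq]
  have h3 := h2.sqrt
  simp only [Real.sqrt_sq (norm_nonneg _), Real.sqrt_zero] at h3
  simpa only [dist_eq_norm] using h3

lemma continuous_htmul {H : Type} [NormedAddCommGroup H]
    [InnerProductSpace ℝ H] {r y : ℝ → H} (hy : Continuous y) (hr : Continuous r) :
    Continuous fun t => htmul H (y t) (r t) :=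
  ((htmul H).continuous.comp hy).clm_apply hr

/-- If the correlations of the curves `r` and `r'` form a kernel of radius `a`, then the inner product
of `∫ y ⊗ r` and `∫ y' ⊗ r'` is close to `∫ ‖x‖²` for `y` and `y'` close to `x` at distance `a`. -/
lemma IsKernel.abs_inner_integral_htmul_sub_le {K : ℝ → ℝ} {a : ℝ} (hK : IsKernel K a)
    {r r' y y' x : ℝ → H} (hr : Continuous r) (hr' : Continuous r') (hy : Continuous y)
    (hy' : Continuous y') (hx : Continuous x)
    (hrr : ∀ t t', (inner ℝ (r t) (r' t') : ℝ) = K (t - t')) {L : ℝ} (hL : 0 ≤ L)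
    (hy0 : ∀ t, t ∉ Set.Ioc (-L) L → y t = 0) (hy0' : ∀ t, t ∉ Set.Ioc (-L) L → y' t = 0)
    (hx0 : ∀ t, t ∉ Set.Ioc (-L) L → x t = 0) {B η : ℝ} (hη : 0 ≤ η)
    (hxB : ∀ t, ‖x t‖ ≤ B) (hyB : ∀ t, ‖y t‖ ≤ B) (h1 : ∀ t, ‖y t - x t‖ ≤ η)
    (h2 : ∀ t t', |t' - t| < a → ‖y' t' - x t‖ ≤ η) :
    |(inner ℝ (∫ t, htmul H (y t) (r t)) (∫ t, htmul H (y' t) (r' t)) : ℝ) - ∫ t, ‖x t‖ ^ 2| ≤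
      2 * L * (2 * B * η) := by
  have hcs : ∀ {E : Type} [NormedAddCommGroup E] (f : ℝ → E), (∀ t, t ∉ Set.Ioc (-L) L → f t = 0) →
      HasCompactSupport f := fun f hf =>
    HasCompactSupport.intro isCompact_Icc fun t ht => hf t fun h => ht (Set.Ioc_subset_Icc_self h)
  have hi : Integrable fun t => htmul H (y t) (r t) :=
    (continuous_htmul hy hr).integrable_of_hasCompactSupport
      (hcs _ fun t ht => by rw [hy0 t ht]; simp)
  have hi' : Integrable fun t => htmul H (y' t) (r' t) :=
    (continuous_htmul hy' hr').integrable_of_hasCompactSupport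
      (hcs _ fun t ht => by rw [hy0' t ht]; simp)
  set w := K ⋆[ContinuousLinearMap.lsmul ℝ ℝ, volume] y' with hw
  have hwc : Continuous w :=
    hK.hasCompactSupport.continuous_convolution_left _ hK.smooth.continuous hy'.locallyIntegrable
  have e1 : (inner ℝ (∫ t, htmul H (y t) (r t)) (∫ t, htmul H (y' t) (r' t)) : ℝ) =
      ∫ t, (inner ℝ (y t) (w t) : ℝ) := by
    rw [real_inner_comm, ← integral_inner hi]
    refine integral_congr_ae (.of_forall fun t => ?_)
    simp only
    rw [real_inner_comm, ← integral_inner hi', hw, convolution_eq_swap]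
    have hk : Integrable fun u => K (t - u) • y' u :=
      Continuous.integrable_of_hasCompactSupport
        ((hK.smooth.continuous.comp (continuous_const.sub continuous_id)).smul hy')
        (hcs _ fun t ht => by simp [hy0' t ht])
    simp only [ContinuousLinearMap.lsmul_apply]
    rw [← integral_inner hk]
    refine integral_congr_ae (.of_forall fun u => ?_)
    simp only [inner_htmul, hrr, real_inner_smul_right]
    ring
  have hwx : ∀ t, ‖w t - x t‖ ≤ η := fun t =>
    hK.norm_convolution_sub_le hy' t (x t) hη fun u hu => h2 t u hu
  have hB : 0 ≤ B := (norm_nonneg _).trans (hxB 0)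
  have i1 : Integrable fun t => (inner ℝ (y t) (w t) : ℝ) :=
    (hy.inner hwc).integrable_of_hasCompactSupport (hcs _ fun t ht => by rw [hy0 t ht]; simp)
  have i2 : Integrable fun t => ‖x t‖ ^ 2 :=
    (hx.norm.pow 2).integrable_of_hasCompactSupport (hcs _ fun t ht => by simp [hx0 t ht])
  rw [e1, ← integral_sub i1 i2, ← setIntegral_eq_integral_of_forall_compl_eq_zero
    (s := Set.Ioc (-L) L) fun t ht => by rw [hy0 t ht, hx0 t ht]; simp]
  have hb := norm_setIntegral_le_of_norm_le_const (μ := volume) (s := Set.Ioc (-L) L)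
    (f := fun t => (inner ℝ (y t) (w t) : ℝ) - ‖x t‖ ^ 2) (C := 2 * B * η)
    measure_Ioc_lt_top fun t _ => by
      have e : (inner ℝ (y t) (w t) : ℝ) - ‖x t‖ ^ 2 =
          inner ℝ (y t) (w t - x t) + inner ℝ (y t - x t) (x t) := by
        rw [inner_sub_right, inner_sub_left, real_inner_self_eq_norm_sq]; ring
      rw [e]
      calc _ ≤ ‖y t‖ * ‖w t - x t‖ + ‖y t - x t‖ * ‖x t‖ :=
            (norm_add_le _ _).trans (add_le_add (norm_inner_le_norm _ _) (norm_inner_le_norm _ _))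
        _ ≤ B * η + η * B := by
            gcongr
            exacts [hyB t, hwx t, h1 t, hxB t]
        _ = _ := by ring
  refine hb.trans (le_of_eq ?_)
  rw [Real.volume_real_Ioc_of_le (by linarith)]
  ring

/-- The two-parameter integral `∫ φ(t) B(s, t) ⊗ ξ(t) dt` in the Hilbert tensor square exists as a limit
of its mollifications, since its kernel `φ(t) 1_{[s,t]}(u)` is square integrable. -/
lemma exists_tendsto_integral_htmul (J J' : L2R →ₗᵢ[ℝ] H) (s : ℝ) {φ : ℝ → ℝ}
    (hφ : Continuous φ) (hc : HasCompactSupport φ) :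
    ∃ z, Tendsto (fun κ => ∫ t, φ t • htmul H (J (molPath κ t - molPath κ s)) (J' (molNoise κ t)))
      kernels (𝓝 z) := by
  refine exists_tendsto_of_tendsto_inner (c := ∫ t, ‖φ t • J (bm t - bm s)‖ ^ 2) ?_
  obtain ⟨L, hL0, hL⟩ := hc.isCompact.isBounded.subset_ball_lt 0 (0 : ℝ)
  have hz : ∀ t, t ∉ Set.Ioc (-L) L → φ t = 0 := fun t ht =>
    image_eq_zero_of_notMem_tsupport fun h => ht (by
      have := hL h
      rw [mem_ball_zero_iff, Real.norm_eq_abs, abs_lt] at this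
      exact ⟨this.1, this.2.le⟩)
  obtain ⟨Φ, hΦ⟩ := hc.exists_bound_of_continuous hφ
  have hΦ0 : 0 ≤ Φ := (norm_nonneg _).trans (hΦ 0)
  set x : ℝ → H := fun t => φ t • J (bm t - bm s) with hxdef
  have hx : Continuous x := hφ.smul (J.continuous.comp (continuous_bm.sub continuous_const))
  have hxc : HasCompactSupport x := hc.smul_right
  obtain ⟨B, hB⟩ := hxc.exists_bound_of_continuous hx
  have hB0 : 0 ≤ B := (norm_nonneg _).trans (hB 0)
  set y : (ℝ → ℝ) → ℝ → H := fun κ t => φ t • J (molPath κ t - molPath κ s) with hydef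
  have hyx : ∀ {κ a}, IsKernel κ a → ∀ t, ‖y κ t - x t‖ ≤ Φ * (2 * √a) := by
    intro κ a h t
    rw [hydef, hxdef]
    simp only
    rw [← smul_sub, ← map_sub, norm_smul, J.norm_map]
    refine mul_le_mul (hΦ t) ?_ (norm_nonneg _) hΦ0
    calc ‖molPath κ t - molPath κ s - (bm t - bm s)‖
        = ‖(molPath κ t - bm t) - (molPath κ s - bm s)‖ := by congr 1; abel
      _ ≤ √a + √a := (norm_sub_le _ _).trans
          (add_le_add (h.norm_molPath_sub_le t) (h.norm_molPath_sub_le s))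
      _ = _ := by ring
  have hyc : ∀ {κ a}, IsKernel κ a → Continuous (y κ) := fun h =>
    hφ.smul (J.continuous.comp (h.continuous_molPath.sub continuous_const))
  rw [Metric.tendsto_nhds]
  intro θ hθ
  -- the tolerance `η` makes the error `2 L * (2 (B + 1) η)` smaller than `θ`
  obtain ⟨η, hη0, hη1, hηθ⟩ : ∃ η : ℝ, 0 < η ∧ η ≤ 1 ∧ 2 * L * (2 * (B + 1) * η) < θ := by
    refine ⟨min 1 (θ / (2 * (4 * L * (B + 1)))), by positivity, min_le_left _ _, ?_⟩
    calc 2 * L * (2 * (B + 1) * min 1 (θ / (2 * (4 * L * (B + 1)))))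
        ≤ 2 * L * (2 * (B + 1) * (θ / (2 * (4 * L * (B + 1))))) := by
          gcongr; exact min_le_right _ _
      _ = θ / 2 := by field_simp; norm_num
      _ < θ := by linarith
  obtain ⟨δ, hδ, hδx⟩ := Metric.uniformContinuous_iff.1
    (hx.uniformContinuous_of_tendsto_cocompact hxc.is_zero_at_infty) (η / 2) (by positivity)
  have ha : ∀ᶠ a in 𝓝[>] (0 : ℝ), Φ * (2 * √a) < η / 2 ∧ a < δ / 2 := by
    refine eventually_nhdsWithin_of_eventually_nhds ((Tendsto.eventually_lt_const (v := 0)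
      (by positivity) (Continuous.tendsto' (by fun_prop) _ _ (by simp))).and
        (eventually_lt_nhds (by positivity)))
  obtain ⟨a, ⟨ha1, ha2⟩, ha0⟩ := (ha.and self_mem_nhdsWithin).exists
  have hev := eventually_isKernel (a := a) ha0
  filter_upwards [hev.prod_mk hev] with ⟨κ, κ'⟩ ⟨h, h'⟩
  rw [Real.dist_eq]
  refine lt_of_le_of_lt ?_ hηθ
  have hs : ∀ κ t, φ t • htmul H (J (molPath κ t - molPath κ s)) (J' (molNoise κ t)) =
      htmul H (y κ t) (J' (molNoise κ t)) := fun κ t => by simp [hydef]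
  simp only [hs]
  have hx1 : ∀ t t', |t' - t| < a + a → ‖x t' - x t‖ ≤ η / 2 := fun t t' htt => by
    rw [← dist_eq_norm]
    exact (hδx (by rw [Real.dist_eq]; linarith)).le
  refine (h.convolution h').abs_inner_integral_htmul_sub_le
    (J'.continuous.comp h.continuous_molNoise) (J'.continuous.comp h'.continuous_molNoise)
    (hyc h) (hyc h') hx (fun t t' => ?_) hL0.le (fun t ht => ?_) (fun t ht => ?_) (fun t ht => ?_)
    hη0.le (fun t => (hB t).trans (by linarith)) (fun t => ?_) (fun t => ?_) fun t t' htt => ?_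
  · simp only [Function.comp_apply, J'.inner_map_map]
    exact h.inner_molNoise h' t t'
  · simp [hydef, hz t ht]
  · simp [hydef, hz t ht]
  · simp [hxdef, hz t ht]
  · calc ‖y κ t‖ ≤ ‖x t‖ + ‖y κ t - x t‖ := norm_le_norm_add_norm_sub' _ _
      _ ≤ B + 1 := add_le_add (hB t) ((hyx h t).trans (by linarith))
  · exact (hyx h t).trans (by linarith)
  · calc ‖y κ' t' - x t‖ ≤ ‖y κ' t' - x t'‖ + ‖x t' - x t‖ := norm_sub_le_norm_sub_add_norm_sub _ _ _
      _ ≤ η / 2 + η / 2 := add_le_add ((hyx h' t').trans ha1.le) (hx1 t t' htt)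
      _ = η := by ring

end Hilbert

/-! ### Limits and integration by parts under the integral -/

section Limits

variable {E : Type*} [NormedAddCommGroup E] [NormedSpace ℝ E]

lemma integrable_smul_of_continuousOn {ψ : ℝ → ℝ} (hψ : Continuous ψ) (hc : HasCompactSupport ψ)
    {f : ℝ → E} (hf : ContinuousOn f (tsupport ψ)) : Integrable fun t => ψ t • f t := by
  have h1 : IntegrableOn (fun t => ψ t • f t) (tsupport ψ) :=
    (hψ.continuousOn.smul hf).integrableOn_compact hc
  refine (integrableOn_iff_integrable_of_support_subset fun t ht => subset_tsupport ψ ?_).1 h1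
  intro h0
  exact ht (by simp [h0])

lemma tendsto_integral_smul {ι : Type*} {l : Filter ι} {ψ : ℝ → ℝ} (hψ : Continuous ψ)
    (hc : HasCompactSupport ψ) {f : ι → ℝ → E} {g : ℝ → E}
    (hf : ∀ᶠ i in l, ContinuousOn (f i) (tsupport ψ)) (hg : ContinuousOn g (tsupport ψ))
    (h : TendstoUniformlyOn f g l (tsupport ψ)) :
    Tendsto (fun i => ∫ t, ψ t • f i t) l (𝓝 (∫ t, ψ t • g t)) := by
  rw [Metric.tendsto_nhds]
  intro θ hθ
  set I := ∫ t, ‖ψ t‖ with hI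
  have hI0 : 0 ≤ I := integral_nonneg fun t => norm_nonneg _
  have hiψ : Integrable fun t => ‖ψ t‖ := (hψ.integrable_of_hasCompactSupport hc).norm
  rw [Metric.tendstoUniformlyOn_iff] at h
  filter_upwards [hf, h (θ / (I + 1)) (by positivity)] with i hi hu
  rw [dist_eq_norm, ← integral_sub (integrable_smul_of_continuousOn hψ hc hi)
    (integrable_smul_of_continuousOn hψ hc hg)]
  calc _ ≤ ∫ t, ‖ψ t‖ * (θ / (I + 1)) := by
        refine norm_integral_le_of_norm_le (hiψ.mul_const _) (.of_forall fun t => ?_)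
        rw [← smul_sub, norm_smul]
        by_cases ht : t ∈ tsupport ψ
        · gcongr
          rw [← dist_eq_norm, dist_comm]
          exact (hu t ht).le
        · simp [image_eq_zero_of_notMem_tsupport ht]
    _ = I * (θ / (I + 1)) := by rw [integral_mul_const]
    _ < θ := by
        rw [mul_div_assoc', div_lt_iff₀ (by positivity)]
        nlinarith

lemma TendstoUniformlyOn.continuousAt_comp {ι T X Y : Type*} [TopologicalSpace T] [UniformSpace X]
    [UniformSpace Y] {l : Filter ι} {K : Set T} (hK : IsCompact K) {f : ι → T → X} {g : T → X}
    (h : TendstoUniformlyOn f g l K) (hg : ContinuousOn g K) {F : X → Y}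
    (hF : ∀ t ∈ K, ContinuousAt F (g t)) :
    TendstoUniformlyOn (fun i t => F (f i t)) (fun t => F (g t)) l K := by
  intro u hu
  have h1 := (hK.image_of_continuousOn hg).uniformContinuousAt_of_continuousAt F
    (by rintro _ ⟨t, ht, rfl⟩; exact hF t ht) hu
  filter_upwards [h _ h1] with i hi t ht
  exact hi t ht ⟨t, ht, rfl⟩

/-- Integration by parts against a compactly supported function. -/
lemma integral_smul_eq_neg_integral_deriv_smul [CompleteSpace E] {φ : ℝ → ℝ} (hφ : ContDiff ℝ 1 φ)
    (hc : HasCompactSupport φ) {f f' : ℝ → E} (hf : ∀ t ∈ tsupport φ, HasDerivAt f (f' t) t)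
    (hf' : ContinuousOn f' (tsupport φ)) :
    ∫ t, φ t • f' t = -∫ t, deriv φ t • f t := by
  have hφ' : Continuous (deriv φ) := hφ.continuous_deriv le_rfl
  have hfc : ContinuousOn f (tsupport φ) := fun t ht => (hf t ht).continuousAt.continuousWithinAt
  have i1 := integrable_smul_of_continuousOn hφ.continuous hc hf'
  have i2 : Integrable fun t => deriv φ t • f t :=
    integrable_smul_of_continuousOn hφ' hc.deriv (hfc.mono (tsupport_deriv_subset))
  have i3 := integrable_smul_of_continuousOn hφ.continuous hc hfc
  exact integral_bilinear_hasDerivAt_right_eq_neg_left_of_integrable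
    (L := ContinuousLinearMap.lsmul ℝ ℝ) (fun t _ => (hφ.differentiable one_ne_zero t).hasDerivAt)
    hf i1 i2 i3

lemma integral_deriv_eq_zero {φ : ℝ → ℝ} (hφ : ContDiff ℝ 1 φ) (hc : HasCompactSupport φ) :
    ∫ t, deriv φ t = 0 :=
  integral_eq_zero_of_hasDerivAt_of_integrable
    (fun t => (hφ.differentiable one_ne_zero t).hasDerivAt)
    ((hφ.continuous_deriv le_rfl).integrable_of_hasCompactSupport hc.deriv)
    (hφ.continuous.integrable_of_hasCompactSupport hc)

/-- Integration of a two-sided product of fields: the direct contraction is a multiple of `Γ_q`. -/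
lemma integral_smul_mulLeftRight_field (H : Type) [NormedAddCommGroup H] [InnerProductSpace ℝ H]
    (q : Set.Ioo (-1 : ℝ) 1) {φ : ℝ → ℝ} (hφ : Continuous φ)
    (hc : HasCompactSupport φ) {X r : ℝ → H} (hX : Continuous X) (hr : Continuous r) :
    ∫ t, φ t • ContinuousLinearMap.mulLeftRight ℝ (MezdonAlgebra H q) (fieldCLM H q (X t))
        (fieldCLM H q (r t)) =
      chaosProdCLM H q (∫ t, φ t • htmul H (X t) (r t)) +
        (∫ t, φ t • (inner ℝ (X t) (r t) : ℝ)) • gamma H q := by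
  have i1 : Integrable fun t => φ t • htmul H (X t) (r t) :=
    integrable_smul_of_continuousOn hφ hc (continuous_htmul hX hr).continuousOn
  have i2 : Integrable fun t => φ t • (inner ℝ (X t) (r t) : ℝ) :=
    integrable_smul_of_continuousOn hφ hc (hX.inner hr).continuousOn
  rw [← ContinuousLinearMap.integral_comp_comm _ i1, integral_smul_gamma,
    ← integral_add ((chaosProdCLM H q).integrable_comp i1) (i2.smul_const _)]
  refine integral_congr_ae (.of_forall fun t => ?_)
  simp only [mulLeftRight_field, map_smul, smul_add, smul_smul, smul_eq_mul]

lemma continuous_mulLeftRight {E : Type} [NormedRing E] [NormedAlgebra ℝ E] {X : Type*}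
    [TopologicalSpace X] {f g : X → E} (hf : Continuous f) (hg : Continuous g) :
    Continuous fun t => ContinuousLinearMap.mulLeftRight ℝ E (f t) (g t) :=
  ((ContinuousLinearMap.mulLeftRight ℝ E).continuous.comp hf).clm_apply hg

end Limits

/-! ### Noises, their products and the Itô constants -/

section Single

variable {n : ℕ} {V : Type} [NormedAddCommGroup V] [InnerProductSpace ℝ V]

/-- The isometric embedding of the `i`-th component. -/
def singleL (i : Fin n) : V →ₗᵢ[ℝ] PiLp 2 fun _ : Fin n => V where
  toFun f := PiLp.single 2 i f
  map_add' f g := PiLp.single_add 2 i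
  map_smul' c f := by
    simp only [← PiLp.toLp_single, Pi.single_smul, WithLp.toLp_smul, RingHom.id_apply]
  norm_map' f := PiLp.norm_single 2 (fun _ => V) i f

lemma singleL_apply (i : Fin n) (f : V) : singleL i f = PiLp.single 2 i f := rfl

lemma inner_singleL (i j : Fin n) (f g : V) :
    inner ℝ (singleL i f) (singleL j g) = (if i = j then inner ℝ f g else 0 : ℝ) := by
  rw [PiLp.inner_apply, singleL_apply, singleL_apply, Finset.sum_eq_single i
    (fun k _ hk => by rw [PiLp.single_eq_of_ne 2 hk, inner_zero_left]) (by simp), PiLp.single_eq_same]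
  split_ifs with h
  · subst h; rw [PiLp.single_eq_same]
  · rw [PiLp.single_eq_of_ne 2 h, inner_zero_right]

end Single

section NoiseAlgebra

variable (q : Set.Ioo (-1 : ℝ) 1) {n : ℕ}

/-- The noise `ξ_q^i(f)` as a continuous linear function of `f`. -/
def noiseL (i : Fin n) : L2R →L[ℝ] Alg q n :=
  (fieldCLM (NoiseSpace n) q).comp (singleL i).toContinuousLinearMap

lemma noiseL_apply (i : Fin n) (f : L2R) : noiseL q i f = noise q i f :=
  fieldCLM_apply (NoiseSpace n) q _

lemma vacuumState_noiseL (i j : Fin n) (f g : L2R) :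
    vacuumState (NoiseSpace n) q (noiseL q i f * noiseL q j g) = if i = j then inner ℝ f g else 0 := by
  rw [← inner_singleL]
  exact vacuumState_field_mul_field (NoiseSpace n) q _ _

lemma increment_eq (i : Fin n) (s t : ℝ) : increment q i s t = noiseL q i (bm t - bm s) := by
  rw [← bmInc_eq, noiseL_apply]; rfl

lemma brownian_eq (t : ℝ) (i : Fin n) : brownian q t i = noiseL q i (bm t) :=
  (noiseL_apply q i _).symm

lemma noiseM_eq (ρ : ℝ → ℝ) (ε : ℝ) (i : Fin n) (t : ℝ) :
    noiseM q ρ ε i t = noiseL q i (molNoise (rescale ρ ε) t) :=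
  (noiseL_apply q i _).symm

lemma IsKernel.hasDerivAt_noiseL {κ : ℝ → ℝ} {a : ℝ} (h : IsKernel κ a) (i : Fin n) (s t : ℝ) :
    HasDerivAt (fun t => noiseL q i (molPath κ t - molPath κ s)) (noiseL q i (molNoise κ t)) t :=
  (noiseL q i).hasFDerivAt.comp_hasDerivAt t ((h.hasDerivAt_molPath t).sub_const _)

lemma incrementM_eq {ρ : ℝ → ℝ} {ε a : ℝ} (h : IsKernel (rescale ρ ε) a) (i : Fin n) (s t : ℝ) :
    incrementM q ρ ε i s t = noiseL q i (molPath (rescale ρ ε) t - molPath (rescale ρ ε) s) := by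
  rw [incrementM]
  simp only [noiseM_eq]
  rw [intervalIntegral.integral_eq_sub_of_hasDerivAt (fun u _ => h.hasDerivAt_noiseL q i s u)
    (((noiseL q i).continuous.comp h.continuous_molNoise).intervalIntegrable _ _)]
  simp

/-- The vacuum expectations that determine the Itô lift. -/
lemma tendsto_vacuumState {ρ : ℝ → ℝ} (hρ : IsMollifier ρ) {ε : ℝ} (hε : 0 < ε) (i j : Fin n) :
    Tendsto (fun T : ℝ => vacuumState (NoiseSpace n) q
      (incrementM q ρ ε i 0 T * noiseM q ρ ε j 0)) atTop (𝓝 (if i = j then 1 / 2 else 0)) ∧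
    Tendsto (fun T : ℝ => vacuumState (NoiseSpace n) q
      (noiseM q ρ ε i 0 * incrementM q ρ ε j 0 T)) atTop (𝓝 (if i = j then 1 / 2 else 0)) := by
  obtain ⟨M, hM, hk⟩ := hρ.exists_isKernel
  have h := hk ε hε
  constructor <;> refine tendsto_const_nhds.congr' ?_ <;>
    filter_upwards [eventually_ge_atTop (2 * (M * ε))] with T hT <;>
    rw [incrementM_eq q h, noiseM_eq, vacuumState_noiseL]
  · rw [h.inner_molPath_molNoise hT]
  · rw [real_inner_comm, h.inner_molPath_molNoise hT]

/-- The mollified product of an integrated noise and a noise, without renormalisation. -/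
def modelL (κ : ℝ → ℝ) (i j : Fin n) (s : ℝ) (φ : ℝ → ℝ) : Alg q n →L[ℝ] Alg q n :=
  ∫ t, φ t • ContinuousLinearMap.mulLeftRight ℝ (Alg q n)
    (noiseL q i (molPath κ t - molPath κ s)) (noiseL q j (molNoise κ t))

/-- The mollified product of a noise and an integrated noise, without renormalisation. -/
def modelR (κ : ℝ → ℝ) (i j : Fin n) (s : ℝ) (φ : ℝ → ℝ) : Alg q n →L[ℝ] Alg q n :=
  ∫ t, φ t • ContinuousLinearMap.mulLeftRight ℝ (Alg q n)
    (noiseL q i (molNoise κ t)) (noiseL q j (molPath κ t - molPath κ s))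

/-- The product `∫ φ'(t) B^i(s, t) (·) B^j(s, t) dt` of two increments. -/
def incrementProd (i j : Fin n) (s : ℝ) (φ : ℝ → ℝ) : Alg q n →L[ℝ] Alg q n :=
  ∫ t, deriv φ t • ContinuousLinearMap.mulLeftRight ℝ (Alg q n)
    (noiseL q i (bm t - bm s)) (noiseL q j (bm t - bm s))

/-- Mollified paths converge uniformly to the Brownian path. -/
lemma tendstoUniformly_molPath : TendstoUniformly molPath bm kernels := by
  rw [Metric.tendstoUniformly_iff]
  intro θ hθ
  filter_upwards [eventually_isKernel (a := (θ / 2) ^ 2) (by positivity)] with κ h t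
  rw [dist_comm, dist_eq_norm]
  refine (h.norm_molPath_sub_le t).trans_lt ?_
  rw [Real.sqrt_sq (by positivity)]
  linarith

lemma tendstoUniformly_molPath_sub (s : ℝ) :
    TendstoUniformly (fun κ t => molPath κ t - molPath κ s) (fun t => bm t - bm s) kernels := by
  rw [Metric.tendstoUniformly_iff]
  intro θ hθ
  filter_upwards [Metric.tendstoUniformly_iff.1 tendstoUniformly_molPath (θ / 2) (by positivity)]
    with κ h t
  calc _ ≤ dist (bm t) (molPath κ t) + dist (bm s) (molPath κ s) := dist_sub_sub_le _ _ _ _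
    _ < θ := by linarith [h t, h s]

variable {φ : ℝ → ℝ}

lemma continuous_noiseL_bm (i : Fin n) (s : ℝ) : Continuous fun t => noiseL q i (bm t - bm s) :=
  (noiseL q i).continuous.comp (continuous_bm.sub continuous_const)

lemma IsKernel.continuous_noiseL_molPath {κ : ℝ → ℝ} {a : ℝ} (h : IsKernel κ a) (i : Fin n) (s : ℝ) :
    Continuous fun t => noiseL q i (molPath κ t - molPath κ s) :=
  (noiseL q i).continuous.comp (h.continuous_molPath.sub continuous_const)

lemma IsKernel.continuous_noiseL_molNoise {κ : ℝ → ℝ} {a : ℝ} (h : IsKernel κ a) (i : Fin n) :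
    Continuous fun t => noiseL q i (molNoise κ t) :=
  (noiseL q i).continuous.comp h.continuous_molNoise

/-- The direct contraction: since `⟨B(s,t), ξ(t)⟩` is half the derivative of `‖B(s,t)‖²`, it
converges. -/
lemma exists_tendsto_integral_inner (s : ℝ) (hφ : ContDiff ℝ 1 φ) (hc : HasCompactSupport φ) :
    ∃ c : ℝ, Tendsto (fun κ => ∫ t, φ t • (inner ℝ (molPath κ t - molPath κ s) (molNoise κ t) : ℝ))
      kernels (𝓝 c) := by
  have hφ' : Continuous (deriv φ) := hφ.continuous_deriv le_rfl
  have h1 : Tendsto (fun κ => ∫ t, deriv φ t • (2⁻¹ * ‖molPath κ t - molPath κ s‖ ^ 2)) kernels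
      (𝓝 (∫ t, deriv φ t • (2⁻¹ * ‖bm t - bm s‖ ^ 2))) := by
    refine tendsto_integral_smul hφ' hc.deriv ?_
      (continuous_const.mul ((continuous_bm.sub continuous_const).norm.pow 2)).continuousOn ?_
    · filter_upwards [eventually_isKernel one_pos] with κ h
      exact (continuous_const.mul ((h.continuous_molPath.sub continuous_const).norm.pow 2)).continuousOn
    · have hcont : Continuous fun v : L2R => 2⁻¹ * ‖v‖ ^ 2 := by fun_prop
      exact TendstoUniformlyOn.continuousAt_comp hc.deriv
        (tendstoUniformly_molPath_sub s).tendstoUniformlyOn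
        (continuous_bm.sub continuous_const).continuousOn fun t _ => hcont.continuousAt
  refine ⟨_, (h1.neg).congr' ?_⟩
  filter_upwards [eventually_isKernel one_pos] with κ h
  refine (integral_smul_eq_neg_integral_deriv_smul hφ hc (fun t _ => ?_) ?_).symm
  · have hd := (h.hasDerivAt_molPath t).sub_const (molPath κ s)
    have := (hd.norm_sq).const_mul (2⁻¹ : ℝ)
    refine this.congr_deriv ?_
    ring
  · exact ((h.continuous_molPath.sub continuous_const).inner h.continuous_molNoise).continuousOn

lemma exists_tendsto_modelL (i j : Fin n) (s : ℝ) (hφ : ContDiff ℝ 1 φ) (hc : HasCompactSupport φ) :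
    ∃ T, Tendsto (fun κ => modelL q κ i j s φ) kernels (𝓝 T) := by
  obtain ⟨z, hz⟩ := exists_tendsto_integral_htmul (singleL i : L2R →ₗᵢ[ℝ] NoiseSpace n) (singleL j) s
    hφ.continuous hc
  obtain ⟨c, hc'⟩ := exists_tendsto_integral_inner s hφ hc
  have h1 := ((chaosProdCLM (NoiseSpace n) q).continuous.tendsto z).comp hz
  have h2 := (hc'.const_mul (if i = j then 1 else 0)).smul_const (gamma (NoiseSpace n) q)
  refine ⟨_, (h1.add h2).congr' ?_⟩
  filter_upwards [eventually_isKernel one_pos] with κ h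
  have hX : Continuous fun t => (singleL i (molPath κ t - molPath κ s) : NoiseSpace n) :=
    (singleL i).continuous.comp (h.continuous_molPath.sub continuous_const)
  have hr : Continuous fun t => (singleL j (molNoise κ t) : NoiseSpace n) :=
    (singleL j).continuous.comp h.continuous_molNoise
  have key := integral_smul_mulLeftRight_field (NoiseSpace n) q hφ.continuous hc hX hr
  refine Eq.trans ?_ key.symm
  simp only [inner_singleL, Function.comp_apply]
  congr 2
  split_ifs <;> simp

lemma IsKernel.modelL_add_modelR {κ : ℝ → ℝ} {a : ℝ} (h : IsKernel κ a) (i j : Fin n) (s : ℝ)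
    (hφ : ContDiff ℝ 1 φ) (hc : HasCompactSupport φ) :
    modelL q κ i j s φ + modelR q κ i j s φ =
      -∫ t, deriv φ t • ContinuousLinearMap.mulLeftRight ℝ (Alg q n)
        (noiseL q i (molPath κ t - molPath κ s)) (noiseL q j (molPath κ t - molPath κ s)) := by
  have c1 := h.continuous_noiseL_molPath q i s
  have c2 := h.continuous_noiseL_molPath q j s
  have c3 := h.continuous_noiseL_molNoise q i
  have c4 := h.continuous_noiseL_molNoise q j
  have l1 := continuous_mulLeftRight c1 c4
  have l2 := continuous_mulLeftRight c3 c2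
  rw [modelL, modelR, ← integral_add
    (integrable_smul_of_continuousOn hφ.continuous hc l1.continuousOn)
    (integrable_smul_of_continuousOn hφ.continuous hc l2.continuousOn)]
  simp only [← smul_add]
  refine integral_smul_eq_neg_integral_deriv_smul hφ hc (fun t _ => ?_) (l1.add l2).continuousOn
  exact (ContinuousLinearMap.mulLeftRight ℝ (Alg q n)).hasDerivAt_of_bilinear
    (fun _ => h.hasDerivAt_noiseL q i s t) (fun _ => h.hasDerivAt_noiseL q j s t)

lemma tendsto_incrementProd (i j : Fin n) (s : ℝ) (hφ : ContDiff ℝ 1 φ) (hc : HasCompactSupport φ) :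
    Tendsto (fun κ => ∫ t, deriv φ t • ContinuousLinearMap.mulLeftRight ℝ (Alg q n)
        (noiseL q i (molPath κ t - molPath κ s)) (noiseL q j (molPath κ t - molPath κ s)))
      kernels (𝓝 (incrementProd q i j s φ)) := by
  refine tendsto_integral_smul (hφ.continuous_deriv le_rfl) hc.deriv ?_
    (continuous_mulLeftRight (continuous_noiseL_bm q i s) (continuous_noiseL_bm q j s)).continuousOn ?_
  · filter_upwards [eventually_isKernel one_pos] with κ h
    exact (continuous_mulLeftRight (h.continuous_noiseL_molPath q i s)
      (h.continuous_noiseL_molPath q j s)).continuousOn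
  · have hcont : Continuous fun v : L2R => ContinuousLinearMap.mulLeftRight ℝ (Alg q n)
        (noiseL q i v) (noiseL q j v) :=
      continuous_mulLeftRight (noiseL q i).continuous (noiseL q j).continuous
    exact TendstoUniformlyOn.continuousAt_comp hc.deriv
      (tendstoUniformly_molPath_sub s).tendstoUniformlyOn
      (continuous_bm.sub continuous_const).continuousOn fun t _ => hcont.continuousAt

end NoiseAlgebra

/-! ### Existence and uniqueness of the lift -/

section LiftExistence

variable (q : Set.Ioo (-1 : ℝ) 1) {n : ℕ}

lemma testFunction_contDiff {Ω : Opens ℝ} (φ : 𝓓(Ω, ℝ)) : ContDiff ℝ 1 φ :=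
  φ.contDiff.of_le (by norm_cast)

lemma liftML_eq {ρ : ℝ → ℝ} {ε a : ℝ} (h : IsKernel (rescale ρ ε) a) (c : ℝ) (i j : Fin n) (s : ℝ)
    (φ : 𝓓((⊤ : Opens ℝ), ℝ)) : liftML q ρ ε c i j s φ =
      modelL q (rescale ρ ε) i j s φ - (c * ∫ t, φ t) • deltaQ q n := by
  simp only [liftML, modelL, incrementM_eq q h, noiseM_eq]

lemma liftMR_eq {ρ : ℝ → ℝ} {ε a : ℝ} (h : IsKernel (rescale ρ ε) a) (c : ℝ) (i j : Fin n) (s : ℝ)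
    (φ : 𝓓((⊤ : Opens ℝ), ℝ)) : liftMR q ρ ε c i j s φ =
      modelR q (rescale ρ ε) i j s φ - (c * ∫ t, φ t) • deltaQ q n := by
  simp only [liftMR, modelR, incrementM_eq q h, noiseM_eq]

lemma IsMollifier.eventually_isKernel {ρ : ℝ → ℝ} (hρ : IsMollifier ρ) :
    ∀ᶠ ε in 𝓝[>] (0 : ℝ), IsKernel (rescale ρ ε) 1 :=
  hρ.tendsto_rescale.eventually (Mezdon.eventually_isKernel one_pos)

/-- The renormalised mollified models converge together with the products of mollified noises, and
the two limits add up to a product of two increments. -/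
lemma exists_isLift (C : Fin n → Fin n → ℝ) : ∃ Z : Lift q n, IsLift q C Z ∧ ∀ i j s φ,
    Z.L i j s φ + Z.R i j s φ =
      -incrementProd q i j s φ - ((C i j + C j i) * ∫ t, φ t) • deltaQ q n := by
  choose T hT using fun (i j : Fin n) s (φ : 𝓓((⊤ : Opens ℝ), ℝ)) =>
    exists_tendsto_modelL q i j s (testFunction_contDiff φ) φ.hasCompactSupport
  have hR : ∀ (i j : Fin n) s (φ : 𝓓((⊤ : Opens ℝ), ℝ)), Tendsto (fun κ => modelR q κ i j s φ) kernels
      (𝓝 (-incrementProd q i j s φ - T i j s φ)) := by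
    intro i j s φ
    refine ((tendsto_incrementProd q i j s (testFunction_contDiff φ)
      φ.hasCompactSupport).neg.sub (hT i j s φ)).congr' ?_
    filter_upwards [eventually_isKernel one_pos] with κ h
    rw [← h.modelL_add_modelR q i j s (testFunction_contDiff φ) φ.hasCompactSupport, add_sub_cancel_left]
  refine ⟨⟨fun i j s φ => T i j s φ - (C i j * ∫ t, φ t) • deltaQ q n,
    fun i j s φ => -incrementProd q i j s φ - T i j s φ - (C j i * ∫ t, φ t) • deltaQ q n⟩,
    fun ρ hρ l r hlr i j s φ => ⟨?_, ?_⟩, fun i j s φ => ?_⟩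
  · refine (((hT i j s φ).comp hρ.tendsto_rescale).sub
      (((hlr i j).1.mul_const _).smul_const (deltaQ q n))).congr' ?_
    filter_upwards [hρ.eventually_isKernel] with ε h
    exact (liftML_eq q h _ i j s φ).symm
  · refine (((hR i j s φ).comp hρ.tendsto_rescale).sub
      (((hlr i j).2.mul_const _).smul_const (deltaQ q n))).congr' ?_
    filter_upwards [hρ.eventually_isKernel] with ε h
    exact (liftMR_eq q h _ i j s φ).symm
  · simp only
    module

lemma IsLift.unique {C : Fin n → Fin n → ℝ} {Z Z' : Lift q n} (h : IsLift q C Z)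
    (h' : IsLift q C Z') : Z = Z' := by
  obtain ⟨ρ, hρ⟩ := exists_isMollifier
  have hc : CountertermsTo C (fun _ => C) (fun _ i j => C j i) := fun i j =>
    ⟨tendsto_const_nhds, tendsto_const_nhds⟩
  obtain ⟨L, R⟩ := Z
  obtain ⟨L', R'⟩ := Z'
  congr 1 <;> funext i j s φ
  · exact tendsto_nhds_unique (h ρ hρ _ _ hc i j s φ).1 (h' ρ hρ _ _ hc i j s φ).1
  · exact tendsto_nhds_unique (h ρ hρ _ _ hc i j s φ).2 (h' ρ hρ _ _ hc i j s φ).2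

/-- The symmetric part of a lift is determined by the paths: only the constants depend on the lift. -/
lemma IsLift.L_add_R {C : Fin n → Fin n → ℝ} {Z : Lift q n} (h : IsLift q C Z) (i j : Fin n) (s : ℝ)
    (φ : 𝓓((⊤ : Opens ℝ), ℝ)) : Z.L i j s φ + Z.R i j s φ =
      -incrementProd q i j s φ - ((C i j + C j i) * ∫ t, φ t) • deltaQ q n := by
  obtain ⟨Z', h', hZ'⟩ := exists_isLift q C
  rw [h.unique q h']
  exact hZ' i j s φ

end LiftExistence

/-! ### Analytic functions along curves -/

section AnalyticLocal

variable {E : Type} [NormedRing E] [NormedAlgebra ℝ E] [CompleteSpace E] {n : ℕ}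
  {A : Coeffs E n} {R : ENNReal}

/-- On a compact subset of the ball of convergence, the estimates for analytic functions hold. -/
lemma AnalyticOnBall.exists_dominated (hA : AnalyticOnBall A R) {S : Set (Fin n → E)}
    (hS : IsCompact S) (hne : S.Nonempty) (h : ∀ X ∈ S, ∀ i, ‖X i‖ₑ < R) :
    ∃ w ρ θ, Dominated A w ρ θ ∧ ∀ X ∈ S, ∀ i, ‖X i‖ < ρ := by
  obtain ⟨w, hw⟩ := hA.exists_majorizes
  obtain ⟨X₀, hX₀, hmax⟩ := hS.exists_isMaxOn hne (continuous_norm.continuousOn)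
  have hmax' : ∀ X ∈ S, ∀ i, ‖X i‖ ≤ ‖X₀‖ := fun X hX i => (norm_le_pi_norm X i).trans (hmax hX)
  obtain ⟨R', hR', hlt⟩ : ∃ R' : ENNReal, Majorizes A w R' ∧ ‖X₀‖ₑ < R' := by
    rcases n with _ | n
    · exact ⟨⊤, hw.top_of_isEmpty rfl, enorm_lt_top⟩
    · refine ⟨R, hw, ?_⟩
      obtain ⟨i, -, hi⟩ := Finset.exists_mem_eq_sup (Finset.univ : Finset (Fin (n + 1)))
        Finset.univ_nonempty fun i => ‖X₀ i‖₊
      have : ‖X₀‖₊ = ‖X₀ i‖₊ := by rw [Pi.nnnorm_def, hi]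
      have h2 := h X₀ hX₀ i
      rw [enorm_eq_nnnorm] at h2 ⊢
      rwa [this]
  obtain ⟨ρ, hρ, hρ'⟩ := ENNReal.lt_iff_exists_nnreal_btwn.1 hlt
  rw [enorm_eq_nnnorm, ENNReal.coe_lt_coe] at hρ
  obtain ⟨θ, hθ⟩ := hR'.dominated (lt_of_le_of_lt zero_le hρ) hρ'
  exact ⟨w, ρ, θ, hθ, fun X hX i => (hmax' X hX i).trans_lt (by exact_mod_cast hρ)⟩

lemma continuousAt_of_lipschitz {F : Type*} [NormedAddCommGroup F] {f : (Fin n → E) → F} {ρ : ℝ}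
    (h : ∃ c : ℝ, 0 ≤ c ∧ ∀ X Y : Fin n → E, (∀ i, ‖X i‖ ≤ ρ) → (∀ i, ‖Y i‖ ≤ ρ) → ∀ δ, 0 ≤ δ →
      (∀ i, ‖X i - Y i‖ ≤ δ) → ‖f X‖ ≤ c ∧ ‖f X - f Y‖ ≤ c * δ) {X : Fin n → E}
    (hX : ∀ i, ‖X i‖ < ρ) : ContinuousAt f X := by
  obtain ⟨c, hc, hf⟩ := h
  rw [ContinuousAt, tendsto_iff_norm_sub_tendsto_zero]
  have hev : ∀ᶠ Y in 𝓝 X, ∀ i, ‖Y i‖ < ρ := by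
    refine eventually_all.2 fun i => ?_
    exact ((continuous_apply i).norm.tendsto X).eventually_lt_const (hX i)
  refine squeeze_zero' (g := fun Y => c * ‖Y - X‖) (.of_forall fun _ => norm_nonneg _) ?_ ?_
  · filter_upwards [hev] with Y hY
    exact (hf Y X (fun i => (hY i).le) (fun i => (hX i).le) ‖Y - X‖ (norm_nonneg _)
      fun i => norm_le_pi_norm (Y - X) i).2
  · exact Continuous.tendsto' (by fun_prop) _ _ (by simp)

lemma AnalyticOnBall.continuousAt_deriv₁ (hA : AnalyticOnBall A R) {X : Fin n → E}
    (hX : ∀ i, ‖X i‖ₑ < R) (i : Fin n) : ContinuousAt (deriv₁ A i) X := by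
  obtain ⟨w, ρ, θ, hd, hρ⟩ := hA.exists_dominated (isCompact_singleton (x := X))
    (Set.singleton_nonempty X) (by simpa using hX)
  exact continuousAt_of_lipschitz (hd.deriv₁_lipschitz i) (hρ X rfl)

lemma AnalyticOnBall.continuousAt_deriv₂ (hA : AnalyticOnBall A R) {X : Fin n → E}
    (hX : ∀ i, ‖X i‖ₑ < R) (i j : Fin n) : ContinuousAt (deriv₂ A i j) X := by
  obtain ⟨w, ρ, θ, hd, hρ⟩ := hA.exists_dominated (isCompact_singleton (x := X))
    (Set.singleton_nonempty X) (by simpa using hX)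
  exact continuousAt_of_lipschitz (hd.deriv₂_lipschitz i j) (hρ X rfl)

lemma AnalyticOnBall.hasFDerivAt (hA : AnalyticOnBall A R) {X : Fin n → E}
    (hX : ∀ i, ‖X i‖ₑ < R) : HasFDerivAt (evalSeries A)
      (∑ i, (pairL (deriv₁ A i X)).comp (ContinuousLinearMap.proj (R := ℝ) i)) X := by
  obtain ⟨w, ρ, θ, hd, hρ⟩ := hA.exists_dominated (isCompact_singleton (x := X))
    (Set.singleton_nonempty X) (by simpa using hX)
  exact hd.hasFDerivAt (hρ X rfl)

/-- The chain rule along a differentiable curve. -/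
lemma AnalyticOnBall.hasDerivAt_comp (hA : AnalyticOnBall A R) {X : ℝ → Fin n → E} {t : ℝ}
    (hX : ∀ i, ‖X t i‖ₑ < R) {X' : Fin n → E} (hX' : ∀ i, HasDerivAt (fun t => X t i) (X' i) t) :
    HasDerivAt (fun t => evalSeries A (X t)) (∑ i, pair (X' i) (deriv₁ A i (X t))) t := by
  refine ((hA.hasFDerivAt hX).comp_hasDerivAt t (hasDerivAt_pi.2 hX')).congr_deriv ?_
  simp [pairL_apply]

/-- The terms of first and second order of the Taylor expansion at `X`, in the direction `h`. -/
def taylorPoly (A : Coeffs E n) (X h : Fin n → E) : E :=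
  ∑ i, pair (h i) (deriv₁ A i X) +
    ∑ i, ∑ j, sandwich (ContinuousLinearMap.mulLeftRight ℝ E (h i) (h j)) (deriv₂ A i j X)

lemma continuous_taylorPoly (A : Coeffs E n) (X : Fin n → E) {h : ℝ → Fin n → E}
    (hh : ∀ i, Continuous fun t => h t i) : Continuous fun t => taylorPoly A X (h t) := by
  refine Continuous.add (continuous_finsetSum _ fun i _ => ?_)
    (continuous_finsetSum _ fun i _ => continuous_finsetSum _ fun j _ => ?_)
  · exact (pairL (deriv₁ A i X)).continuous.comp (hh i)
  · exact (sandwichL (deriv₂ A i j X)).continuous.comp (continuous_mulLeftRight (hh i) (hh j))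

/-- The Taylor polynomial may be integrated over the direction before it is paired with the
derivatives. -/
lemma integral_smul_taylorPoly (A : Coeffs E n) (X : Fin n → E) {ψ : ℝ → ℝ} (hψ : Continuous ψ)
    (hc : HasCompactSupport ψ) {h : ℝ → Fin n → E} (hh : ∀ i, Continuous fun t => h t i) :
    ∫ t, ψ t • taylorPoly A X (h t) =
      ∑ i, pair (∫ t, ψ t • h t i) (deriv₁ A i X) +
        ∑ i, ∑ j, sandwich (∫ t, ψ t • ContinuousLinearMap.mulLeftRight ℝ E (h t i) (h t j))
          (deriv₂ A i j X) := by
  have i1 : ∀ i, Integrable fun t => ψ t • h t i := fun i =>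
    integrable_smul_of_continuousOn hψ hc (hh i).continuousOn
  have i2 : ∀ i j, Integrable fun t => ψ t • ContinuousLinearMap.mulLeftRight ℝ E (h t i) (h t j) :=
    fun i j => integrable_smul_of_continuousOn hψ hc
      (continuous_mulLeftRight (hh i) (hh j)).continuousOn
  simp only [← pairL_apply, ← sandwichL_apply]
  simp only [← ContinuousLinearMap.integral_comp_comm _ (i1 _),
    ← ContinuousLinearMap.integral_comp_comm _ (i2 _ _)]
  have i1' : ∀ i, Integrable fun t => pairL (deriv₁ A i X) (ψ t • h t i) := fun i =>
    (pairL (deriv₁ A i X)).integrable_comp (i1 i)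
  have i2' : ∀ i j, Integrable fun t => sandwichL (deriv₂ A i j X)
      (ψ t • ContinuousLinearMap.mulLeftRight ℝ E (h t i) (h t j)) := fun i j =>
    (sandwichL (deriv₂ A i j X)).integrable_comp (i2 i j)
  simp only [← integral_finsetSum _ fun j _ => i2' _ j]
  rw [← integral_finsetSum _ fun i _ => i1' i,
    ← integral_finsetSum _ fun i _ => integrable_finsetSum _ fun j _ => i2' i j,
    ← integral_add (integrable_finsetSum _ fun i _ => i1' i)
      (integrable_finsetSum _ fun i _ => integrable_finsetSum _ fun j _ => i2' i j)]
  refine integral_congr_ae (.of_forall fun t => ?_)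
  simp only [taylorPoly, smul_add, Finset.smul_sum, map_smul, pairL_apply, sandwichL_apply]

end AnalyticLocal

/-! ### Distributions given by continuous functions -/

section Distributions

variable {E : Type} [NormedAddCommGroup E] [NormedSpace ℝ E] {Ω : Opens ℝ}

/-- The distribution `∂ₜ f - g` for functions that are continuous on `Ω`. -/
lemma exists_distribution {f g : ℝ → E} (hf : ContinuousOn f Ω) (hg : ContinuousOn g Ω) :
    ∃ ζ : 𝓓'(Ω, E), ∀ φ : 𝓓(Ω, ℝ), ζ φ = -(∫ t, deriv φ t • f t) - ∫ t, φ t • g t := by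
  have hf' : LocallyIntegrableOn f Ω := hf.locallyIntegrableOn Ω.isOpen.measurableSet
  have hg' : LocallyIntegrableOn g Ω := hg.locallyIntegrableOn Ω.isOpen.measurableSet
  let S (f : ℝ → E) : 𝓓(Ω, ℝ) →L[ℝ] E :=
    TestFunction.integralAgainstBilinCLM (ContinuousLinearMap.lsmul ℝ ℝ) volume f
  let T : 𝓓(Ω, ℝ) →L[ℝ] E :=
    -(S f).comp (TestFunction.lineDerivCLM ℝ (1 : ℝ) : 𝓓(Ω, ℝ) →L[ℝ] 𝓓(Ω, ℝ)) - S g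
  refine ⟨{ toLinearMap := T.toLinearMap, cont := T.continuous }, fun φ => ?_⟩
  have h1 (t : ℝ) : (TestFunction.lineDerivCLM ℝ (1 : ℝ) : 𝓓(Ω, ℝ) →L[ℝ] 𝓓(Ω, ℝ)) φ t = deriv φ t := by
    have h2 : DifferentiableAt ℝ φ t := (φ.contDiff.differentiable (by simp)).differentiableAt
    rw [TestFunction.lineDerivCLM_apply_of_le (by simp), h2.lineDeriv_eq_fderiv,
      fderiv_apply_one_eq_deriv]
  change -(S f ((TestFunction.lineDerivCLM ℝ (1 : ℝ) : 𝓓(Ω, ℝ) →L[ℝ] 𝓓(Ω, ℝ)) φ)) - S g φ = _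
  simp only [S]
  rw [TestFunction.integralAgainstBilinCLM_eq_integral hf',
    TestFunction.integralAgainstBilinCLM_eq_integral hg']
  simp only [ContinuousLinearMap.lsmul_apply, h1]

lemma norm_integral_smul_le {ψ : ℝ → ℝ} {f : ℝ → E} {s l M b : ℝ} (hl : 0 ≤ l) (hM : 0 ≤ M)
    (hψ : ∀ t, |ψ t| ≤ M) (h0 : ∀ t, t ∉ Set.Icc (s - l) (s + l) → ψ t = 0)
    (hf : ∀ t ∈ Set.Icc (s - l) (s + l), ‖f t‖ ≤ b) :
    ‖∫ t, ψ t • f t‖ ≤ 2 * l * (M * b) := by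
  rw [← setIntegral_eq_integral_of_forall_compl_eq_zero (s := Set.Icc (s - l) (s + l))
    fun t ht => by rw [h0 t ht, zero_smul]]
  refine (norm_setIntegral_le_of_norm_le_const (C := M * b) measure_Icc_lt_top fun t ht => ?_).trans
    (le_of_eq ?_)
  · rw [norm_smul]
    exact mul_le_mul (hψ t) (hf t ht) (norm_nonneg _) hM
  · rw [Real.volume_real_Icc_of_le (by linarith)]
    ring

end Distributions

/-! ### Distributions of positive scaling vanish -/

section SmoothPartition

/-- A smooth function supported in `[-1, 1]` whose integer translates form a partition of unity. -/
def smoothTent (x : ℝ) : ℝ := Real.smoothTransition (x + 1) - Real.smoothTransition x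

lemma contDiff_smoothTent {m : ℕ∞} : ContDiff ℝ m smoothTent :=
  (Real.smoothTransition.contDiff.comp (contDiff_id.add contDiff_const)).sub
    Real.smoothTransition.contDiff

lemma abs_smoothTent_le (x : ℝ) : |smoothTent x| ≤ 1 := by
  rw [abs_le, smoothTent]
  constructor <;> linarith [Real.smoothTransition.nonneg x, Real.smoothTransition.nonneg (x + 1),
    Real.smoothTransition.le_one x, Real.smoothTransition.le_one (x + 1)]

lemma smoothTent_eq_zero {x : ℝ} (hx : x ∉ Set.Icc (-1 : ℝ) 1) : smoothTent x = 0 := by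
  rw [Set.mem_Icc, not_and_or, not_le, not_le] at hx
  rcases hx with hx | hx
  · rw [smoothTent, Real.smoothTransition.zero_of_nonpos (by linarith),
      Real.smoothTransition.zero_of_nonpos (by linarith), sub_zero]
  · rw [smoothTent, Real.smoothTransition.one_of_one_le (by linarith),
      Real.smoothTransition.one_of_one_le (by linarith), sub_self]

lemma tsupport_smoothTent_subset : tsupport smoothTent ⊆ Set.Icc (-1) 1 :=
  closure_minimal (fun _ hx => by_contra fun h => hx (smoothTent_eq_zero h)) isClosed_Icc

lemma exists_abs_deriv_smoothTent_le : ∃ c : ℝ, ∀ x, |deriv smoothTent x| ≤ c := by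
  have hc : HasCompactSupport smoothTent :=
    HasCompactSupport.of_support_subset_isCompact isCompact_Icc
      ((subset_tsupport _).trans tsupport_smoothTent_subset)
  have h1 : ContDiff ℝ 1 smoothTent := contDiff_smoothTent (m := 1)
  exact (h1.continuous_deriv le_rfl).bounded_above_of_compact_support hc.deriv

lemma sum_smoothTent_eq_one (N : ℕ) {x : ℝ} (hx : |x| ≤ N) :
    ∑ m ∈ Finset.range (2 * N + 1), smoothTent (x + N - m) = 1 := by
  have h : ∀ m : ℕ, smoothTent (x + N - m) = -Real.smoothTransition (x + N + 1 - (m + 1 : ℕ)) -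
      -Real.smoothTransition (x + N + 1 - m) := fun m => by
    rw [smoothTent]
    push_cast
    rw [show x + N - m + 1 = x + N + 1 - m by ring, show x + N + 1 - ((m : ℝ) + 1) = x + N - m by ring]
    ring
  obtain ⟨h1, h2⟩ := abs_le.1 hx
  simp only [h]
  rw [Finset.sum_range_sub (fun m : ℕ => -Real.smoothTransition (x + N + 1 - m))]
  push_cast
  rw [Real.smoothTransition.zero_of_nonpos (by linarith), Real.smoothTransition.one_of_one_le (by linarith)]
  ring

end SmoothPartition

section Uniqueness

variable {E : Type} [NormedAddCommGroup E] [NormedSpace ℝ E] {Ω : Opens ℝ}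

/-- A distribution whose values on test functions of scale `l` and height `l⁻¹` are of order `l ^ γ`,
`γ > 0`, vanishes: cut a test function into `O(l⁻¹)` pieces of scale `l`, each of which is `l` times
such a function. -/
lemma eq_zero_of_scaling (ν : 𝓓(Ω, ℝ) →ₗ[ℝ] E) {γ : ℝ} (hγ : 0 < γ)
    (h : ∀ K : Set ℝ, IsCompact K → K ⊆ Ω → ∃ c : ℝ, ∀ s l : ℝ, 0 < l → l ≤ 1 →
      Set.Icc (s - l) (s + l) ⊆ K → ∀ η : ℝ → ℝ, ContDiff ℝ ∞ η → tsupport η ⊆ Set.Icc (-1) 1 →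
        (∀ x, |η x| ≤ 1) → (∀ x, |deriv η x| ≤ 1) → ∀ φ : 𝓓(Ω, ℝ), (∀ t, φ t = l⁻¹ * η ((t - s) / l)) →
          ‖ν φ‖ ≤ c * l ^ γ) (φ : 𝓓(Ω, ℝ)) : ν φ = 0 := by
  obtain ⟨δ, hδ, hsub⟩ := φ.hasCompactSupport.isCompact.exists_cthickening_subset_open Ω.isOpen
    φ.tsupport_subset
  obtain ⟨c, hc⟩ := h _ φ.hasCompactSupport.isCompact.cthickening hsub
  obtain ⟨a, ha⟩ : ∃ a : ℕ, ∀ t ∈ tsupport φ, |t| ≤ a := by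
    obtain ⟨r, hr⟩ := φ.hasCompactSupport.isCompact.isBounded.exists_norm_le
    obtain ⟨a, ha⟩ := exists_nat_ge r
    exact ⟨a, fun t ht => (hr t ht).trans ha⟩
  obtain ⟨b₀, hb₀⟩ := φ.continuous.bounded_above_of_compact_support φ.hasCompactSupport
  obtain ⟨b₁, hb₁⟩ := ((testFunction_contDiff φ).continuous_deriv le_rfl).bounded_above_of_compact_support
    φ.hasCompactSupport.deriv
  obtain ⟨b₂, hb₂⟩ := exists_abs_deriv_smoothTent_le
  have hb₀' : 0 ≤ b₀ := (norm_nonneg _).trans (hb₀ 0)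
  have hb₁' : 0 ≤ b₁ := (norm_nonneg _).trans (hb₁ 0)
  have hb₂' : 0 ≤ b₂ := (abs_nonneg _).trans (hb₂ 0)
  -- `M` bounds a rescaled piece of `φ` and its derivative.
  obtain ⟨M, hM⟩ : ∃ M, M = b₀ + b₁ + b₀ * b₂ + 1 := ⟨_, rfl⟩
  have hM0 : 0 < M := by rw [hM]; positivity
  obtain ⟨c', hc', hcc⟩ : ∃ c' : ℝ, 0 ≤ c' ∧ c ≤ c' := ⟨max c 0, le_max_right _ _, le_max_left _ _⟩
  -- the piece of `φ` of scale `1 / p` around `k / p`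
  let piece (p : ℕ) (k : ℝ) : 𝓓(Ω, ℝ) :=
    ⟨fun t => φ t * smoothTent (p * t - k),
      φ.contDiff.mul (contDiff_smoothTent.comp ((contDiff_const.mul contDiff_id).sub contDiff_const)),
      φ.hasCompactSupport.mul_right, (tsupport_mul_subset_left).trans φ.tsupport_subset⟩
  have hpiece : ∀ p k t, piece p k t = φ t * smoothTent (p * t - k) := fun p k t => rfl
  have bound : ∀ p : ℕ, 0 < p → 2 / (p : ℝ) ≤ δ → ∀ k,
      ‖ν (piece p k)‖ ≤ M * c' * ((p : ℝ)⁻¹ * (p : ℝ)⁻¹ ^ γ) := by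
    intro p hp hpδ k
    have hp0 : (0 : ℝ) < p := by exact_mod_cast hp
    have hp1 : (1 : ℝ) ≤ p := by exact_mod_cast hp
    have hrhs : 0 ≤ M * c' * ((p : ℝ)⁻¹ * (p : ℝ)⁻¹ ^ γ) := by positivity
    by_cases hmeet : ∃ t ∈ tsupport φ, t ∈ Set.Icc (k / p - (p : ℝ)⁻¹) (k / p + (p : ℝ)⁻¹)
    swap
    · have : piece p k = 0 := by
        ext t
        rw [hpiece]
        by_cases ht : t ∈ tsupport φ
        · rw [smoothTent_eq_zero, mul_zero]; rfl
          intro hx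
          refine hmeet ⟨t, ht, ?_, ?_⟩
          · rw [← one_div, ← sub_div, div_le_iff₀ hp0]; linarith [hx.1]
          · rw [← one_div, ← add_div, le_div_iff₀ hp0]; linarith [hx.2]
        · rw [image_eq_zero_of_notMem_tsupport ht, zero_mul]; rfl
      rw [this, map_zero, norm_zero]
      exact hrhs
    obtain ⟨t₀, ht₀, ht₀'⟩ := hmeet
    have hη : ∀ x, HasDerivAt (fun x => M⁻¹ * (φ ((p : ℝ)⁻¹ * x + k / p) * smoothTent x))
        (M⁻¹ * ((deriv φ ((p : ℝ)⁻¹ * x + k / p) * (p : ℝ)⁻¹) * smoothTent x +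
          φ ((p : ℝ)⁻¹ * x + k / p) * deriv smoothTent x)) x := by
      intro x
      have d1 : HasDerivAt (fun x : ℝ => (p : ℝ)⁻¹ * x + k / p) (p : ℝ)⁻¹ x := by
        simpa using ((hasDerivAt_id x).const_mul (p : ℝ)⁻¹).add_const (k / p)
      have d2 : HasDerivAt φ (deriv φ ((p : ℝ)⁻¹ * x + k / p)) ((p : ℝ)⁻¹ * x + k / p) :=
        ((testFunction_contDiff φ).differentiable one_ne_zero _).hasDerivAt
      have d3 : HasDerivAt smoothTent (deriv smoothTent x) x :=
        ((contDiff_smoothTent (m := 1)).differentiable one_ne_zero x).hasDerivAt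
      exact ((d2.comp x d1).mul d3).const_mul _
    have key := hc (k / p) (p : ℝ)⁻¹ (by positivity) (inv_le_one_of_one_le₀ hp1) ?_
      (fun x => M⁻¹ * (φ ((p : ℝ)⁻¹ * x + k / p) * smoothTent x)) ?_ ?_ ?_ ?_ ((M⁻¹ * p) • piece p k) ?_
    · rw [map_smul, norm_smul, Real.norm_of_nonneg (by positivity), ← le_div_iff₀' (by positivity)] at key
      refine key.trans ?_
      rw [div_eq_mul_inv, mul_inv, inv_inv]
      calc c * (p : ℝ)⁻¹ ^ γ * (M * (p : ℝ)⁻¹) ≤ c' * (p : ℝ)⁻¹ ^ γ * (M * (p : ℝ)⁻¹) := by gcongr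
        _ = _ := by ring
    · intro t ht
      refine Metric.mem_cthickening_of_dist_le t t₀ δ _ ht₀ ?_
      rw [Real.dist_eq, abs_le]
      have : 2 / (p : ℝ) = (p : ℝ)⁻¹ + (p : ℝ)⁻¹ := by ring
      constructor <;> linarith [ht.1, ht.2, ht₀'.1, ht₀'.2]
    · exact contDiff_const.mul ((φ.contDiff.comp
        ((contDiff_const.mul contDiff_id).add contDiff_const)).mul contDiff_smoothTent)
    · refine (tsupport_mul_subset_right).trans ((tsupport_mul_subset_right).trans
        tsupport_smoothTent_subset)
    · intro x
      rw [abs_mul, abs_mul, abs_of_pos (inv_pos.2 hM0), inv_mul_le_iff₀ hM0, mul_one]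
      calc |φ ((p : ℝ)⁻¹ * x + k / p)| * |smoothTent x| ≤ b₀ * 1 := by
            gcongr
            · exact hb₀ _
            · exact abs_smoothTent_le x
        _ ≤ M := by rw [hM]; nlinarith
    · intro x
      rw [(hη x).deriv, abs_mul, abs_of_pos (inv_pos.2 hM0), inv_mul_le_iff₀ hM0, mul_one]
      refine (abs_add_le _ _).trans ?_
      rw [abs_mul, abs_mul, abs_mul, abs_of_pos (inv_pos.2 hp0)]
      calc _ ≤ b₁ * 1 * 1 + b₀ * b₂ := by
            gcongr
            · exact hb₁ _
            · exact inv_le_one_of_one_le₀ hp1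
            · exact abs_smoothTent_le x
            · exact hb₀ _
            · exact hb₂ x
        _ ≤ M := by rw [hM]; linarith
    · intro t
      change (M⁻¹ * p) * (φ t * smoothTent (p * t - k)) = _
      have e1 : (t - k / p) / (p : ℝ)⁻¹ = p * t - k := by field_simp
      have e2 : (p : ℝ)⁻¹ * (p * t - k) + k / p = t := by field_simp; ring
      rw [e1, e2, inv_inv]
      ring
  have hsum : ∀ p : ℕ, 0 < p → φ = ∑ m ∈ Finset.range (2 * (a * p) + 1), piece p (m - (a * p : ℕ)) := by
    intro p hp
    ext t
    rw [sum_apply]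
    simp only [hpiece]
    rw [← Finset.mul_sum]
    by_cases ht : t ∈ tsupport φ
    · have := sum_smoothTent_eq_one (a * p) (x := p * t) (by
        push_cast
        rw [abs_mul, Nat.abs_cast, mul_comm]
        exact mul_le_mul_of_nonneg_right (ha t ht) (Nat.cast_nonneg _))
      simp only [sub_sub_eq_add_sub]
      rw [this, mul_one]
    · rw [image_eq_zero_of_notMem_tsupport ht, zero_mul]
  have total : ∀ᶠ p : ℕ in atTop, ‖ν φ‖ ≤ (2 * a + 1) * (M * c') * (p : ℝ)⁻¹ ^ γ := by
    have h2 : ∀ᶠ p : ℕ in atTop, 2 / (p : ℝ) ≤ δ :=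
      (tendsto_const_div_atTop_nhds_zero_nat 2).eventually_le_const hδ
    filter_upwards [h2, eventually_gt_atTop 0] with p h2 hp
    have hp1 : (1 : ℝ) ≤ p := by exact_mod_cast hp
    have hp0 : (0 : ℝ) < p := by linarith
    conv_lhs => rw [hsum p hp, map_sum]
    refine (norm_sum_le_of_le _ fun m _ => bound p hp h2 _).trans ?_
    rw [Finset.sum_const, Finset.card_range, nsmul_eq_mul]
    push_cast
    have : (2 * ((a : ℝ) * p) + 1) * (p : ℝ)⁻¹ ≤ 2 * a + 1 := by
      rw [← div_eq_mul_inv, div_le_iff₀ hp0]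
      nlinarith
    calc _ = ((2 * ((a : ℝ) * p) + 1) * (p : ℝ)⁻¹) * (M * c') * (p : ℝ)⁻¹ ^ γ := by ring
      _ ≤ _ := by gcongr
  have hlim : Tendsto (fun p : ℕ => (2 * a + 1) * (M * c') * (p : ℝ)⁻¹ ^ γ) atTop (𝓝 0) := by
    have h1 : Tendsto (fun p : ℕ => (p : ℝ)⁻¹ ^ γ) atTop (𝓝 0) := by
      have := (tendsto_inv_atTop_nhds_zero_nat (𝕜 := ℝ)).rpow_const (p := γ) (Or.inr hγ.le)
      rwa [Real.zero_rpow hγ.ne'] at this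
    simpa using h1.const_mul ((2 * a + 1) * (M * c'))
  exact norm_le_zero_iff.1 (ge_of_tendsto hlim total)

end Uniqueness

/-! ### Second order expansion along Hölder continuous paths -/

section LocalExpansion

variable {E : Type} [NormedRing E] [NormedAlgebra ℝ E] [CompleteSpace E] {n : ℕ}
  {A : Coeffs E n} {R : ENNReal}

/-- The second order term `∑ᵢⱼ cᵢⱼ (D_iD_jF(X))[T]`. -/
def contraction (T : E →L[ℝ] E) (c : Fin n → Fin n → ℝ) (A : Coeffs E n) (X : Fin n → E) : E :=
  ∑ i, ∑ j, c i j • sandwich T (deriv₂ A i j X)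

lemma AnalyticOnBall.continuousAt_contraction (hA : AnalyticOnBall A R) (T : E →L[ℝ] E)
    (c : Fin n → Fin n → ℝ) {X : Fin n → E} (hX : ∀ i, ‖X i‖ₑ < R) :
    ContinuousAt (contraction T c A) X := by
  refine tendsto_finsetSum _ fun i _ => tendsto_finsetSum _ fun j _ => Tendsto.const_smul ?_ _
  exact ((sandwich T).continuous.tendsto _).comp (hA.continuousAt_deriv₂ hX i j)

lemma Dominated.contraction_lipschitz {w : (m : ℕ) → (Fin m → Fin n) → ℝ} {ρ θ : ℝ} (h : Dominated A w ρ θ)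
    (T : E →L[ℝ] E) (c : Fin n → Fin n → ℝ) :
    ∃ b : ℝ, 0 ≤ b ∧ ∀ X Y : Fin n → E, (∀ i, ‖X i‖ ≤ ρ) → (∀ i, ‖Y i‖ ≤ ρ) → ∀ δ, 0 ≤ δ →
      (∀ i, ‖X i - Y i‖ ≤ δ) → ‖contraction T c A X - contraction T c A Y‖ ≤ b * δ := by
  choose b hb hb' using h.deriv₂_lipschitz
  refine ⟨∑ i, ∑ j, |c i j| * (‖T‖ * b i j), Finset.sum_nonneg fun i _ => Finset.sum_nonneg fun j _ =>
    mul_nonneg (abs_nonneg _) (mul_nonneg (norm_nonneg _) (hb i j)), fun X Y hX hY δ hδ hXY => ?_⟩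
  rw [contraction, contraction, ← Finset.sum_sub_distrib, Finset.sum_mul]
  refine norm_sum_le_of_le _ fun i _ => ?_
  rw [← Finset.sum_sub_distrib, Finset.sum_mul]
  refine norm_sum_le_of_le _ fun j _ => ?_
  rw [← smul_sub, ← map_sub, norm_smul, Real.norm_eq_abs, mul_assoc]
  refine mul_le_mul_of_nonneg_left ((norm_sandwich_le T _).trans ?_) (abs_nonneg _)
  rw [mul_assoc]
  exact mul_le_mul_of_nonneg_left (hb' i j X Y hX hY δ hδ hXY).2 (norm_nonneg _)

/-- Along a path that is Hölder continuous of exponent `1 / 2`, the distribution `∂ₜ F(X) - g(X)` is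
approximated to order `1 / 2` at each scale by its second order expansion at the base point: the
remainder of the expansion of `F` is of order `3 / 2` and one derivative is lost. -/
lemma AnalyticOnBall.exists_local_bound (hA : AnalyticOnBall A R) (T : E →L[ℝ] E)
    (c : Fin n → Fin n → ℝ) {X : ℝ → Fin n → E} (hX : ∀ i, Continuous fun t => X t i) {N : ℝ}
    (hN : 0 ≤ N) (hhol : ∀ s t i, ‖X t i - X s i‖ ≤ N * √|t - s|) {K : Set ℝ} (hK : IsCompact K)
    (hKR : ∀ t ∈ K, ∀ i, ‖X t i‖ₑ < R) :
    ∃ b : ℝ, ∀ s l : ℝ, 0 < l → Set.Icc (s - l) (s + l) ⊆ K → ∀ φ : ℝ → ℝ, ContDiff ℝ 1 φ →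
      tsupport φ ⊆ Set.Icc (s - l) (s + l) → (∀ t, |φ t| ≤ l⁻¹) → (∀ t, |deriv φ t| ≤ (l ^ 2)⁻¹) →
        ‖(-(∫ t, deriv φ t • evalSeries A (X t)) - ∫ t, φ t • contraction T c A (X t)) -
          (-(∫ t, deriv φ t • taylorPoly A (X s) (fun i => X t i - X s i)) -
            (∫ t, φ t) • contraction T c A (X s))‖ ≤ b * l ^ (1 / 2 : ℝ) := by
  rcases K.eq_empty_or_nonempty with rfl | hne
  · exact ⟨0, fun s l hl hsub => absurd (hsub (Set.left_mem_Icc.2 (by linarith))) (Set.notMem_empty _)⟩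
  have hXc : Continuous X := continuous_pi hX
  obtain ⟨w, ρ, θ, hd, hρ⟩ := hA.exists_dominated (hK.image hXc) (hne.image X)
    (by rintro _ ⟨t, ht, rfl⟩; exact hKR t ht)
  have hρ' : ∀ t ∈ K, ∀ i, ‖X t i‖ ≤ ρ := fun t ht i => (hρ _ ⟨t, ht, rfl⟩ i).le
  obtain ⟨b₁, hb₁, hT⟩ := hd.taylor
  obtain ⟨b₂, hb₂, hL⟩ := hd.contraction_lipschitz T c
  refine ⟨2 * (b₁ * N ^ 3) + 2 * (b₂ * N), fun s l hl hsub φ hφ hsupp hφ0 hφ1 => ?_⟩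
  have hs : s ∈ K := hsub ⟨by linarith, by linarith⟩
  have hc : HasCompactSupport φ := HasCompactSupport.of_support_subset_isCompact isCompact_Icc
    ((subset_tsupport _).trans hsupp)
  have hφ' : Continuous (deriv φ) := hφ.continuous_deriv le_rfl
  have hφ'supp : tsupport (deriv φ) ⊆ Set.Icc (s - l) (s + l) := (tsupport_deriv_subset (f := φ)).trans hsupp
  have hFc : ContinuousOn (fun t => evalSeries A (X t)) (tsupport (deriv φ)) := fun t ht =>
    ((hA.hasFDerivAt (hKR t (hsub (hφ'supp ht)))).continuousAt.comp
      hXc.continuousAt).continuousWithinAt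
  have hGc : ContinuousOn (fun t => contraction T c A (X t)) (tsupport φ) := fun t ht =>
    ((hA.continuousAt_contraction T c (hKR t (hsub (hsupp ht)))).comp
      hXc.continuousAt).continuousWithinAt
  have hPc : Continuous fun t => taylorPoly A (X s) (fun i => X t i - X s i) :=
    continuous_taylorPoly A (X s) fun i => (hX i).sub continuous_const
  have i1 := integrable_smul_of_continuousOn hφ' hc.deriv hFc
  have i2 := integrable_smul_of_continuousOn hφ' hc.deriv hPc.continuousOn
  have i3 : Integrable fun t => deriv φ t • evalSeries A (X s) :=
    integrable_smul_of_continuousOn hφ' hc.deriv continuousOn_const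
  have i4 := integrable_smul_of_continuousOn hφ.continuous hc hGc
  have i5 : Integrable fun t => φ t • contraction T c A (X s) :=
    integrable_smul_of_continuousOn hφ.continuous hc continuousOn_const
  have key : (-(∫ t, deriv φ t • evalSeries A (X t)) - ∫ t, φ t • contraction T c A (X t)) -
          (-(∫ t, deriv φ t • taylorPoly A (X s) (fun i => X t i - X s i)) -
            (∫ t, φ t) • contraction T c A (X s)) =
      -(∫ t, deriv φ t • (evalSeries A (X t) - evalSeries A (X s) -
          taylorPoly A (X s) (fun i => X t i - X s i))) -
        ∫ t, φ t • (contraction T c A (X t) - contraction T c A (X s)) := by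
    have e0 : ∫ t, deriv φ t • evalSeries A (X s) = 0 := by
      rw [integral_smul_const, integral_deriv_eq_zero hφ hc, zero_smul]
    simp only [smul_sub]
    have i13 : Integrable fun t => deriv φ t • evalSeries A (X t) - deriv φ t • evalSeries A (X s) :=
      i1.sub i3
    rw [integral_sub i13 i2, integral_sub i1 i3, integral_sub i4 i5, e0, integral_smul_const]
    abel
  rw [key]
  have hdist : ∀ t ∈ Set.Icc (s - l) (s + l), ∀ i, ‖X t i - X s i‖ ≤ N * √l := fun t ht i =>
    (hhol s t i).trans (mul_le_mul_of_nonneg_left (Real.sqrt_le_sqrt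
      (abs_le.2 ⟨by linarith [ht.1], by linarith [ht.2]⟩)) hN)
  have B1 : ‖∫ t, deriv φ t • (evalSeries A (X t) - evalSeries A (X s) -
      taylorPoly A (X s) (fun i => X t i - X s i))‖ ≤ 2 * l * ((l ^ 2)⁻¹ * (b₁ * (N * √l) ^ 3)) := by
    refine norm_integral_smul_le hl.le (by positivity) hφ1
      (fun t ht => image_eq_zero_of_notMem_tsupport fun h => ht (hφ'supp h)) fun t ht => ?_
    have := hT (X s) (X t) (hρ' s hs) (hρ' t (hsub ht)) (N * √l) (by positivity) (hdist t ht)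
    rwa [sub_sub _ (∑ i, _)] at this
  have B2 : ‖∫ t, φ t • (contraction T c A (X t) - contraction T c A (X s))‖ ≤
      2 * l * (l⁻¹ * (b₂ * (N * √l))) :=
    norm_integral_smul_le hl.le (by positivity) hφ0
      (fun t ht => image_eq_zero_of_notMem_tsupport fun h => ht (hsupp h)) fun t ht =>
        hL (X t) (X s) (hρ' t (hsub ht)) (hρ' s hs) (N * √l) (by positivity) (hdist t ht)
  rw [← Real.sqrt_eq_rpow]
  refine (norm_sub_le _ _).trans ?_
  rw [norm_neg]
  refine (add_le_add B1 B2).trans (le_of_eq ?_)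
  have hsq : √l ^ 3 = l * √l := by rw [pow_succ, Real.sq_sqrt hl.le]
  rw [mul_pow, hsq]
  field_simp

end LocalExpansion

/-! ### Convergence along mollified paths -/

section Mollified

variable {E : Type} [NormedRing E] [NormedAlgebra ℝ E] [CompleteSpace E] {n : ℕ}
  {A : Coeffs E n} {R : ENNReal} {ι : Type*} {L : Filter ι}

lemma continuous_pair : Continuous fun p : E × TP E 2 => pair p.1 p.2 :=
  IsBoundedBilinearMap.continuous (𝕜 := ℝ) (f := fun p : E × TP E 2 => pair p.1 p.2)
    { add_left := pair_add_apply
      smul_left := pair_smul_apply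
      add_right := fun h => map_add (pair h)
      smul_right := fun c h => map_smul (pair h) c
      bound := ⟨1, one_pos, fun h u => by rw [one_mul]; exact norm_pair_le h u⟩ }

/-- If smooth paths `Y k` converge uniformly to `X`, then `∂ₜ F(Y k)` and `g(Y k)` converge to
`∂ₜ F(X)` and `g(X)` in the sense of distributions. -/
lemma AnalyticOnBall.tendsto_integral (hA : AnalyticOnBall A R) {X : ℝ → Fin n → E}
    (hX : Continuous X) {Y : ι → ℝ → Fin n → E} {Y' : ι → ℝ → Fin n → E}
    (hY : ∀ᶠ k in L, (∀ t i, HasDerivAt (fun t => Y k t i) (Y' k t i) t) ∧ Continuous (Y' k))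
    (hYX : TendstoUniformly Y X L) {φ : ℝ → ℝ} (hφ : ContDiff ℝ 1 φ) (hc : HasCompactSupport φ)
    (hR : ∀ t ∈ tsupport φ, ∀ i, ‖X t i‖ₑ < R) (T : E →L[ℝ] E) :
    Tendsto (fun k => ∫ t, φ t • ∑ i, pair (Y' k t i) (deriv₁ A i (Y k t))) L
      (𝓝 (-∫ t, deriv φ t • evalSeries A (X t))) ∧
    (∀ i j, Tendsto (fun k => ∫ t, φ t • sandwich T (deriv₂ A i j (Y k t))) L
      (𝓝 (∫ t, φ t • sandwich T (deriv₂ A i j (X t))))) ∧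
    ∀ᶠ k in L, (Integrable fun t => φ t • ∑ i, pair (Y' k t i) (deriv₁ A i (Y k t))) ∧
      ∀ i j, Integrable fun t => φ t • sandwich T (deriv₂ A i j (Y k t)) := by
  have hK : IsCompact (tsupport φ) := hc
  have hφ' : Continuous (deriv φ) := hφ.continuous_deriv le_rfl
  have hK' : tsupport (deriv φ) ⊆ tsupport φ := tsupport_deriv_subset
  have hYR : ∀ᶠ k in L, ∀ t ∈ tsupport φ, ∀ i, ‖Y k t i‖ₑ < R := by
    have hopen : IsOpen {Z : Fin n → E | ∀ i, ‖Z i‖ₑ < R} := by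
      simp only [Set.ofPred_forall]
      exact isOpen_iInter_of_finite fun i => isOpen_lt (by fun_prop) continuous_const
    obtain ⟨δ, hδ, hsub⟩ := (hK.image hX).exists_thickening_subset_open hopen
      (by rintro _ ⟨t, ht, rfl⟩; exact hR t ht)
    filter_upwards [Metric.tendstoUniformly_iff.1 hYX δ hδ] with k hk t ht
    exact hsub (Metric.mem_thickening_iff.2 ⟨X t, ⟨t, ht, rfl⟩, by rw [dist_comm]; exact hk t⟩)
  have hYc : ∀ᶠ k in L, Continuous (Y k) := hY.mono fun k hk =>
    continuous_pi fun i => continuous_iff_continuousAt.2 fun t => (hk.1 t i).continuousAt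
  have c1 : ∀ᶠ k in L, ContinuousOn (fun t => ∑ i, pair (Y' k t i) (deriv₁ A i (Y k t)))
      (tsupport φ) := by
    filter_upwards [hY, hYR, hYc] with k hk hkR hkc
    refine continuousOn_finsetSum _ fun i _ t ht => ContinuousAt.continuousWithinAt ?_
    have a1 : ContinuousAt (fun t => Y' k t i) t := ((continuous_apply i).comp hk.2).continuousAt
    have a2 : ContinuousAt (fun t => deriv₁ A i (Y k t)) t :=
      ContinuousAt.comp (f := Y k) (hA.continuousAt_deriv₁ (hkR t ht) i) hkc.continuousAt
    exact ContinuousAt.comp (g := fun p : E × TP E 2 => pair p.1 p.2)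
      (f := fun t => (Y' k t i, deriv₁ A i (Y k t))) continuous_pair.continuousAt (a1.prodMk a2)
  have c2 : ∀ᶠ k in L, ∀ i j, ContinuousOn (fun t => sandwich T (deriv₂ A i j (Y k t)))
      (tsupport φ) := by
    filter_upwards [hYR, hYc] with k hkR hkc i j t ht
    exact ((sandwich T).continuous.continuousAt.comp ((hA.continuousAt_deriv₂ (hkR t ht) i j).comp
      hkc.continuousAt)).continuousWithinAt
  refine ⟨?_, fun i j => ?_, ?_⟩
  · have h1 : Tendsto (fun k => ∫ t, deriv φ t • evalSeries A (Y k t)) L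
        (𝓝 (∫ t, deriv φ t • evalSeries A (X t))) := by
      refine tendsto_integral_smul hφ' hc.deriv ?_ (fun t ht => ?_) ?_
      · filter_upwards [hYR, hYc] with k hkR hkc t ht
        exact ((hA.hasFDerivAt (hkR t (hK' ht))).continuousAt.comp
          hkc.continuousAt).continuousWithinAt
      · exact ((hA.hasFDerivAt (hR t (hK' ht))).continuousAt.comp
          hX.continuousAt).continuousWithinAt
      · exact (TendstoUniformlyOn.continuousAt_comp hK hYX.tendstoUniformlyOn hX.continuousOn
          fun t ht => (hA.hasFDerivAt (hR t ht)).continuousAt).mono hK'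
    refine h1.neg.congr' ?_
    filter_upwards [hY, hYR, c1] with k hk hkR hc1
    exact (integral_smul_eq_neg_integral_deriv_smul hφ hc
      (fun t ht => hA.hasDerivAt_comp (hkR t ht) (hk.1 t)) hc1).symm
  · refine tendsto_integral_smul hφ.continuous hc (c2.mono fun k hk => hk i j) (fun t ht => ?_) ?_
    · exact ((sandwich T).continuous.continuousAt.comp ((hA.continuousAt_deriv₂ (hR t ht) i j).comp
        hX.continuousAt)).continuousWithinAt
    · exact TendstoUniformlyOn.continuousAt_comp (F := fun Z => sandwich T (deriv₂ A i j Z)) hK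
        hYX.tendstoUniformlyOn hX.continuousOn fun t ht =>
          (sandwich T).continuous.continuousAt.comp (hA.continuousAt_deriv₂ (hR t ht) i j)
  · filter_upwards [c1, c2] with k h1 h2
    exact ⟨integrable_smul_of_continuousOn hφ.continuous hc h1,
      fun i j => integrable_smul_of_continuousOn hφ.continuous hc (h2 i j)⟩

end Mollified

/-! ### The germ and its reconstruction -/

section TestFunctions

variable {Ω : Opens ℝ}

lemma coe_monoCLM (φ : 𝓓(Ω, ℝ)) :
    ((TestFunction.monoCLM (𝕜 := ℝ) φ : 𝓓((⊤ : Opens ℝ), ℝ)) : ℝ → ℝ) = φ := by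
  rw [TestFunction.monoCLM_apply, if_pos ⟨le_rfl, le_top⟩]

/-- The size of `l⁻¹ η((· - s) / l)` and of its derivative. -/
lemma scaled_bounds {φ η : ℝ → ℝ} {s l : ℝ} (hl : 0 < l) (hη : ContDiff ℝ ∞ η)
    (hsupp : tsupport η ⊆ Set.Icc (-1) 1) (h0 : ∀ x, |η x| ≤ 1) (h1 : ∀ x, |deriv η x| ≤ 1)
    (hφ : ∀ t, φ t = l⁻¹ * η ((t - s) / l)) :
    tsupport φ ⊆ Set.Icc (s - l) (s + l) ∧ (∀ t, |φ t| ≤ l⁻¹) ∧ ∀ t, |deriv φ t| ≤ (l ^ 2)⁻¹ := by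
  refine ⟨closure_minimal (fun t ht => ?_) isClosed_Icc, fun t => ?_, fun t => ?_⟩
  · have hne : η ((t - s) / l) ≠ 0 := fun h => ht (by rw [hφ, h, mul_zero])
    have := hsupp (subset_tsupport _ hne)
    rw [Set.mem_Icc, le_div_iff₀ hl, div_le_iff₀ hl] at this
    exact ⟨by linarith [this.1], by linarith [this.2]⟩
  · rw [hφ, abs_mul, abs_of_pos (inv_pos.2 hl)]
    exact mul_le_of_le_one_right (inv_pos.2 hl).le (h0 _)
  · have d : HasDerivAt φ (l⁻¹ * (deriv η ((t - s) / l) * l⁻¹)) t := by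
      have e : φ = fun t => l⁻¹ * η ((t - s) / l) := funext hφ
      rw [e]
      have d1 : HasDerivAt (fun t => (t - s) / l) l⁻¹ t := by
        simpa using ((hasDerivAt_id t).sub_const s).div_const l
      exact (((hη.differentiable (by simp)) _).hasDerivAt.comp t d1).const_mul _
    rw [d.deriv, abs_mul, abs_mul, abs_of_pos (inv_pos.2 hl)]
    calc l⁻¹ * (|deriv η ((t - s) / l)| * l⁻¹) ≤ l⁻¹ * (1 * l⁻¹) := by
          gcongr
          exact h1 _
      _ = _ := by rw [one_mul, pow_two, mul_inv]

end TestFunctions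

section GermOfPath

/-- The noise is the distributional derivative of the path, from any base point. -/
lemma map_toL2 {W : Type*} [NormedAddCommGroup W] [NormedSpace ℝ W] [CompleteSpace W]
    (T : L2R →L[ℝ] W) {φ : ℝ → ℝ} (hφ : ContDiff ℝ 1 φ) (hc : HasCompactSupport φ) (s : ℝ) :
    T (toL2 φ) = -∫ t, deriv φ t • T (bm t - bm s) := by
  have hφ' : Continuous (deriv φ) := hφ.continuous_deriv le_rfl
  have i1 : Integrable fun t => deriv φ t • bm t :=
    integrable_smul_of_continuousOn hφ' hc.deriv continuous_bm.continuousOn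
  have i1' : Integrable fun t => deriv φ t • T (bm t) :=
    integrable_smul_of_continuousOn hφ' hc.deriv (T.continuous.comp continuous_bm).continuousOn
  have i2 : Integrable fun t => deriv φ t • T (bm s) :=
    integrable_smul_of_continuousOn hφ' hc.deriv continuousOn_const
  rw [toL2_eq_neg_integral hφ hc, map_neg, ← ContinuousLinearMap.integral_comp_comm _ i1]
  simp only [map_smul, map_sub, smul_sub]
  rw [integral_sub i1' i2, integral_smul_const, integral_deriv_eq_zero hφ hc, zero_smul, sub_zero]

variable (q : Set.Ioo (-1 : ℝ) 1) {n : ℕ}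

lemma brownian_sub (s t : ℝ) (i : Fin n) :
    brownian q t i - brownian q s i = noiseL q i (bm t - bm s) := by
  rw [brownian_eq, brownian_eq, map_sub]

lemma continuous_brownian (i : Fin n) : Continuous fun t => brownian q t i := by
  simp only [brownian_eq]
  exact (noiseL q i).continuous.comp continuous_bm

lemma norm_brownian_sub_le (s t : ℝ) (i : Fin n) :
    ‖brownian q t i - brownian q s i‖ ≤ (∑ i : Fin n, ‖noiseL q i‖) * √|t - s| := by
  rw [brownian_sub, ← norm_bm_sub]
  refine ((noiseL q i).le_opNorm _).trans (mul_le_mul_of_nonneg_right ?_ (norm_nonneg _))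
  exact Finset.single_le_sum (f := fun i => ‖noiseL q i‖) (fun i _ => norm_nonneg _)
    (Finset.mem_univ i)

/-- The correction term of the Itô formula. -/
def itoCorrection (C : Fin n → Fin n → ℝ) (A : Coeffs (Alg q n) n) (X : Fin n → Alg q n) : Alg q n :=
  contraction (deltaQ q n) (fun i j => C i j + C j i) A X

/-- The germ is the second order expansion of `∂ₜ F(B_q) - g(B_q)`, with `g` the Itô correction:
only the symmetric part of the lift enters, and it is a product of increments up to the
constants. -/
lemma IsLift.germ_eq {C : Fin n → Fin n → ℝ} {Z : Lift q n} (h : IsLift q C Z)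
    (A : Coeffs (Alg q n) n) (s : ℝ) (φ : 𝓓((⊤ : Opens ℝ), ℝ)) :
    germ q Z A s φ =
      -(∫ t, deriv φ t • taylorPoly A (brownian q s) (fun i => brownian q t i - brownian q s i)) -
        (∫ t, φ t) • itoCorrection q C A (brownian q s) := by
  have hφ := testFunction_contDiff φ
  have hc := φ.hasCompactSupport
  rw [integral_smul_taylorPoly A (brownian q s) (hφ.continuous_deriv le_rfl) hc.deriv
    (h := fun t i => brownian q t i - brownian q s i)
    (fun i => (continuous_brownian q i).sub continuous_const)]
  have e1 : ∀ i, pair (noise q i (toL2 φ)) (deriv₁ A i (brownian q s)) =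
      -pair (∫ t, deriv φ t • (brownian q t i - brownian q s i)) (deriv₁ A i (brownian q s)) := by
    intro i
    simp only [brownian_sub]
    rw [← noiseL_apply, map_toL2 (noiseL q i) hφ hc s, ← pairL_apply, ← pairL_apply, map_neg]
  have e2 : ∀ i j, sandwich (Z.L i j s φ + Z.R i j s φ) (deriv₂ A i j (brownian q s)) =
      -sandwich (∫ t, deriv φ t • ContinuousLinearMap.mulLeftRight ℝ (Alg q n)
        (brownian q t i - brownian q s i) (brownian q t j - brownian q s j))
          (deriv₂ A i j (brownian q s)) -
        (∫ t, φ t) • ((C i j + C j i) • sandwich (deltaQ q n) (deriv₂ A i j (brownian q s))) := by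
    intro i j
    simp only [brownian_sub]
    rw [h.L_add_R q i j s φ, ← sandwichL_apply, ← sandwichL_apply, ← sandwichL_apply, map_sub,
      map_neg, map_smul, smul_smul, mul_comm (∫ t, φ t)]
    rfl
  rw [germ, itoCorrection, contraction]
  simp only [e1, e2, Finset.sum_sub_distrib, Finset.sum_neg_distrib, Finset.smul_sum]
  abel

end GermOfPath

section Reconstruction

variable (q : Set.Ioo (-1 : ℝ) 1) {n : ℕ} {Ω : Opens ℝ}

lemma IsReconstruction.unique {G : ℝ → 𝓓((⊤ : Opens ℝ), ℝ) → Alg q n} {ζ₁ ζ₂ : 𝓓'(Ω, Alg q n)}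
    (h₁ : IsReconstruction q G ζ₁) (h₂ : IsReconstruction q G ζ₂) : ζ₁ = ζ₂ := by
  obtain ⟨γ₁, hγ₁, h₁⟩ := h₁
  obtain ⟨γ₂, hγ₂, h₂⟩ := h₂
  let ν : 𝓓(Ω, ℝ) →ₗ[ℝ] Alg q n :=
    { toFun := fun φ => ζ₁ φ - ζ₂ φ
      map_add' := fun φ ψ => by rw [map_add, map_add]; abel
      map_smul' := fun c φ => by rw [map_smul, map_smul, RingHom.id_apply, smul_sub] }
  ext φ
  refine sub_eq_zero.1 (eq_zero_of_scaling ν (lt_min hγ₁ hγ₂) (fun K hK hKΩ => ?_) φ)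
  obtain ⟨c₁, hc₁⟩ := h₁ K hK hKΩ
  obtain ⟨c₂, hc₂⟩ := h₂ K hK hKΩ
  refine ⟨|c₁| + |c₂|, fun s l hl hl1 hs η hη hsupp h0 h1 φ hφ => ?_⟩
  have b₁ := hc₁ s l hl hl1 hs η hη hsupp h0 h1 φ hφ
  have b₂ := hc₂ s l hl hl1 hs η hη hsupp h0 h1 φ hφ
  have p₁ : l ^ γ₁ ≤ l ^ min γ₁ γ₂ := Real.rpow_le_rpow_of_exponent_ge hl hl1 (min_le_left _ _)
  have p₂ : l ^ γ₂ ≤ l ^ min γ₁ γ₂ := Real.rpow_le_rpow_of_exponent_ge hl hl1 (min_le_right _ _)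
  have a₁ : c₁ * l ^ γ₁ ≤ |c₁| * l ^ min γ₁ γ₂ :=
    mul_le_mul (le_abs_self _) p₁ (by positivity) (abs_nonneg _)
  have a₂ : c₂ * l ^ γ₂ ≤ |c₂| * l ^ min γ₁ γ₂ :=
    mul_le_mul (le_abs_self _) p₂ (by positivity) (abs_nonneg _)
  have : ν φ = (ζ₁ φ - G s (TestFunction.monoCLM (𝕜 := ℝ) φ)) -
      (ζ₂ φ - G s (TestFunction.monoCLM (𝕜 := ℝ) φ)) := (sub_sub_sub_cancel_right _ _ _).symm
  rw [this, add_mul]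
  exact (norm_sub_le _ _).trans (add_le_add (b₁.trans a₁) (b₂.trans a₂))

/-- The reconstruction exists and is `∂ₜ F(B_q) - g(B_q)`, with `g` the Itô correction. -/
lemma IsLift.exists_reconstruction {C : Fin n → Fin n → ℝ} {Z : Lift q n} (h : IsLift q C Z)
    {A : Coeffs (Alg q n) n} {R : ENNReal} (hA : AnalyticOnBall A R)
    (hΩ : ∀ t ∈ Ω, ∀ i : Fin n, ‖brownian q t i‖ₑ < R) :
    ∃ ζ : 𝓓'(Ω, Alg q n), IsReconstruction q (germ q Z A) ζ ∧ ∀ φ : 𝓓(Ω, ℝ),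
      ζ φ = -(∫ t, deriv φ t • evalSeries A (brownian q t)) -
        ∫ t, φ t • itoCorrection q C A (brownian q t) := by
  have hB : Continuous fun t => (brownian q t : Fin n → Alg q n) :=
    continuous_pi (continuous_brownian q)
  obtain ⟨ζ, hζ⟩ := exists_distribution (E := Alg q n) (Ω := Ω)
    (f := fun t => evalSeries A (brownian q t))
    (g := fun t => itoCorrection q C A (brownian q t))
    (fun t ht => (ContinuousAt.comp (f := fun t => brownian q t) (hA.hasFDerivAt (hΩ t ht)).continuousAt
      hB.continuousAt).continuousWithinAt)
    (fun t ht => (ContinuousAt.comp (f := fun t => brownian q t)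
      (hA.continuousAt_contraction _ _ (hΩ t ht)) hB.continuousAt).continuousWithinAt)
  refine ⟨ζ, ⟨1 / 2, by norm_num, fun K hK hKΩ => ?_⟩, hζ⟩
  obtain ⟨b, hb⟩ := hA.exists_local_bound (deltaQ q n) (fun i j => C i j + C j i)
    (X := fun t => brownian q t) (continuous_brownian q)
    (Finset.sum_nonneg fun i _ => norm_nonneg (noiseL q i)) (norm_brownian_sub_le q) hK
    fun t ht => hΩ t (hKΩ ht)
  refine ⟨b, fun s l hl _ hs η hη hsupp h0 h1 φ hφ => ?_⟩
  obtain ⟨g1, g2, g3⟩ := scaled_bounds hl hη hsupp h0 h1 hφ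
  rw [hζ, h.germ_eq q]
  simp only [coe_monoCLM]
  exact hb s l hl hs φ (testFunction_contDiff φ) g1 g2 g3

end Reconstruction

/-! ### The Itô formula -/

section DoubleSums

variable {E : Type} [NormedAddCommGroup E] [NormedSpace ℝ E] {n : ℕ}

lemma integrable_smul_sum {φ : ℝ → ℝ} {f : Fin n → Fin n → ℝ → E} (c : Fin n → Fin n → ℝ)
    (h : ∀ i j, Integrable fun t => φ t • f i j t) :
    Integrable fun t => φ t • ∑ i, ∑ j, c i j • f i j t := by
  simp only [Finset.smul_sum, smul_comm (φ _) (c _ _)]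
  exact integrable_finsetSum _ fun i _ => integrable_finsetSum _ fun j _ => (h i j).smul (c i j)

lemma integral_smul_sum {φ : ℝ → ℝ} {f : Fin n → Fin n → ℝ → E} (c : Fin n → Fin n → ℝ)
    (h : ∀ i j, Integrable fun t => φ t • f i j t) :
    ∫ t, φ t • ∑ i, ∑ j, c i j • f i j t = ∑ i, ∑ j, c i j • ∫ t, φ t • f i j t := by
  have hi : ∀ i j, Integrable fun t => c i j • φ t • f i j t := fun i j => (h i j).smul (c i j)
  simp only [Finset.smul_sum, smul_comm (φ _) (c _ _)]
  rw [integral_finsetSum _ fun i _ => integrable_finsetSum _ fun j _ => hi i j]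
  refine Finset.sum_congr rfl fun i _ => ?_
  rw [integral_finsetSum _ fun j _ => hi i j]
  exact Finset.sum_congr rfl fun j _ => integral_smul _ _

end DoubleSums

section ItoFormula

variable (q : Set.Ioo (-1 : ℝ) 1) {n : ℕ} {Ω : Opens ℝ} {A : Coeffs (Alg q n) n} {R : ENNReal}
  {ρ : ℝ → ℝ}

lemma integral_itoCorrection (C : Fin n → Fin n → ℝ) (hA : AnalyticOnBall A R)
    (hΩ : ∀ t ∈ Ω, ∀ i : Fin n, ‖brownian q t i‖ₑ < R) (φ : 𝓓(Ω, ℝ)) :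
    ∫ t, φ t • itoCorrection q C A (brownian q t) =
      ∑ i, ∑ j, (C i j + C j i) • ∫ t, φ t • deltaR q n (deriv₂ A i j (brownian q t)) := by
  have hB : Continuous fun t => (brownian q t : Fin n → Alg q n) :=
    continuous_pi (continuous_brownian q)
  refine integral_smul_sum _ fun i j =>
    integrable_smul_of_continuousOn φ.continuous φ.hasCompactSupport fun t ht => ?_
  exact (ContinuousAt.comp (f := fun t => deriv₂ A i j (brownian q t))
    (sandwich (deltaQ q n)).continuous.continuousAt
    (ContinuousAt.comp (f := fun t => brownian q t)
      (hA.continuousAt_deriv₂ (hΩ t (φ.tsupport_subset ht)) i j)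
      hB.continuousAt)).continuousWithinAt

lemma brownianM_eq {ε a : ℝ} (h : IsKernel (rescale ρ ε) a) (t : ℝ) (i : Fin n) :
    brownianM q ρ ε t i = noiseL q i (molPath (rescale ρ ε) t - molPath (rescale ρ ε) 0) :=
  incrementM_eq q h i 0 t

lemma IsKernel.hasDerivAt_brownianM {ε a : ℝ} (h : IsKernel (rescale ρ ε) a) (t : ℝ) (i : Fin n) :
    HasDerivAt (fun t => brownianM q ρ ε t i) (noiseM q ρ ε i t) t := by
  simp only [brownianM_eq q h, noiseM_eq]
  exact h.hasDerivAt_noiseL q i 0 t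

lemma IsMollifier.hasDerivAt_evalSeries (hρ : IsMollifier ρ) (hA : AnalyticOnBall A R) {ε : ℝ}
    (hε : 0 < ε) {t : ℝ} (ht : ∀ i : Fin n, ‖brownianM q ρ ε t i‖ₑ < R) :
    HasDerivAt (fun u => evalSeries A (brownianM q ρ ε u))
      (∑ i, pair (noiseM q ρ ε i t) (deriv₁ A i (brownianM q ρ ε t))) t := by
  obtain ⟨M, -, hk⟩ := hρ.exists_isKernel
  exact hA.hasDerivAt_comp ht fun i => (hk ε hε).hasDerivAt_brownianM q t i

lemma IsMollifier.tendstoUniformly_brownianM (hρ : IsMollifier ρ) :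
    TendstoUniformly (fun ε t => (brownianM q ρ ε t : Fin n → Alg q n)) (fun t => brownian q t)
      (𝓝[>] 0) := by
  have h1 : TendstoUniformly (fun ε t => molPath (rescale ρ ε) t - molPath (rescale ρ ε) 0)
      (fun t => bm t - bm 0) (𝓝[>] 0) := fun u hu =>
    hρ.tendsto_rescale.eventually (tendstoUniformly_molPath_sub 0 u hu)
  have h2 : UniformContinuous fun v : L2R => (fun i => noiseL q i v : Fin n → Alg q n) :=
    uniformContinuous_pi.2 fun i => (noiseL q i).uniformContinuous
  have h3 := h2.comp_tendstoUniformly h1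
  have e : ∀ t, (brownian q t : Fin n → Alg q n) = fun i => noiseL q i (bm t - bm 0) := by
    intro t
    funext i
    rw [brownian, increment_eq]
  simp only [e]
  intro u hu
  filter_upwards [h3 u hu, hρ.eventually_isKernel] with ε h4 h t
  rw [show brownianM q ρ ε t = _ from funext (brownianM_eq q h t)]
  exact h4 t

end ItoFormula

end

end Mezdon

/-- The Itô formula for analytic functions of the `n`-dimensional `q`-Brownian motion. -/
theorem mainTheorem5 (q : Set.Ioo (-1 : ℝ) 1) (n : ℕ) :
    -- the vacuum expectations that determine the Itô lift: the constants are `δ_ij / 2`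
    (∀ ρ : ℝ → ℝ, IsMollifier ρ → ∀ ε : ℝ, 0 < ε → ∀ i j : Fin n,
      Tendsto (fun T : ℝ => vacuumState (NoiseSpace n) q
          (incrementM q ρ ε i 0 T * noiseM q ρ ε j 0))
        atTop (𝓝 (if i = j then 1 / 2 else 0)) ∧
      Tendsto (fun T : ℝ => vacuumState (NoiseSpace n) q
          (noiseM q ρ ε i 0 * incrementM q ρ ε j 0 T))
        atTop (𝓝 (if i = j then 1 / 2 else 0))) ∧
    ∀ C : Fin n → Fin n → ℝ,
      -- the lift with constants `C` exists and is unique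
      (∃! Z : Lift q n, IsLift q C Z) ∧
      ∀ Z : Lift q n, IsLift q C Z →
      ∀ (R : ENNReal) (A : Coeffs (Alg q n) n), AnalyticOnBall A R →
      ∀ Ω : Opens ℝ, (∀ t ∈ Ω, ∀ i : Fin n, ‖brownian q t i‖ₑ < R) →
        -- `∑ᵢ D_iF(B_q)[ξ_q^i]` is well defined as a distribution
        (∃! ζ : 𝓓'(Ω, Alg q n), IsReconstruction q (germ q Z A) ζ) ∧
        ∀ ζ : 𝓓'(Ω, Alg q n), IsReconstruction q (germ q Z A) ζ →
          -- the Itô formula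
          (∀ φ : 𝓓(Ω, ℝ),
            -∫ t, deriv φ t • evalSeries A (brownian q t) =
              ζ φ + ∑ i, ∑ j, (C i j + C j i) •
                ∫ t, φ t • deltaR q n (deriv₂ A i j (brownian q t))) ∧
          -- its mollified version
          ∀ ρ : ℝ → ℝ, IsMollifier ρ →
            (∀ ε : ℝ, 0 < ε → ∀ t : ℝ, (∀ i : Fin n, ‖brownianM q ρ ε t i‖ₑ < R) →
              HasDerivAt (fun u => evalSeries A (brownianM q ρ ε u))
                (∑ i, pair (noiseM q ρ ε i t) (deriv₁ A i (brownianM q ρ ε t))) t) ∧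
            ∀ l r : ℝ → Fin n → Fin n → ℝ, CountertermsTo C l r → ∀ φ : 𝓓(Ω, ℝ),
              Tendsto (fun ε => ∫ t, φ t •
                  ((∑ i, pair (noiseM q ρ ε i t) (deriv₁ A i (brownianM q ρ ε t))) -
                    ∑ i, ∑ j, (l ε i j + r ε i j) •
                      deltaR q n (deriv₂ A i j (brownianM q ρ ε t))))
                (𝓝[>] 0) (𝓝 (ζ φ)) := by
  refine ⟨fun ρ hρ ε hε i j => tendsto_vacuumState q hρ hε i j, fun C => ?_⟩
  obtain ⟨Z₀, hZ₀, -⟩ := exists_isLift (n := n) q C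
  refine ⟨⟨Z₀, hZ₀, fun Z hZ => hZ.unique q hZ₀⟩, fun Z hZ R A hA Ω hΩ => ?_⟩
  obtain ⟨ζ₀, hζ₀, hf⟩ := hZ.exists_reconstruction q hA hΩ
  refine ⟨⟨ζ₀, hζ₀, fun ζ hζ => hζ.unique q hζ₀⟩, fun ζ hζ => ?_⟩
  obtain rfl : ζ = ζ₀ := hζ.unique q hζ₀
  have hf' : ∀ φ : 𝓓(Ω, ℝ), ζ φ = -(∫ t, deriv φ t • evalSeries A (brownian q t)) -
      ∑ i, ∑ j, (C i j + C j i) • ∫ t, φ t • deltaR q n (deriv₂ A i j (brownian q t)) := fun φ => by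
    rw [hf, integral_itoCorrection q C hA hΩ]
  refine ⟨fun φ => by rw [hf', sub_add_cancel], fun ρ hρ =>
    ⟨fun ε hε t ht => hρ.hasDerivAt_evalSeries q hA hε ht, fun l r hlr φ => ?_⟩⟩
  have hB : Continuous fun t => (brownian q t : Fin n → Alg q n) :=
    continuous_pi (continuous_brownian q)
  obtain ⟨h1, h2, h3⟩ := hA.tendsto_integral (L := 𝓝[>] (0 : ℝ)) hB
    (Y := fun ε t => brownianM q ρ ε t) (Y' := fun ε t i => noiseM q ρ ε i t) (by
      filter_upwards [hρ.eventually_isKernel] with ε h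
      refine ⟨fun t i => h.hasDerivAt_brownianM q t i, continuous_pi fun i => ?_⟩
      simp only [noiseM_eq]
      exact h.continuous_noiseL_molNoise q i)
    (hρ.tendstoUniformly_brownianM q) (testFunction_contDiff φ) φ.hasCompactSupport
    (fun t ht => hΩ t (φ.tsupport_subset ht)) (deltaQ q n)
  rw [hf']
  refine (h1.sub (tendsto_finsetSum Finset.univ fun i _ => tendsto_finsetSum Finset.univ fun j _ =>
    ((hlr i j).1.add (hlr i j).2).smul (h2 i j))).congr' ?_
  filter_upwards [h3] with ε h
  have e := integral_smul_sum (fun i j => l ε i j + r ε i j) h.2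
  refine (congrArg _ e.symm).trans ?_
  rw [← integral_sub h.1 (integrable_smul_sum _ h.2)]
  simp only [deltaR, smul_sub]
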